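/- **Setting.** Let $n\in\{2,3\}$, let $\Omega\subset\mathbb R^n$ be a bounded open convex set, and let $\Gamma\subset\Omega$ be a closed (compact, without boundary) Lipschitz surface of co-dimension one; write $d(x)=\operatorname{dist}(x,\Gamma)$. For an open set $U$, $s\in\mathbb N$ and $\alpha\in\mathbb R$ put, with distributional derivatives, $$|u|_{s,\alpha,U}=\Big(\sum_{|\gamma|=s}\int_U |D^\gamma u|^2 d^{2\alpha}\,dx\Big)^{1/2},\qquad |||u|||_{s,\alpha,U}=\Big(\sum_{j=0}^{s}|u|_{j,\alpha-s+j,U}^2\Big)^{1/2},$$ and let $V^s_\alpha$ be the space of functions for which the latter norm, taken over $\Omega\setminus\Gamma$, is finite. Let $\Omega_h$ be a conforming decomposition of $\overline\Omega$ into finitely many cells $K$, each an affine image $F_K([0,1]^n)$, where two different cells are disjoint or meet in a common proper face. Let $h_K=\operatorname{diam}K$ and let $\rho_K$ be the radius of the largest ball in $K$. Assume that, with constants $C_s,c_1,c_2$ $(c_1>0)$ independent of the mesh, the mesh size $h>0$ satisfies $\rho_K\le h\le C_s\rho_K$ and $c_1h\le h_K\le c_2h$ for all $K$. Fix $\sigma>c_2$,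 let $\Omega_h^{\rm in}$ be the set of cells with $\max_{x\in K}d(x)\le\sigma h$, and let $\Omega_h^{\rm out}$ be the set of the other cells. For $r\in\mathbb N$ let $W_h^r\subset H^1_0(\Omega)$ be the space of continuous functions that vanish on $\partial\Omega$ and are, on each cell $K$, of the form $q\circ F_K^{-1}$ with $q$ a polynomial of degree at most $r$ in each variable. Let $x_i$ be its nodal points (the points of $\Omega$ that are images under some $F_K$ of points with coordinates in $\{0,1/r,\dots,1\}$), and let $\phi_i\in W_h^r$ be the nodal basis, $\phi_i(x_j)=\delta_{ij}$. For $u\in H^{k+1}(\Omega\setminus\Gamma)\cap V^\ell_\epsilon$ with continuous representative $u$ on $\overline\Omega\setminus\Gamma$ put $$\Pi_hu=\sum_{i\,:\;x_i\in K'\text{ for some }K'\in\Omega_h^{\rm out}}u(x_i)\,\phi_i .$$ **Theorem.** Let $r\ge k$, and let $\ell\le k+1$ be such that the embedding $H^\ell(\Omega)\hookrightarrow L^\infty(\Omega)$ is continuous. Let $m\le\ell$, $\alpha\in(-\frac12,\frac12)$ and $\epsilon\le\alpha$. Then there is a constant $C>0$, depending on $n,\Omega,\Gamma,k,\ell,m,r,\alpha,\epsilon,\sigma,C_s,c_1,c_2$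 but not on the mesh, on $h$, on $K$ or on $u$, such that for all such meshes and all $u\in H^{k+1}(\Omega\setminus\Gamma)\cap V^\ell_\epsilon$: 1. for every $K\in\Omega_h^{\rm out}$ such that $u=0$ on $K\cap\partial\Omega$ (hence for every $K\in\Omega_h^{\rm out}$ if $u=0$ on $\partial\Omega$), $$|u-\Pi_hu|_{m,0,K}\le C\,h_K^{\,k+1-m}\,|u|_{k+1,0,K};$$ 2. for every $K\in\Omega_h^{\rm in}$, $$|\Pi_hu|_{m,\alpha,K}\le C\,h_K^{\,\ell-m+\alpha-\epsilon}\,|||u|||_{\ell,\epsilon,\Delta_K},$$ where $\Delta_K$ is the union of the interiors of the cells $K'\in\Omega_h^{\rm out}$ with $K'\cap K\ne\emptyset$. -/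

import Mathlib

open MeasureTheory Set
open scoped ENNReal NNReal ContDiff

noncomputable section

namespace ImmersedFEM

/-- Euclidean space `ℝⁿ`. -/
abbrev E (n : ℕ) : Type := EuclideanSpace ℝ (Fin n)

/-! ### Weak derivatives and weighted Sobolev seminorms -/

/-- The classical partial derivative `∂ᵢ f`. -/
def pderiv {n : ℕ} (i : Fin n) (f : E n → ℝ) : E n → ℝ :=
  fun x => fderiv ℝ f x (EuclideanSpace.single i 1)

/-- The classical derivative `D^γ f` for a multi-index `γ` (used for smooth `f` only). -/
def multiDeriv {n : ℕ} (γ : Fin n → ℕ) (f : E n → ℝ) : E n → ℝ :=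
  (List.finRange n).foldr (fun i g => (pderiv i)^[γ i] g) f

/-- `g` is the distributional derivative `D^γ u` on the open set `U`. -/
def IsWeakDeriv {n : ℕ} (γ : Fin n → ℕ) (U : Set (E n)) (u g : E n → ℝ) : Prop :=
  LocallyIntegrableOn u U ∧ LocallyIntegrableOn g U ∧
    ∀ φ : E n → ℝ, ContDiff ℝ ∞ φ → HasCompactSupport φ → tsupport φ ⊆ U →
      ∫ x in U, u x * multiDeriv γ φ x = (-1 : ℝ) ^ (∑ i, γ i) * ∫ x in U, g x * φ x

/-- The squared weighted norm `‖g‖²_{0,α,U} = ∫_U g² d^{2α}`, with `d = dist(·, Γ)`. -/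
def wNormSq {n : ℕ} (Γ : Set (E n)) (α : ℝ) (U : Set (E n)) (g : E n → ℝ) : ℝ≥0∞ :=
  ∫⁻ x in U, ‖g x‖ₑ ^ 2 * Metric.infEDist x Γ ^ (2 * α)

/-- The seminorm `|u|_{s,α,U} = (∑_{|γ|=s} ‖D^γ u‖²_{0,α,U})^{1/2}`, with values in `[0, ∞]`.
The weak derivative is unique up to null sets, so the infimum is over a single value; it is `∞`
if there is no weak derivative. -/
def semi {n : ℕ} (Γ : Set (E n)) (s : ℕ) (α : ℝ) (U : Set (E n)) (u : E n → ℝ) : ℝ≥0∞ :=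
  (∑ γ ∈ Finset.piAntidiag (Finset.univ : Finset (Fin n)) s,
    ⨅ (g : E n → ℝ) (_ : IsWeakDeriv γ U u g), wNormSq Γ α U g) ^ (1 / 2 : ℝ)

/-- The unweighted seminorm `|u|_{s,0,U}`. -/
def semi0 {n : ℕ} (s : ℕ) (U : Set (E n)) (u : E n → ℝ) : ℝ≥0∞ :=
  (∑ γ ∈ Finset.piAntidiag (Finset.univ : Finset (Fin n)) s,
    ⨅ (g : E n → ℝ) (_ : IsWeakDeriv γ U u g), ∫⁻ x in U, ‖g x‖ₑ ^ 2) ^ (1 / 2 : ℝ)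

/-- The norm of `H^s(U)` (infinite if `u ∉ H^s(U)`). -/
def sobNorm {n : ℕ} (s : ℕ) (U : Set (E n)) (u : E n → ℝ) : ℝ≥0∞ :=
  (∑ j ∈ Finset.range (s + 1), semi0 j U u ^ 2) ^ (1 / 2 : ℝ)

/-- `u ∈ H^s(U)`. -/
def MemH {n : ℕ} (s : ℕ) (U : Set (E n)) (u : E n → ℝ) : Prop := sobNorm s U u < ⊤

/-- The Kondratiev type norm
`|||u|||_{s,α,U} = (∑_{j=0}^s |u|²_{j,α-s+j,U})^{1/2}` (infinite if `u ∉ V^s_α(U)`). -/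
def kondNorm {n : ℕ} (Γ : Set (E n)) (s : ℕ) (α : ℝ) (U : Set (E n)) (u : E n → ℝ) : ℝ≥0∞ :=
  (∑ j ∈ Finset.range (s + 1), semi Γ j (α - s + j) U u ^ 2) ^ (1 / 2 : ℝ)

/-- `u ∈ V^s_α(U)`. -/
def MemV {n : ℕ} (Γ : Set (E n)) (s : ℕ) (α : ℝ) (U : Set (E n)) (u : E n → ℝ) : Prop :=
  kondNorm Γ s α U u < ⊤

/-- The embedding `H^s(Ω) ↪ L^∞(Ω)` is continuous. -/
def EmbedsInLinfty {n : ℕ} (s : ℕ) (Ω : Set (E n)) : Prop :=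
  ∃ C : ℝ≥0, ∀ u : E n → ℝ, MemH s Ω u →
    eLpNorm u ⊤ (volume.restrict Ω) ≤ C * sobNorm s Ω u

/-! ### The interface -/

/-- `Γ` is a closed Lipschitz surface of co-dimension one: it is compact and, near each of its
points, it is the graph of a Lipschitz function over a hyperplane `ν^⊥`. -/
def IsClosedLipschitzSurface {n : ℕ} (Γ : Set (E n)) : Prop :=
  IsCompact Γ ∧ ∀ x ∈ Γ, ∃ (ν : E n) (L : ℝ≥0) (g : E n → ℝ) (ρ : ℝ),
    ‖ν‖ = 1 ∧ 0 < ρ ∧ LipschitzWith L g ∧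
    ∀ y ∈ Metric.ball x ρ, y ∈ Γ ↔ inner ℝ ν y = g (y - inner ℝ ν y • ν)

/-- The continuous representative, on `closure Ω \ Γ`, of a function `u` on `Ω`. On this set it
is unique if it exists. -/
def contRep {n : ℕ} (Ω Γ : Set (E n)) (u : E n → ℝ) : E n → ℝ :=
  open Classical in
  if h : ∃ w : E n → ℝ, ContinuousOn w (closure Ω \ Γ) ∧ w =ᵐ[volume.restrict (Ω \ Γ)] u
  then h.choose else u

/-! ### Meshes -/

/-- The reference cell `[0,1]ⁿ`. -/
def refCube (n : ℕ) : Set (E n) := {x | ∀ i, 0 ≤ x i ∧ x i ≤ 1}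

/-- The closed face of the reference cell on which the coordinates `xᵢ` with `s i = some b` are
fixed, to `1` or to `0`, and the other coordinates are free. -/
def refFace {n : ℕ} (s : Fin n → Option Bool) : Set (E n) :=
  {x | x ∈ refCube n ∧ ∀ i b, s i = some b → x i = if b then 1 else 0}

/-- A conforming decomposition of `Ω` into finitely many cells, which are the images of the
reference cell under affine transformations. -/
structure Mesh {n : ℕ} (Ω : Set (E n)) where
  /-- the number of cells -/
  N : ℕ
  /-- the affine transformations from the reference cell -/
  F : Fin N → (E n ≃ᵃ[ℝ] E n)
  cover : closure Ω = ⋃ i, F i '' refCube n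
  /-- two different cells are disjoint, or meet in a common proper face (of any dimension) -/
  conforming : ∀ i j, i ≠ j → (F i '' refCube n) ∩ (F j '' refCube n) = ∅ ∨
    ∃ s t : Fin n → Option Bool, (∃ a, s a ≠ none) ∧ (∃ a, t a ≠ none) ∧
      (F i '' refCube n) ∩ (F j '' refCube n) = F i '' refFace s ∧
      (F i '' refCube n) ∩ (F j '' refCube n) = F j '' refFace t

namespace Mesh

variable {n : ℕ} {Ω : Set (E n)} (M : Mesh Ω)

/-- The (closed) cell `K`. -/
def cell (K : Fin M.N) : Set (E n) := M.F K '' refCube n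

/-- `h_K = diam K`. -/
def hK (K : Fin M.N) : ℝ := Metric.diam (M.cell K)

/-- `ρ_K`, the radius of the largest ball contained in `K`. -/
def rhoK (K : Fin M.N) : ℝ := sSup {ρ : ℝ | ∃ x, Metric.ball x ρ ⊆ M.cell K}

/-- The mesh, with mesh size `h`, is shape regular and quasi-uniform with the given constants:
`ρ_K ≤ h ≤ Cs ρ_K` and `c₁ h ≤ h_K ≤ c₂ h` for all cells `K`. -/
structure Regular (h Cs c₁ c₂ : ℝ) : Prop where
  h_pos : 0 < h
  shape : ∀ K, M.rhoK K ≤ h ∧ h ≤ Cs * M.rhoK K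
  quasiUniform : ∀ K, c₁ * h ≤ M.hK K ∧ M.hK K ≤ c₂ * h

/-- `K ∈ Ω_h^in`: `max_{x ∈ K} dist(x, Γ) ≤ σ h`. -/
def IsIn (Γ : Set (E n)) (σ h : ℝ) (K : Fin M.N) : Prop :=
  (⨆ x ∈ M.cell K, Metric.infEDist x Γ) ≤ ENNReal.ofReal (σ * h)

/-- `Δ_K`, the (interior of the) elements of `Ω_h^out` whose closure meets that of `K`. -/
def patch (Γ : Set (E n)) (σ h : ℝ) (K : Fin M.N) : Set (E n) :=
  ⋃ K' ∈ {K' : Fin M.N | ¬ M.IsIn Γ σ h K' ∧ (M.cell K' ∩ M.cell K).Nonempty},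
    interior (M.cell K')

/-- The finite element space `W_h^r`: functions in `H¹₀(Ω)` (as they are piecewise polynomial, this
means continuous, zero on `∂Ω`, and they are extended by zero outside `Ω`) that belong to
`𝒬^r(K)` on each cell `K`, i.e. that are there a polynomial of degree at most `r` in each
reference coordinate. -/
def feSpace (r : ℕ) : Set (E n → ℝ) :=
  {v | Continuous v ∧ (∀ x, x ∉ Ω → v x = 0) ∧
    ∀ K, ∃ p : MvPolynomial (Fin n) ℝ, (∀ i, p.degreeOf i ≤ r) ∧
      ∀ x ∈ M.cell K, v x = MvPolynomial.eval (fun i => (M.F K).symm x i) p}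

open Classical in
/-- The nodal points of `W_h^r`: the images in the cells of the points of `[0,1]ⁿ` with coordinates
in `{0, 1/r, …, 1}`, except those on `∂Ω`. -/
def nodes (r : ℕ) : Finset (E n) :=
  ((Finset.univ : Finset (Fin M.N × (Fin n → Fin (r + 1)))).image
    fun q => M.F q.1 (WithLp.toLp 2 fun i => ((q.2 i : ℕ) : ℝ) / r)).filter (· ∈ Ω)

/-- The nodal basis function of `W_h^r` at the node `p`: the element of `W_h^r` that is `1`
at `p` and `0` at the other nodes. -/
def nodalBasis (r : ℕ) (p : E n) : E n → ℝ :=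
  open Classical in
  if h : ∃ v ∈ M.feSpace r, ∀ q ∈ M.nodes r, v q = if q = p then 1 else 0
  then h.choose else 0

open Classical in
/-- The operator `Π_h u = ∑_{i : xᵢ ∈ Ω_h^out} u(xᵢ) φᵢ`. -/
def interp (Γ : Set (E n)) (σ h : ℝ) (r : ℕ) (u : E n → ℝ) : E n → ℝ :=
  fun x => ∑ p ∈ (M.nodes r).filter (fun p => ∃ K, ¬ M.IsIn Γ σ h K ∧ p ∈ M.cell K),
    contRep Ω Γ u p * M.nodalBasis r p x

end Mesh

end ImmersedFEM

end

noncomputable section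

namespace ImmersedFEM

/-! ### Partial derivatives of smooth functions -/

section Derivatives

variable {n : ℕ}

/-! Since `n ≥ 2`, `H¹` does not embed into `L^∞`, so the embedding hypothesis forces `l ≥ 2`
(`two_le_of_embedsInLinfty`) and hence `k ≥ 1`. Since `n ≤ 3`, two derivatives in `L²` do control
point values. All use of point values therefore rests on a scale-invariant embedding of `H²` into
the continuous functions on convex sets (`sobolev_sup`).

The Sobolev estimates are made directly on the physical cells. In a regular mesh the interior of a
cell is convex, has diameter at most `c₂ h` and volume at least `κ (c₂ h)^n` with one `κ` for all
cells (`Mesh.Regular.fatConvex`). The inequalities `poincare`, `bramble_hilbert` and `sobolev_sup`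
depend on the set only through `κ` and explicit powers of the diameter bound. Only the shape
functions are compared with the reference cell; there `m` derivatives cost `h^(-m)`
(`exists_multiDeriv_cellShape_le`).

On each cell the interpolant is the Lagrange interpolant of its nodal values
(`interp_eq_sum_shape`). This requires the nodal basis to exist (`exists_nodal`). On a common face,
the affine map between the reference coordinates of two cells only permutes, reflects or fixes
coordinates, so grid points go to grid points (`grid_map`) and the local Lagrange functions fit
together. They vanish on the boundary of `Ω` by a supporting hyperplane argument
(`localBasis_eq_zero`).

Away from `Γ`, an outer cell keeps a distance of at least `(σ - c₂) h`, so `u` is `H^(k+1)` there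
and the nodal values are those of `u`. A polynomial `p` of degree at most `k ≤ r` is reproduced, so
the error is `u - p` minus the interpolant of `u - p`. The first term is bounded by
`bramble_hilbert`, the second by the supremum of `u - p` times `h^(-m)`.

Near `Γ`, only nodes shared with an outer cell count. On such a neighbour the distance is comparable
to `h`, the weights are constants up to factors, and nodal values are at most `C h^(l - ε - n/2)`
times the weighted norm (`exists_abs_nodeVal_le`). The rest is the bound `C h^(2α + n)` for the
integral of `d^(2α)` over a cell (`exists_lintegral_dist_rpow_le`). It holds for `α > -1/2` because,
inside a ball of radius `R`, a tube of width `t` about a Lipschitz surface has volume at most `C t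
R^(n-1)`. -/

theorem contDiff_pderiv {f : E n → ℝ} (hf : ContDiff ℝ ∞ f) (i : Fin n) :
    ContDiff ℝ ∞ (pderiv i f) :=
  (hf.fderiv_right (by simp)).clm_apply contDiff_const

theorem contDiff_pderiv_iterate {f : E n → ℝ} (hf : ContDiff ℝ ∞ f) (i : Fin n) (k : ℕ) :
    ContDiff ℝ ∞ ((pderiv i)^[k] f) := by
  induction k with
  | zero => exact hf
  | succ k ih => rw [Function.iterate_succ_apply']; exact contDiff_pderiv ih i

theorem contDiff_foldr_pderiv {f : E n → ℝ} (hf : ContDiff ℝ ∞ f) (γ : Fin n → ℕ)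
    (L : List (Fin n)) : ContDiff ℝ ∞ (L.foldr (fun i g => (pderiv i)^[γ i] g) f) := by
  induction L with
  | nil => exact hf
  | cons a L ih => exact contDiff_pderiv_iterate ih a _

theorem contDiff_multiDeriv {f : E n → ℝ} (hf : ContDiff ℝ ∞ f) (γ : Fin n → ℕ) :
    ContDiff ℝ ∞ (multiDeriv γ f) :=
  contDiff_foldr_pderiv hf γ _

theorem pderiv_comm {f : E n → ℝ} (hf : ContDiff ℝ ∞ f) (i j : Fin n) :
    pderiv i (pderiv j f) = pderiv j (pderiv i f) := by
  have key : ∀ (a b : Fin n) (x : E n), pderiv a (pderiv b f) x =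
      fderiv ℝ (fderiv ℝ f) x (EuclideanSpace.single a 1) (EuclideanSpace.single b 1) := by
    intro a b x
    have h1 : DifferentiableAt ℝ (fderiv ℝ f) x :=
      ((hf.fderiv_right (m := ∞) (by simp)).differentiable (by simp)) x
    have h2 : pderiv b f = fun y => fderiv ℝ f y (EuclideanSpace.single b 1) := rfl
    rw [h2, pderiv, fderiv_clm_apply h1 (differentiableAt_const _)]
    simp
  funext x
  rw [key, key]
  exact ((contDiff_infty.1 hf 2).contDiffAt.isSymmSndFDerivAt (by simp)) _ _

theorem pderiv_iterate_comm {f : E n → ℝ} (hf : ContDiff ℝ ∞ f) (i j : Fin n) (k : ℕ) :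
    pderiv i ((pderiv j)^[k] f) = (pderiv j)^[k] (pderiv i f) := by
  induction k with
  | zero => rfl
  | succ k ih =>
    rw [Function.iterate_succ_apply', Function.iterate_succ_apply',
      pderiv_comm (contDiff_pderiv_iterate hf j k), ih]

theorem pderiv_foldr_comm {f : E n → ℝ} (hf : ContDiff ℝ ∞ f) (γ : Fin n → ℕ) (i : Fin n)
    (L : List (Fin n)) : pderiv i (L.foldr (fun i g => (pderiv i)^[γ i] g) f) =
      L.foldr (fun i g => (pderiv i)^[γ i] g) (pderiv i f) := by
  induction L with
  | nil => rfl
  | cons a L ih =>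
    simp only [List.foldr_cons]
    rw [pderiv_iterate_comm (contDiff_foldr_pderiv hf γ L), ih]

theorem pderiv_multiDeriv {f : E n → ℝ} (hf : ContDiff ℝ ∞ f) (γ : Fin n → ℕ) (i : Fin n) :
    pderiv i (multiDeriv γ f) = multiDeriv γ (pderiv i f) :=
  pderiv_foldr_comm hf γ i _

/-- The fold applies the derivatives in a fixed order, so the additional one has to be commuted to
the innermost place. `Nodup` ensures that it is met only once. -/
theorem foldr_pderiv_add_single {f : E n → ℝ} (hf : ContDiff ℝ ∞ f) (γ : Fin n → ℕ) (i : Fin n)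
    (L : List (Fin n)) (hL : L.Nodup) :
    L.foldr (fun j g => (pderiv j)^[(γ + Pi.single i 1 : Fin n → ℕ) j] g) f =
      if i ∈ L then L.foldr (fun j g => (pderiv j)^[γ j] g) (pderiv i f)
      else L.foldr (fun j g => (pderiv j)^[γ j] g) f := by
  induction L with
  | nil => simp
  | cons a L ih =>
    have ha := (List.nodup_cons.1 hL).1
    simp only [List.foldr_cons, ih (List.nodup_cons.1 hL).2]
    by_cases hai : a = i
    · subst hai
      simp only [ha, if_false, List.mem_cons, true_or, if_true, Pi.add_apply, Pi.single_eq_same]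
      rw [Function.iterate_succ_apply, pderiv_foldr_comm hf]
    · have : i ≠ a := fun h => hai h.symm
      by_cases hiL : i ∈ L <;> simp [this, hiL, hai]

theorem multiDeriv_add_single {f : E n → ℝ} (hf : ContDiff ℝ ∞ f) (γ : Fin n → ℕ) (i : Fin n) :
    multiDeriv (γ + Pi.single i 1) f = multiDeriv γ (pderiv i f) := by
  have := foldr_pderiv_add_single hf γ i (List.finRange n) (List.nodup_finRange n)
  rwa [if_pos (List.mem_finRange i)] at this

theorem multiDeriv_zero (f : E n → ℝ) : multiDeriv 0 f = f := by
  have : ∀ L : List (Fin n), L.foldr (fun i g => (pderiv i)^[(0 : Fin n → ℕ) i] g) f = f := by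
    intro L
    induction L with
    | nil => rfl
    | cons a L ih => simp
  exact this _

theorem multiDeriv_single {f : E n → ℝ} (hf : ContDiff ℝ ∞ f) (i : Fin n) :
    multiDeriv (Pi.single i 1) f = pderiv i f := by
  have := multiDeriv_add_single hf 0 i
  rwa [zero_add, multiDeriv_zero] at this

theorem exists_eq_add_single {γ : Fin n → ℕ} {s : ℕ} (h : ∑ i, γ i = s + 1) :
    ∃ (i : Fin n) (δ : Fin n → ℕ), γ = δ + Pi.single i 1 ∧ ∑ i, δ i = s := by
  have : ∃ i, γ i ≠ 0 := by
    by_contra! hc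
    simp [hc] at h
  obtain ⟨i, hi⟩ := this
  have e : γ = (γ - Pi.single i 1) + Pi.single i 1 := by
    funext j
    by_cases hj : j = i
    · subst hj; simp; omega
    · simp [hj]
  refine ⟨i, γ - Pi.single i 1, e, ?_⟩
  have h2 : ∑ j, γ j = ∑ j, (γ - Pi.single i 1 : Fin n → ℕ) j + ∑ j, (Pi.single i 1 : Fin n → ℕ) j := by
    rw [← Finset.sum_add_distrib]
    exact Finset.sum_congr rfl fun j _ => congrFun e j
  rw [Finset.sum_pi_single'] at h2
  simp at h2 h
  simp
  omega

theorem sum_add_single (γ : Fin n → ℕ) (i : Fin n) :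
    ∑ j, (γ + Pi.single i 1 : Fin n → ℕ) j = ∑ j, γ j + 1 := by
  simp [Finset.sum_add_distrib, Finset.sum_pi_single']

/-- Induction over multi-indices, adding one unit vector at a time. -/
theorem multiIndex_induction {P : (Fin n → ℕ) → Prop} (h0 : P 0)
    (hs : ∀ γ i, P γ → P (γ + Pi.single i 1)) (γ : Fin n → ℕ) : P γ := by
  have : ∀ s (γ : Fin n → ℕ), ∑ i, γ i = s → P γ := by
    intro s
    induction s with
    | zero =>
      intro γ h
      have : γ = 0 := by funext i; exact (Finset.sum_eq_zero_iff.1 h) i (Finset.mem_univ i)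
      rwa [this]
    | succ s ih =>
      intro γ h
      obtain ⟨i, δ, rfl, hδ⟩ := exists_eq_add_single h
      exact hs _ _ (ih δ hδ)
  exact this _ γ rfl

theorem pderiv_add {f g : E n → ℝ} (hf : ContDiff ℝ ∞ f) (hg : ContDiff ℝ ∞ g) (i : Fin n) :
    pderiv i (fun x => f x + g x) = fun x => pderiv i f x + pderiv i g x := by
  funext x
  have : fderiv ℝ (fun x => f x + g x) x = fderiv ℝ f x + fderiv ℝ g x :=
    fderiv_add (hf.differentiable (by simp) x) (hg.differentiable (by simp) x)
  simp [pderiv, this]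

theorem multiDeriv_add {f g : E n → ℝ} (hf : ContDiff ℝ ∞ f) (hg : ContDiff ℝ ∞ g)
    (γ : Fin n → ℕ) :
    multiDeriv γ (fun x => f x + g x) = fun x => multiDeriv γ f x + multiDeriv γ g x := by
  induction γ using multiIndex_induction generalizing f g with
  | h0 => simp [multiDeriv_zero]
  | hs γ i ih =>
    rw [multiDeriv_add_single (hf.add hg), multiDeriv_add_single hf, multiDeriv_add_single hg,
      pderiv_add hf hg, ih (contDiff_pderiv hf i) (contDiff_pderiv hg i)]

theorem pderiv_const_mul {f : E n → ℝ} (hf : ContDiff ℝ ∞ f) (c : ℝ) (i : Fin n) :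
    pderiv i (fun x => c * f x) = fun x => c * pderiv i f x := by
  funext x
  have : fderiv ℝ (fun x => c * f x) x = c • fderiv ℝ f x :=
    fderiv_const_mul (hf.differentiable (by simp) x) c
  simp [pderiv, this]

theorem multiDeriv_const_mul {f : E n → ℝ} (hf : ContDiff ℝ ∞ f) (c : ℝ) (γ : Fin n → ℕ) :
    multiDeriv γ (fun x => c * f x) = fun x => c * multiDeriv γ f x := by
  induction γ using multiIndex_induction generalizing f with
  | h0 => simp [multiDeriv_zero]
  | hs γ i ih =>
    rw [multiDeriv_add_single (contDiff_const.mul hf), multiDeriv_add_single hf,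
      pderiv_const_mul hf, ih (contDiff_pderiv hf i)]

theorem multiDeriv_sum {ι : Type*} (s : Finset ι) {f : ι → E n → ℝ}
    (hf : ∀ a, ContDiff ℝ ∞ (f a)) (c : ι → ℝ) (γ : Fin n → ℕ) :
    multiDeriv γ (fun x => ∑ a ∈ s, c a * f a x) = fun x => ∑ a ∈ s, c a * multiDeriv γ (f a) x := by
  classical
  induction s using Finset.induction_on with
  | empty =>
    have := multiDeriv_const_mul (n := n) (f := fun _ => 0) contDiff_const 0 γ
    simpa using this
  | insert a s ha ih =>
    simp only [Finset.sum_insert ha]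
    rw [multiDeriv_add (contDiff_const.mul (hf a))
      (ContDiff.sum fun a _ => contDiff_const.mul (hf a)), multiDeriv_const_mul (hf a), ih]

/-- Each partial derivative is `fderiv` followed by evaluation at a unit vector, a functional of
norm at most one. This gives access to the chain rule bounds for `iteratedFDeriv`. -/
theorem abs_multiDeriv_le {f : E n → ℝ} (hf : ContDiff ℝ ∞ f) (γ : Fin n → ℕ) (x : E n) :
    |multiDeriv γ f x| ≤ ‖iteratedFDeriv ℝ (∑ i, γ i) f x‖ := by
  have step : ∀ (g : E n → ℝ) (_ : ContDiff ℝ ∞ g) (i : Fin n) (s : ℕ),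
      ‖iteratedFDeriv ℝ s (pderiv i g) x‖ ≤ ‖iteratedFDeriv ℝ (s + 1) g x‖ := by
    intro g hg i s
    rw [← norm_iteratedFDeriv_fderiv]
    let Λ : (E n →L[ℝ] ℝ) →L[ℝ] ℝ :=
      ContinuousLinearMap.apply ℝ ℝ (EuclideanSpace.single i (1 : ℝ) : E n)
    have e : pderiv i g = Λ ∘ fderiv ℝ g := rfl
    rw [e]
    refine (ContinuousLinearMap.norm_iteratedFDeriv_comp_left (𝕜 := ℝ) Λ
      (hg.fderiv_right (m := ∞) (by simp)).contDiffAt (by exact_mod_cast le_top)).trans ?_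
    have : ‖Λ‖ ≤ 1 := by
      refine ContinuousLinearMap.opNorm_le_bound _ zero_le_one fun T => ?_
      have := T.le_opNorm (EuclideanSpace.single i (1 : ℝ) : E n)
      simpa [Λ] using this
    exact mul_le_of_le_one_left (norm_nonneg _) this
  induction γ using multiIndex_induction generalizing f with
  | h0 =>
    have h0 : ∑ i, (0 : Fin n → ℕ) i = 0 := by simp
    rw [h0, multiDeriv_zero, norm_iteratedFDeriv_zero, Real.norm_eq_abs]
  | hs γ i ih =>
    rw [multiDeriv_add_single hf, sum_add_single]
    exact (ih (contDiff_pderiv hf i)).trans (step f hf i _)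

theorem tsupport_pderiv_subset (i : Fin n) (f : E n → ℝ) :
    tsupport (pderiv i f) ⊆ tsupport f := by
  refine (closure_mono ?_).trans (tsupport_fderiv_subset ℝ (f := f))
  intro x hx
  simp only [Function.mem_support, pderiv] at hx ⊢
  intro h
  simp [h] at hx

theorem tsupport_multiDeriv_subset {f : E n → ℝ} (hf : ContDiff ℝ ∞ f) (γ : Fin n → ℕ) :
    tsupport (multiDeriv γ f) ⊆ tsupport f := by
  induction γ using multiIndex_induction generalizing f with
  | h0 => simp [multiDeriv_zero]
  | hs γ i ih =>
    rw [multiDeriv_add_single hf]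
    exact (ih (contDiff_pderiv hf i)).trans (tsupport_pderiv_subset i f)

theorem hasCompactSupport_pderiv {f : E n → ℝ} (hf : HasCompactSupport f) (i : Fin n) :
    HasCompactSupport (pderiv i f) :=
  hf.of_isClosed_subset (isClosed_tsupport _) (tsupport_pderiv_subset i f)

end Derivatives

/-! ### Weak derivatives -/

section Weak

variable {n : ℕ} {U V : Set (E n)} {u v g g' : E n → ℝ} {γ : Fin n → ℕ}

theorem integrable_mul_of_tsupport_subset {φ : E n → ℝ}
    (hu : LocallyIntegrableOn u U) (hφ : Continuous φ) (hc : HasCompactSupport φ)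
    (hs : tsupport φ ⊆ U) : Integrable (fun x => u x * φ x) (volume.restrict U) := by
  have h1 : IntegrableOn (fun x => u x * φ x) (tsupport φ) :=
    (hu.integrableOn_compact_subset hs hc).mul_continuousOn hφ.continuousOn hc
  have h2 : Integrable (fun x => u x * φ x) := by
    rw [← integrableOn_iff_integrable_of_support_subset (s := tsupport φ)]
    · exact h1
    · intro x hx
      apply subset_tsupport
      simp only [Function.mem_support] at hx ⊢
      exact right_ne_zero_of_mul hx
  exact h2.integrableOn

theorem IsWeakDeriv.setIntegral_eq {φ : E n → ℝ} (hφ : tsupport φ ⊆ U) (u : E n → ℝ) :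
    ∫ x in U, u x * φ x = ∫ x, u x * φ x := by
  refine setIntegral_eq_integral_of_forall_compl_eq_zero fun x hx => ?_
  rw [image_eq_zero_of_notMem_tsupport fun h => hx (hφ h), mul_zero]

theorem IsWeakDeriv.mono (h : IsWeakDeriv γ U u g) (hV : V ⊆ U) : IsWeakDeriv γ V u g := by
  refine ⟨h.1.mono_set hV, h.2.1.mono_set hV, fun φ hφ hc hs => ?_⟩
  have := h.2.2 φ hφ hc (hs.trans hV)
  rw [setIntegral_eq (hs.trans hV), setIntegral_eq
    (((tsupport_multiDeriv_subset hφ γ).trans hs).trans hV)] at this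
  rw [setIntegral_eq hs, setIntegral_eq ((tsupport_multiDeriv_subset hφ γ).trans hs)]
  exact this

theorem IsWeakDeriv.congr (h : IsWeakDeriv γ U u g) (hu : u =ᵐ[volume.restrict U] v)
    (hg : g =ᵐ[volume.restrict U] g') : IsWeakDeriv γ U v g' := by
  refine ⟨h.1.congr hu, h.2.1.congr hg, fun φ hφ hc hs => ?_⟩
  have e1 : ∫ x in U, v x * multiDeriv γ φ x = ∫ x in U, u x * multiDeriv γ φ x :=
    integral_congr_ae (by filter_upwards [hu] with x hx; rw [hx])
  have e2 : ∫ x in U, g' x * φ x = ∫ x in U, g x * φ x :=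
    integral_congr_ae (by filter_upwards [hg] with x hx; rw [hx])
  rw [e1, e2]
  exact h.2.2 φ hφ hc hs

/-- The fundamental lemma of the calculus of variations. By it the infima in `semi` and `semi0` can
be evaluated at any chosen weak derivative. -/
theorem IsWeakDeriv.ae_eq (hU : IsOpen U) (h : IsWeakDeriv γ U u g) (h' : IsWeakDeriv γ U u g') :
    g =ᵐ[volume.restrict U] g' := by
  have := hU.ae_eq_zero_of_integral_contDiff_smul_eq_zero (μ := volume)
    (h.2.1.sub h'.2.1) (fun φ hφ hc hs => ?_)
  · rw [Filter.EventuallyEq, ae_restrict_iff' hU.measurableSet]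
    filter_upwards [this] with x hx hxU
    exact sub_eq_zero.1 (hx hxU)
  · have e := (h.2.2 φ hφ hc hs).symm.trans (h'.2.2 φ hφ hc hs)
    have e' := mul_left_cancel₀ (pow_ne_zero _ (by norm_num)) e
    have i1 := integrable_mul_of_tsupport_subset h.2.1 hφ.continuous hc hs
    have i2 := integrable_mul_of_tsupport_subset h'.2.1 hφ.continuous hc hs
    have : ∫ x, φ x • (g - g') x = ∫ x in U, (g x * φ x - g' x * φ x) := by
      rw [setIntegral_eq_integral_of_forall_compl_eq_zero]
      · refine integral_congr_ae (Filter.Eventually.of_forall fun x => ?_)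
        simp; ring
      · intro x hx
        rw [image_eq_zero_of_notMem_tsupport fun h => hx (hs h)]; ring
    rw [this, integral_sub i1 i2, e', sub_self]

theorem IsWeakDeriv.sub {a b : E n → ℝ} (h : IsWeakDeriv γ U u a) (h' : IsWeakDeriv γ U v b) :
    IsWeakDeriv γ U (fun x => u x - v x) (fun x => a x - b x) := by
  refine ⟨h.1.sub h'.1, h.2.1.sub h'.2.1, fun φ hφ hc hs => ?_⟩
  have hs' := (tsupport_multiDeriv_subset hφ γ).trans hs
  have hc' : HasCompactSupport (multiDeriv γ φ) :=
    hc.of_isClosed_subset (isClosed_tsupport _) (tsupport_multiDeriv_subset hφ γ)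
  have hcont := (contDiff_multiDeriv hφ γ).continuous
  simp only [sub_mul]
  rw [integral_sub (integrable_mul_of_tsupport_subset h.1 hcont hc' hs')
      (integrable_mul_of_tsupport_subset h'.1 hcont hc' hs'),
    integral_sub (integrable_mul_of_tsupport_subset h.2.1 hφ.continuous hc hs)
      (integrable_mul_of_tsupport_subset h'.2.1 hφ.continuous hc hs),
    h.2.2 φ hφ hc hs, h'.2.2 φ hφ hc hs]
  ring

theorem IsWeakDeriv.trans_single {i : Fin n} (h : IsWeakDeriv γ U u g)
    (h' : IsWeakDeriv (Pi.single i 1) U g g') : IsWeakDeriv (γ + Pi.single i 1) U u g' := by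
  refine ⟨h.1, h'.2.1, fun φ hφ hc hs => ?_⟩
  rw [multiDeriv_add_single hφ, h.2.2 _ (contDiff_pderiv hφ i) (hasCompactSupport_pderiv hc i)
    ((tsupport_pderiv_subset i φ).trans hs), ← multiDeriv_single hφ, h'.2.2 φ hφ hc hs,
    sum_add_single]
  simp [pow_succ]

/-- Testing with `pderiv i φ` relates the two orders. Higher derivatives can thus be treated one
first-order step at a time, which is how the Poincaré inequality is iterated. -/
theorem IsWeakDeriv.split_single {i : Fin n} (h : IsWeakDeriv γ U u g)
    (h' : IsWeakDeriv (γ + Pi.single i 1) U u g') : IsWeakDeriv (Pi.single i 1) U g g' := by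
  refine ⟨h.2.1, h'.2.1, fun φ hφ hc hs => ?_⟩
  have e1 := h.2.2 _ (contDiff_pderiv hφ i) (hasCompactSupport_pderiv hc i)
    ((tsupport_pderiv_subset i φ).trans hs)
  have e2 := h'.2.2 φ hφ hc hs
  rw [multiDeriv_add_single hφ, e1, sum_add_single, pow_succ, mul_assoc] at e2
  rw [multiDeriv_single hφ, mul_left_cancel₀ (pow_ne_zero _ (by norm_num)) e2]
  simp

theorem isWeakDeriv_zero (hu : LocallyIntegrableOn u U) : IsWeakDeriv 0 U u u :=
  ⟨hu, hu, fun φ _ _ _ => by simp [multiDeriv_zero]⟩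

theorem isWeakDeriv_single_of_contDiff {f : E n → ℝ} (hf : ContDiff ℝ ∞ f) (i : Fin n) :
    IsWeakDeriv (Pi.single i 1) U f (pderiv i f) := by
  have loc : ∀ {g : E n → ℝ}, Continuous g → LocallyIntegrableOn g U := fun hg =>
    hg.locallyIntegrable.locallyIntegrableOn U
  refine ⟨loc hf.continuous, loc (contDiff_pderiv hf i).continuous, fun φ hφ hc hs => ?_⟩
  rw [multiDeriv_single hφ, IsWeakDeriv.setIntegral_eq hs,
    IsWeakDeriv.setIntegral_eq ((tsupport_pderiv_subset i φ).trans hs)]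
  have hφ' := contDiff_pderiv hφ i
  have hf' := contDiff_pderiv hf i
  have := integral_mul_fderiv_eq_neg_fderiv_mul_of_integrable (μ := (volume : Measure (E n)))
    (f := f) (g := φ) (v := EuclideanSpace.single i 1)
    ((hf'.continuous.mul hφ.continuous).integrable_of_hasCompactSupport hc.mul_left)
    ((hf.continuous.mul hφ'.continuous).integrable_of_hasCompactSupport
      (hasCompactSupport_pderiv hc i).mul_left)
    ((hf.continuous.mul hφ.continuous).integrable_of_hasCompactSupport hc.mul_left)
    (fun x _ => hf.differentiable (by simp) x) (fun x _ => hφ.differentiable (by simp) x)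
  simpa [pderiv] using this

theorem isWeakDeriv_of_contDiff {f : E n → ℝ} (hf : ContDiff ℝ ∞ f) (γ : Fin n → ℕ) :
    IsWeakDeriv γ U f (multiDeriv γ f) := by
  induction γ using multiIndex_induction with
  | h0 =>
    rw [multiDeriv_zero]
    exact isWeakDeriv_zero (hf.continuous.locallyIntegrable.locallyIntegrableOn U)
  | hs γ i ih =>
    have := isWeakDeriv_single_of_contDiff (U := U) (contDiff_multiDeriv hf γ) i
    rw [pderiv_multiDeriv hf, ← multiDeriv_add_single hf] at this
    exact ih.trans_single this

/-! ### The seminorms in terms of a given family of weak derivatives -/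

theorem wNormSq_congr {Γ : Set (E n)} {α : ℝ} (h : g =ᵐ[volume.restrict U] g') :
    wNormSq Γ α U g = wNormSq Γ α U g' :=
  lintegral_congr_ae (by filter_upwards [h] with x hx; rw [hx])

theorem semi_eq {Γ : Set (E n)} (hU : IsOpen U) (s : ℕ) (α : ℝ) {G : (Fin n → ℕ) → E n → ℝ}
    (hG : ∀ γ, ∑ i, γ i = s → IsWeakDeriv γ U u (G γ)) :
    semi Γ s α U u = (∑ γ ∈ Finset.piAntidiag (Finset.univ : Finset (Fin n)) s,
      wNormSq Γ α U (G γ)) ^ (1 / 2 : ℝ) := by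
  unfold semi
  congr 1
  refine Finset.sum_congr rfl fun γ hγ => ?_
  have hγ' := hG γ (Finset.mem_piAntidiag.1 hγ).1
  refine le_antisymm (iInf₂_le _ hγ') (le_iInf₂ fun g hg => ?_)
  rw [wNormSq_congr (hγ'.ae_eq hU hg)]

theorem semi0_eq (hU : IsOpen U) (s : ℕ) {G : (Fin n → ℕ) → E n → ℝ}
    (hG : ∀ γ, ∑ i, γ i = s → IsWeakDeriv γ U u (G γ)) :
    semi0 s U u = (∑ γ ∈ Finset.piAntidiag (Finset.univ : Finset (Fin n)) s,
      ∫⁻ x in U, ‖G γ x‖ₑ ^ 2) ^ (1 / 2 : ℝ) := by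
  unfold semi0
  congr 1
  refine Finset.sum_congr rfl fun γ hγ => ?_
  have hγ' := hG γ (Finset.mem_piAntidiag.1 hγ).1
  refine le_antisymm (iInf₂_le _ hγ') (le_iInf₂ fun g hg => ?_)
  refine (lintegral_congr_ae ?_).le
  filter_upwards [hγ'.ae_eq hU hg] with x hx
  rw [hx]

/-- A function in `H^s` has square integrable weak derivatives up to order `s`. -/
theorem MemH.exists_weakDeriv {s : ℕ} (h : MemH s U u) :
    ∃ G : (Fin n → ℕ) → E n → ℝ, ∀ γ, ∑ i, γ i ≤ s →
      IsWeakDeriv γ U u (G γ) ∧ MemLp (G γ) 2 (volume.restrict U) := by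
  have : ∀ γ : Fin n → ℕ, ∃ g : E n → ℝ, ∑ i, γ i ≤ s →
      IsWeakDeriv γ U u g ∧ MemLp g 2 (volume.restrict U) := by
    intro γ
    by_cases hγ : ∑ i, γ i ≤ s
    swap
    · exact ⟨0, fun h => absurd h hγ⟩
    have h1 : (∑ j ∈ Finset.range (s + 1), semi0 j U u ^ 2) < ⊤ := by
      have := ENNReal.rpow_lt_top_iff_of_pos (x := ∑ j ∈ Finset.range (s + 1), semi0 j U u ^ 2)
        (y := 1 / 2) (by norm_num)
      exact this.1 h
    have h2 := (ENNReal.sum_lt_top.1 h1) (∑ i, γ i) (Finset.mem_range.2 (by omega))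
    have h3 : semi0 (∑ i, γ i) U u < ⊤ := (ENNReal.pow_lt_top_iff.1 h2).resolve_right (by simp)
    unfold semi0 at h3
    rw [ENNReal.rpow_lt_top_iff_of_pos (by norm_num)] at h3
    have h4 := (ENNReal.sum_lt_top.1 h3) γ (by simp [Finset.mem_piAntidiag])
    rw [iInf_lt_iff] at h4
    obtain ⟨g, hg⟩ := h4
    rw [iInf_lt_iff] at hg
    obtain ⟨hw, hg⟩ := hg
    refine ⟨g, fun _ => ⟨hw, hw.2.1.aestronglyMeasurable, ?_⟩⟩
    rw [eLpNorm_lt_top_iff_lintegral_rpow_enorm_lt_top (by norm_num) (by norm_num)]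
    simpa using hg
  choose G hG using this
  exact ⟨G, hG⟩

end Weak

/-! ### The Poincaré inequality on convex sets -/

section Poincare

variable {n : ℕ}

theorem fderiv_eq_sum_pderiv (f : E n → ℝ) (y z : E n) :
    fderiv ℝ f y z = ∑ i, z i * pderiv i f y := by
  have hz : z = ∑ i, z i • (EuclideanSpace.single i (1 : ℝ) : E n) := by
    have := (EuclideanSpace.basisFun (Fin n) ℝ).sum_repr z
    simpa using this.symm
  conv_lhs => rw [hz]
  simp [map_sum, pderiv]

theorem ofReal_sq_eq_enorm (a : ℝ) : ‖a‖ₑ ^ 2 = ENNReal.ofReal (a ^ 2) := by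
  rw [← sq_abs, ENNReal.ofReal_pow (abs_nonneg a), ← Real.enorm_eq_ofReal_abs]

theorem lintegral_sq_le {X : Type*} [MeasurableSpace X] (μ : Measure X) {f : X → ℝ≥0∞}
    (hf : AEMeasurable f μ) : (∫⁻ x, f x ∂μ) ^ 2 ≤ μ univ * ∫⁻ x, f x ^ 2 ∂μ := by
  have h := ENNReal.lintegral_mul_le_Lp_mul_Lq μ (p := 2) (q := 2)
    (Real.HolderConjugate.two_two) hf (aemeasurable_const (b := (1 : ℝ≥0∞)))
  simp only [Pi.mul_apply, mul_one, lintegral_const, ENNReal.rpow_two, one_pow, one_mul] at h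
  calc (∫⁻ x, f x ∂μ) ^ 2 ≤ ((∫⁻ x, f x ^ 2 ∂μ) ^ (1 / 2 : ℝ) * (μ univ) ^ (1 / 2 : ℝ)) ^ 2 := by
        gcongr
    _ = μ univ * ∫⁻ x, f x ^ 2 ∂μ := by
        rw [mul_pow, ← ENNReal.rpow_natCast, ← ENNReal.rpow_mul, ← ENNReal.rpow_natCast,
          ← ENNReal.rpow_mul]
        norm_num
        rw [mul_comm]

theorem integrable_comp_add_smul {g : E n → ℝ} (hm : Measurable g) (hg : Integrable g) (z : E n) :
    Integrable (fun p : E n × ℝ => g (p.1 + p.2 • z))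
      (volume.prod (volume.restrict (Icc (0 : ℝ) 1))) := by
  rw [integrable_prod_iff' (Measurable.aestronglyMeasurable (by fun_prop))]
  refine ⟨Filter.Eventually.of_forall fun t => hg.comp_add_right (t • z), ?_⟩
  have : (fun t : ℝ => ∫ x, ‖g (x + t • z)‖) = fun _ => ∫ x, ‖g x‖ := by
    funext t
    exact integral_add_right_eq_self (fun x => ‖g x‖) (t • z)
  simp only [this]
  exact integrable_const _

variable {D : Set (E n)} {v : E n → ℝ} {g : Fin n → E n → ℝ}

/-- The slice at one time of the fundamental theorem of calculus along segments: the translated `φ`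
is an admissible test function, and a change of variables moves the translation onto `g`. -/
theorem integral_fderiv_translate {φ : E n → ℝ} (hg : ∀ i, Integrable (g i))
    (hw : ∀ i, IsWeakDeriv (Pi.single i 1) D v (g i)) (hφ : ContDiff ℝ ∞ φ)
    (hc : HasCompactSupport φ) (w : E n) (hs : ∀ x, x - w ∈ tsupport φ → x ∈ D) (z : E n) :
    ∫ x, v x * fderiv ℝ φ (x - w) (-z) = ∫ x, (∑ i, z i * g i (x + w)) * φ x := by
  set ψ : E n → ℝ := fun x => φ (x - w) with hψ
  have hψs : ContDiff ℝ ∞ ψ := hφ.comp (contDiff_id.sub contDiff_const)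
  have hcl : IsClosed {x | x - w ∈ tsupport φ} :=
    (isClosed_tsupport φ).preimage (continuous_id.sub continuous_const)
  have hts : tsupport ψ ⊆ {x | x - w ∈ tsupport φ} := by
    refine closure_minimal (fun x hx => subset_tsupport _ ?_) hcl
    simpa [hψ] using hx
  have hψc : HasCompactSupport ψ :=
    hc.comp_homeomorph (Homeomorph.subRight w)
  have hψD : tsupport ψ ⊆ D := fun x hx => hs x (hts hx)
  have hp : ∀ i x, pderiv i ψ x = pderiv i φ (x - w) := by
    intro i x
    simp only [pderiv, hψ]
    rw [fderiv_comp_sub]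
  have e1 : ∀ i, ∫ x, v x * pderiv i ψ x = - ∫ x, g i x * ψ x := by
    intro i
    have := (hw i).2.2 ψ hψs hψc hψD
    rw [multiDeriv_single hψs, IsWeakDeriv.setIntegral_eq hψD,
      IsWeakDeriv.setIntegral_eq ((tsupport_pderiv_subset i ψ).trans hψD)] at this
    simpa using this
  have hint : ∀ i, Integrable (fun x => v x * pderiv i ψ x) := by
    intro i
    have h1 := integrable_mul_of_tsupport_subset (hw i).1 (contDiff_pderiv hψs i).continuous
      (hasCompactSupport_pderiv hψc i) ((tsupport_pderiv_subset i ψ).trans hψD)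
    refine (integrableOn_iff_integrable_of_support_subset (s := D) fun x hx => ?_).1 h1
    exact hψD (tsupport_pderiv_subset i ψ (subset_tsupport _ (right_ne_zero_of_mul hx)))
  obtain ⟨B, hB⟩ := hc.exists_bound_of_continuous hφ.continuous
  have hint2 : ∀ i, Integrable (fun x => g i (x + w) * φ x) := fun i =>
    ((hg i).comp_add_right w).mul_bdd (c := B) hφ.continuous.aestronglyMeasurable
      (Filter.Eventually.of_forall hB)
  calc ∫ x, v x * fderiv ℝ φ (x - w) (-z)
      = ∫ x, ∑ i, (-z i) * (v x * pderiv i ψ x) := by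
        refine integral_congr_ae (Filter.Eventually.of_forall fun x => ?_)
        simp only [fderiv_eq_sum_pderiv, Finset.mul_sum, hp]
        refine Finset.sum_congr rfl fun i _ => ?_
        simp; ring
    _ = ∑ i, (-z i) * ∫ x, v x * pderiv i ψ x := by
        rw [integral_finsetSum _ fun i _ => (hint i).const_mul _]
        simp only [integral_const_mul]
    _ = ∑ i, z i * ∫ x, g i (x + w) * φ x := by
        refine Finset.sum_congr rfl fun i _ => ?_
        rw [e1]
        have := integral_add_right_eq_self (μ := (volume : Measure (E n)))
          (fun x => g i x * ψ x) w
        simp only [hψ, add_sub_cancel_right] at this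
        rw [this]
        simp [hψ]
    _ = ∫ x, (∑ i, z i * g i (x + w)) * φ x := by
        simp only [Finset.sum_mul, mul_assoc]
        rw [integral_finsetSum _ fun i _ => (hint2 i).const_mul _]
        simp only [integral_const_mul]

theorem Convex.add_smul_mem_of_add_mem (hD : Convex ℝ D) {x z : E n} (hx : x ∈ D)
    (hz : x + z ∈ D) {t : ℝ} (ht : t ∈ Icc (0 : ℝ) 1) : x + t • z ∈ D := by
  have := hD.add_smul_sub_mem hx hz ht
  simpa using this

/-- The fundamental theorem of calculus for weak gradients, along segments. -/
theorem ae_sub_eq_integral (hDo : IsOpen D) (hD : Convex ℝ D)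
    (hv : Integrable v) (hgm : ∀ i, Measurable (g i)) (hg : ∀ i, Integrable (g i))
    (hw : ∀ i, IsWeakDeriv (Pi.single i 1) D v (g i)) (z : E n) :
    ∀ᵐ x, x ∈ D ∩ (fun x => x + z) ⁻¹' D →
      v (x + z) - v x = ∫ t in Icc (0 : ℝ) 1, ∑ i, z i * g i (x + t • z) := by
  have hD'o : IsOpen (D ∩ (fun x => x + z) ⁻¹' D) :=
    hDo.inter (hDo.preimage (continuous_add_const z))
  have hHint : Integrable (fun p : E n × ℝ => ∑ i, z i * g i (p.1 + p.2 • z))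
      (volume.prod (volume.restrict (Icc (0 : ℝ) 1))) :=
    integrable_finsetSum _ fun i _ => (integrable_comp_add_smul (hgm i) (hg i) z).const_mul _
  set h : E n → ℝ := fun x => ∫ t in Icc (0 : ℝ) 1, ∑ i, z i * g i (x + t • z) with hh
  have hhi : Integrable h := hHint.integral_prod_left
  have hvz : Integrable (fun x => v (x + z)) := hv.comp_add_right z
  have hF : Integrable (fun x => v (x + z) - v x - h x) := (hvz.sub hv).sub hhi
  have := hD'o.ae_eq_zero_of_integral_contDiff_smul_eq_zero (μ := volume)
    (f := fun x => v (x + z) - v x - h x) (hF.locallyIntegrable.locallyIntegrableOn _) ?_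
  · filter_upwards [this] with x hx hxD
    exact sub_eq_zero.1 (hx hxD)
  intro φ hφ hc hs
  obtain ⟨B, hB⟩ := hc.exists_bound_of_continuous hφ.continuous
  have mulφ : ∀ {f : E n → ℝ}, Integrable f → Integrable (fun x => f x * φ x) := fun hf =>
    hf.mul_bdd (c := B) hφ.continuous.aestronglyMeasurable (Filter.Eventually.of_forall hB)
  have hv' : Integrable (fun x => v x * φ (x - z)) :=
    hv.mul_bdd (c := B) (by fun_prop) (Filter.Eventually.of_forall fun x => hB _)
  have hdc : Continuous (fderiv ℝ φ) := hφ.continuous_fderiv (by simp)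
  obtain ⟨B', hB'⟩ := (hc.fderiv ℝ).exists_bound_of_continuous hdc
  have ftc : ∀ x, φ (x - z) - φ x = ∫ t in Icc (0 : ℝ) 1, fderiv ℝ φ (x - t • z) (-z) := by
    intro x
    have hd : ∀ t ∈ uIcc (0 : ℝ) 1, HasDerivAt (fun t : ℝ => φ (x - t • z))
        (fderiv ℝ φ (x - t • z) (-z)) t := by
      intro t _
      have h1 : HasDerivAt (fun t : ℝ => x - t • z) (-z) t := by
        simpa using ((hasDerivAt_id t).smul_const z).const_sub x
      exact (hφ.differentiable (by simp) _).hasFDerivAt.comp_hasDerivAt t h1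
    have hcont : Continuous fun t : ℝ => fderiv ℝ φ (x - t • z) (-z) := by fun_prop
    have := intervalIntegral.integral_eq_sub_of_hasDerivAt hd (hcont.intervalIntegrable _ _)
    rw [intervalIntegral.integral_of_le zero_le_one, ← integral_Icc_eq_integral_Ioc] at this
    simpa using this.symm
  have hPint : Integrable (fun p : E n × ℝ => v p.1 * fderiv ℝ φ (p.1 - p.2 • z) (-z))
      (volume.prod (volume.restrict (Icc (0 : ℝ) 1))) := by
    have h1 : Integrable (fun p : E n × ℝ => v p.1)
        (volume.prod (volume.restrict (Icc (0 : ℝ) 1))) := hv.comp_fst _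
    refine h1.mul_bdd (c := B' * ‖z‖) (Continuous.aestronglyMeasurable (by fun_prop))
      (Filter.Eventually.of_forall fun p => ?_)
    refine (ContinuousLinearMap.le_opNorm _ _).trans ?_
    rw [norm_neg]
    exact mul_le_mul_of_nonneg_right (hB' _) (norm_nonneg _)
  have hHφ : Integrable (fun p : E n × ℝ => (∑ i, z i * g i (p.1 + p.2 • z)) * φ p.1)
      (volume.prod (volume.restrict (Icc (0 : ℝ) 1))) :=
    hHint.mul_bdd (c := B) (Continuous.aestronglyMeasurable (by fun_prop))
      (Filter.Eventually.of_forall fun p => hB _)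
  -- Fubini reduces the claim to a fixed `t`. There the translate of `φ` by `t • z` is still
  -- supported in `D`, since with `x` and `x + z` the convex set `D` contains the segment between
  -- them.
  have key : ∫ x, v x * (φ (x - z) - φ x) = ∫ x, h x * φ x := by
    calc ∫ x, v x * (φ (x - z) - φ x)
        = ∫ x, ∫ t in Icc (0 : ℝ) 1, v x * fderiv ℝ φ (x - t • z) (-z) := by
          simp only [ftc, integral_const_mul]
      _ = ∫ t in Icc (0 : ℝ) 1, ∫ x, v x * fderiv ℝ φ (x - t • z) (-z) :=
          integral_integral_swap hPint
      _ = ∫ t in Icc (0 : ℝ) 1, ∫ x, (∑ i, z i * g i (x + t • z)) * φ x := by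
          refine setIntegral_congr_fun measurableSet_Icc fun t ht => ?_
          refine integral_fderiv_translate hg hw hφ hc (t • z) (fun x hx => ?_) z
          obtain ⟨h1, h2⟩ := hs hx
          have := Convex.add_smul_mem_of_add_mem hD h1 h2 ht
          simpa using this
      _ = ∫ x, ∫ t in Icc (0 : ℝ) 1, (∑ i, z i * g i (x + t • z)) * φ x :=
          (integral_integral_swap hHφ).symm
      _ = ∫ x, h x * φ x := by simp only [hh, integral_mul_const]
  have e2 : ∫ x, v (x + z) * φ x = ∫ x, v x * φ (x - z) := by
    have := integral_add_right_eq_self (μ := (volume : Measure (E n)))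
      (fun x => v x * φ (x - z)) z
    simpa using this
  calc ∫ x, φ x • (v (x + z) - v x - h x)
      = ∫ x, ((v (x + z) * φ x - v x * φ x) - h x * φ x) := by
        refine integral_congr_ae (Filter.Eventually.of_forall fun x => ?_)
        simp; ring
    _ = 0 := by
        have hsub : Integrable (fun x => v (x + z) * φ x - v x * φ x) := (mulφ hvz).sub (mulφ hv)
        rw [integral_sub hsub (mulφ hhi), integral_sub (mulφ hvz) (mulφ hv),
          e2, ← key, ← integral_sub hv' (mulφ hv), sub_eq_zero]
        simp only [mul_sub]

/-- Cauchy–Schwarz along the segment from `x` to `x + z`, then Fubini and translation invariance.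
Convexity keeps `x + t • z` in `D`. -/
theorem lintegral_translate_sub_sq_le (hDo : IsOpen D) (hD : Convex ℝ D)
    (hv : Integrable v) (hgm : ∀ i, Measurable (g i)) (hg : ∀ i, Integrable (g i))
    (hw : ∀ i, IsWeakDeriv (Pi.single i 1) D v (g i)) (z : E n) :
    ∫⁻ x in D ∩ (fun x => x + z) ⁻¹' D, ‖v (x + z) - v x‖ₑ ^ 2 ≤
      ‖z‖ₑ ^ 2 * ∫⁻ x in D, ENNReal.ofReal (∑ i, g i x ^ 2) := by
  set D' := D ∩ (fun x => x + z) ⁻¹' D with hD'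
  have hD'm : MeasurableSet D' :=
    (hDo.inter (hDo.preimage (continuous_add_const z))).measurableSet
  set G : E n → ℝ≥0∞ := fun x => ENNReal.ofReal (∑ i, g i x ^ 2) with hG
  have hGm : Measurable G := by fun_prop
  have hpt : ∀ (x : E n) (t : ℝ), ‖∑ i, z i * g i (x + t • z)‖ₑ ^ 2 ≤ ‖z‖ₑ ^ 2 * G (x + t • z) := by
    intro x t
    rw [ofReal_sq_eq_enorm, ← ofReal_norm, ← ENNReal.ofReal_pow (norm_nonneg _), hG,
      ← ENNReal.ofReal_mul (by positivity)]
    refine ENNReal.ofReal_le_ofReal ?_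
    rw [EuclideanSpace.real_norm_sq_eq]
    exact Finset.sum_mul_sq_le_sq_mul_sq _ _ _
  calc ∫⁻ x in D', ‖v (x + z) - v x‖ₑ ^ 2
      ≤ ∫⁻ x in D', ∫⁻ t in Icc (0 : ℝ) 1, ‖z‖ₑ ^ 2 * G (x + t • z) := by
        refine lintegral_mono_ae ?_
        rw [ae_restrict_iff' hD'm]
        filter_upwards [ae_sub_eq_integral hDo hD hv hgm hg hw z] with x hx hxD
        rw [hx hxD]
        calc ‖∫ t in Icc (0 : ℝ) 1, ∑ i, z i * g i (x + t • z)‖ₑ ^ 2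
            ≤ (∫⁻ t in Icc (0 : ℝ) 1, ‖∑ i, z i * g i (x + t • z)‖ₑ) ^ 2 := by
              gcongr
              exact enorm_integral_le_lintegral_enorm _
          _ ≤ _ := lintegral_sq_le _ (by fun_prop)
          _ ≤ _ := by
              simp only [Measure.restrict_apply_univ, Real.volume_Icc, sub_zero,
                ENNReal.ofReal_one, one_mul]
              exact lintegral_mono fun t => hpt x t
    _ = ∫⁻ t in Icc (0 : ℝ) 1, ∫⁻ x in D', ‖z‖ₑ ^ 2 * G (x + t • z) :=
        lintegral_lintegral_swap (by fun_prop)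
    _ ≤ ∫⁻ t in Icc (0 : ℝ) 1, ‖z‖ₑ ^ 2 * ∫⁻ x in D, G x := by
        refine setLIntegral_mono' measurableSet_Icc fun t ht => ?_
        rw [lintegral_const_mul _ (by fun_prop)]
        refine mul_le_mul' le_rfl ?_
        rw [← lintegral_indicator hD'm, ← lintegral_indicator hDo.measurableSet,
          ← lintegral_add_right_eq_self (D.indicator G) (t • z)]
        refine lintegral_mono fun x => ?_
        by_cases hx : x ∈ D'
        · rw [indicator_of_mem hx,
            indicator_of_mem (Convex.add_smul_mem_of_add_mem hD hx.1 hx.2 ht)]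
        · rw [indicator_of_notMem hx]; exact zero_le
    _ = _ := by simp

/-- Substituting `y = x + z` turns the double integral into an integral over translations `z`. Only
those with `‖z‖ ≤ R` contribute, hence the volume of the ball. -/
theorem lintegral_lintegral_sub_sq_le (hDo : IsOpen D) (hD : Convex ℝ D) (hvm : Measurable v)
    (hv : Integrable v) (hgm : ∀ i, Measurable (g i)) (hg : ∀ i, Integrable (g i))
    (hw : ∀ i, IsWeakDeriv (Pi.single i 1) D v (g i)) {R : ℝ}
    (hR : ∀ x ∈ D, ∀ y ∈ D, dist x y ≤ R) :
    ∫⁻ x in D, ∫⁻ y in D, ‖v y - v x‖ₑ ^ 2 ≤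
      volume (Metric.closedBall (0 : E n) R) * ENNReal.ofReal R ^ 2 *
        ∫⁻ x in D, ENNReal.ofReal (∑ i, g i x ^ 2) := by
  have hDm := hDo.measurableSet
  set I := ∫⁻ x in D, ENNReal.ofReal (∑ i, g i x ^ 2)
  set F : E n → E n → ℝ≥0∞ := fun x y =>
    D.indicator 1 x * (D.indicator 1 y * ‖v y - v x‖ₑ ^ 2) with hF
  have m1 : Measurable (D.indicator (1 : E n → ℝ≥0∞)) := measurable_one.indicator hDm
  have e1 : ∫⁻ x in D, ∫⁻ y in D, ‖v y - v x‖ₑ ^ 2 = ∫⁻ x, ∫⁻ y, F x y := by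
    rw [← lintegral_indicator hDm]
    refine lintegral_congr fun x => ?_
    simp only [hF]
    rw [lintegral_const_mul _ (by fun_prop)]
    by_cases hx : x ∈ D
    · simp only [indicator_of_mem hx, Pi.one_apply, one_mul]
      rw [← lintegral_indicator hDm]
      refine lintegral_congr fun y => ?_
      by_cases hy : y ∈ D <;> simp [hy]
    · simp [hx]
  have e2 : ∫⁻ x, ∫⁻ y, F x y = ∫⁻ z, ∫⁻ x, F x (x + z) := by
    rw [lintegral_lintegral_swap (f := fun z x => F x (x + z))
      (Measurable.aemeasurable (by unfold F; fun_prop))]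
    exact lintegral_congr fun x => (lintegral_add_left_eq_self (F x) x).symm
  rw [e1, e2]
  calc ∫⁻ z, ∫⁻ x, F x (x + z)
      ≤ ∫⁻ z in Metric.closedBall (0 : E n) R, ENNReal.ofReal R ^ 2 * I := by
        rw [← lintegral_indicator Metric.isClosed_closedBall.measurableSet]
        refine lintegral_mono fun z => ?_
        have hz : ∀ x, F x (x + z) =
            (D ∩ (fun x => x + z) ⁻¹' D).indicator (fun x => ‖v (x + z) - v x‖ₑ ^ 2) x := by
          intro x
          by_cases hx : x ∈ D <;> by_cases hy : x + z ∈ D <;> simp [hF, hx, hy]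
        simp only [hz]
        by_cases hzb : z ∈ Metric.closedBall (0 : E n) R
        · rw [indicator_of_mem hzb, lintegral_indicator
            (hDo.inter (hDo.preimage (continuous_add_const z))).measurableSet]
          refine (lintegral_translate_sub_sq_le hDo hD hv hgm hg hw z).trans ?_
          gcongr
          rw [← ofReal_norm]
          exact ENNReal.ofReal_le_ofReal (by simpa using hzb)
        · have he : D ∩ (fun x => x + z) ⁻¹' D = ∅ := by
            refine eq_empty_of_forall_notMem fun x hx => hzb ?_
            have := hR _ hx.2 _ hx.1
            simpa [dist_eq_norm] using this
          simp [he]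
    _ = _ := by rw [lintegral_const, Measure.restrict_apply_univ]; ring

/-- `ω`, the volume of the unit ball. -/
def unitBallVol (n : ℕ) : ℝ := (volume (Metric.closedBall (0 : E n) 1)).toReal

theorem volume_closedBall_eq {R : ℝ} (hR : 0 ≤ R) (x : E n) :
    volume (Metric.closedBall x R) = ENNReal.ofReal (R ^ n * unitBallVol n) := by
  rw [Measure.addHaar_closedBall' _ _ hR, ENNReal.ofReal_mul (by positivity), unitBallVol,
    ENNReal.ofReal_toReal measure_closedBall_lt_top.ne]
  simp

theorem unitBallVol_pos (n : ℕ) : 0 < unitBallVol n :=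
  ENNReal.toReal_pos (Metric.measure_closedBall_pos _ _ one_pos).ne' measure_closedBall_lt_top.ne

/-- A convex set of diameter at most `R`, in which a fixed proportion of a ball of radius `R`
can be found. -/
structure FatConvex (D : Set (E n)) (R κ : ℝ) : Prop where
  isOpen : IsOpen D
  convex : Convex ℝ D
  R_pos : 0 < R
  κ_pos : 0 < κ
  dist_le : ∀ x ∈ D, ∀ y ∈ D, dist x y ≤ R
  le_vol : κ * R ^ n ≤ volume.real D

namespace FatConvex

variable {R κ : ℝ}

theorem isBounded (h : FatConvex D R κ) : Bornology.IsBounded D :=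
  Metric.isBounded_iff.2 ⟨R, fun x hx y hy => h.dist_le x hx y hy⟩

theorem vol_lt_top (h : FatConvex D R κ) : volume D < ⊤ := h.isBounded.measure_lt_top

theorem vol_pos (h : FatConvex D R κ) : 0 < volume.real D :=
  lt_of_lt_of_le (mul_pos h.κ_pos (pow_pos h.R_pos n)) h.le_vol

theorem finite (h : FatConvex D R κ) : IsFiniteMeasure (volume.restrict D) :=
  ⟨by simpa using h.vol_lt_top⟩

theorem nonempty (h : FatConvex D R κ) : D.Nonempty := by
  by_contra hc
  rw [not_nonempty_iff_eq_empty] at hc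
  have := h.vol_pos
  simp [hc] at this

end FatConvex

/-- The deviation of `v x` from the mean is the mean over `y` of `v x - v y`. Cauchy–Schwarz bounds
its square by the mean of `(v y - v x)²`, and the double integral is estimated by translations. The
ratio of the ball of radius `R` to `D` is at most `unitBallVol n / κ`. -/
theorem poincare {R κ : ℝ} (h : FatConvex D R κ) (hv : MemLp v 2 (volume.restrict D))
    (hg : ∀ i, MemLp (g i) 2 (volume.restrict D))
    (hw : ∀ i, IsWeakDeriv (Pi.single i 1) D v (g i)) :
    ∫ x in D, (v x - ⨍ y in D, v y) ^ 2 ≤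
      unitBallVol n / κ * R ^ 2 * ∑ i, ∫ x in D, g i x ^ 2 := by
  have := h.finite
  have hDm := h.isOpen.measurableSet
  -- measurable representatives
  set v' : E n → ℝ := D.indicator (hv.1.mk v) with hv'
  set g' : Fin n → E n → ℝ := fun i => D.indicator ((hg i).1.mk (g i)) with hg'
  have ind : ∀ {f : E n → ℝ} (hf : MemLp f 2 (volume.restrict D)),
      f =ᵐ[volume.restrict D] D.indicator (hf.1.mk f) := fun {f} hf =>
    hf.1.ae_eq_mk.trans (indicator_ae_eq_restrict hDm).symm
  have indi : ∀ {f : E n → ℝ} (hf : MemLp f 2 (volume.restrict D)),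
      Integrable (D.indicator (hf.1.mk f)) := fun {f} hf => by
    rw [integrable_indicator_iff hDm]
    exact (hf.integrable (by norm_num)).congr hf.1.ae_eq_mk
  have indm : ∀ {f : E n → ℝ} (hf : MemLp f 2 (volume.restrict D)),
      Measurable (D.indicator (hf.1.mk f)) := fun {f} hf =>
    hf.1.stronglyMeasurable_mk.measurable.indicator hDm
  have hwk : ∀ i, IsWeakDeriv (Pi.single i 1) D v' (g' i) := fun i =>
    (hw i).congr (ind hv) (ind (hg i))
  have main := lintegral_lintegral_sub_sq_le h.isOpen h.convex (indm hv) (indi hv)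
    (fun i => indm (hg i)) (fun i => indi (hg i)) hwk h.dist_le
  have hvi : Integrable v' (volume.restrict D) := (indi hv).integrableOn
  have hV := h.vol_pos
  set a := ⨍ y in D, v y with ha
  have ha' : a = (volume.real D)⁻¹ * ∫ y in D, v' y := by
    rw [ha, setAverage_eq, smul_eq_mul, integral_congr_ae (ind hv)]
  have hpt : ∀ x, ‖v' x - a‖ₑ ^ 2 ≤
      ENNReal.ofReal (volume.real D)⁻¹ * ∫⁻ y in D, ‖v' y - v' x‖ₑ ^ 2 := by
    intro x
    have e : v' x - a = - ((volume.real D)⁻¹ * ∫ y in D, (v' y - v' x)) := by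
      rw [integral_sub hvi (integrable_const _), ha']
      simp only [integral_const, smul_eq_mul, measureReal_restrict_apply_univ]
      field_simp
      ring
    have hvm : Measurable v' := indm hv
    rw [e, enorm_neg, enorm_mul, mul_pow]
    calc ‖(volume.real D)⁻¹‖ₑ ^ 2 * ‖∫ y in D, (v' y - v' x)‖ₑ ^ 2
        ≤ ‖(volume.real D)⁻¹‖ₑ ^ 2 * (volume D * ∫⁻ y in D, ‖v' y - v' x‖ₑ ^ 2) := by
          gcongr
          refine (pow_le_pow_left' (enorm_integral_le_lintegral_enorm _) 2).trans ?_
          have := lintegral_sq_le (volume.restrict D) (f := fun y => ‖v' y - v' x‖ₑ) (by fun_prop)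
          simpa using this
      _ = _ := by
          rw [← mul_assoc]
          congr 1
          rw [ofReal_sq_eq_enorm, ← ENNReal.ofReal_toReal h.vol_lt_top.ne,
            ← ENNReal.ofReal_mul (by positivity)]
          congr 1
          change _ * volume.real D = _
          field_simp
  have sqint : ∀ {f : E n → ℝ}, MemLp f 2 (volume.restrict D) →
      Integrable (fun x => f x ^ 2) (volume.restrict D) := fun hf => hf.integrable_sq
  have hva : MemLp (fun x => v x - a) 2 (volume.restrict D) := hv.sub (memLp_const a)
  rw [← ENNReal.ofReal_le_ofReal_iff (by have := unitBallVol_pos n; have := h.κ_pos; positivity)]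
  calc ENNReal.ofReal (∫ x in D, (v x - a) ^ 2)
      = ∫⁻ x in D, ENNReal.ofReal ((v x - a) ^ 2) :=
        ofReal_integral_eq_lintegral_ofReal (sqint hva)
          (Filter.Eventually.of_forall fun x => sq_nonneg _)
    _ = ∫⁻ x in D, ‖v' x - a‖ₑ ^ 2 := by
        refine lintegral_congr_ae ?_
        filter_upwards [ind hv] with x hx
        rw [ofReal_sq_eq_enorm, hx]
    _ ≤ ∫⁻ x in D, ENNReal.ofReal (volume.real D)⁻¹ * ∫⁻ y in D, ‖v' y - v' x‖ₑ ^ 2 :=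
        lintegral_mono hpt
    _ = ENNReal.ofReal (volume.real D)⁻¹ * ∫⁻ x in D, ∫⁻ y in D, ‖v' y - v' x‖ₑ ^ 2 :=
        lintegral_const_mul' _ _ ENNReal.ofReal_ne_top
    _ ≤ ENNReal.ofReal (volume.real D)⁻¹ * (volume (Metric.closedBall (0 : E n) R) *
          ENNReal.ofReal R ^ 2 * ∫⁻ x in D, ENNReal.ofReal (∑ i, g' i x ^ 2)) := by gcongr
    _ = ENNReal.ofReal ((volume.real D)⁻¹ * (R ^ n * unitBallVol n * R ^ 2 *
          ∑ i, ∫ x in D, g i x ^ 2)) := by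
        have e3 : ∫⁻ x in D, ENNReal.ofReal (∑ i, g' i x ^ 2) =
            ENNReal.ofReal (∑ i, ∫ x in D, g i x ^ 2) := by
          rw [← integral_finsetSum _ fun i _ => sqint (hg i),
            ofReal_integral_eq_lintegral_ofReal (integrable_finsetSum _ fun i _ => sqint (hg i))
            (Filter.Eventually.of_forall fun x => Finset.sum_nonneg fun i _ => sq_nonneg _)]
          refine lintegral_congr_ae ?_
          filter_upwards [ae_all_iff.2 fun i => ind (hg i)] with x hx
          simp only [hx, hg']
        have hR := h.R_pos.le
        have hub := (unitBallVol_pos n).le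
        rw [e3, volume_closedBall_eq hR, ← ENNReal.ofReal_pow hR, ← ENNReal.ofReal_mul (by positivity),
          ← ENNReal.ofReal_mul (by positivity), ← ENNReal.ofReal_mul (by positivity)]
    _ ≤ _ := by
        refine ENNReal.ofReal_le_ofReal ?_
        have hub := (unitBallVol_pos n).le
        have hS : 0 ≤ ∑ i, ∫ x in D, g i x ^ 2 :=
          Finset.sum_nonneg fun i _ => integral_nonneg fun x => sq_nonneg _
        have hk : (volume.real D)⁻¹ * R ^ n ≤ κ⁻¹ := by
          rw [inv_mul_le_iff₀ hV, ← div_eq_mul_inv, le_div_iff₀ h.κ_pos, mul_comm]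
          exact h.le_vol
        calc (volume.real D)⁻¹ * (R ^ n * unitBallVol n * R ^ 2 * ∑ i, ∫ x in D, g i x ^ 2)
            = ((volume.real D)⁻¹ * R ^ n) * (unitBallVol n * R ^ 2 * ∑ i, ∫ x in D, g i x ^ 2) := by
              ring
          _ ≤ κ⁻¹ * (unitBallVol n * R ^ 2 * ∑ i, ∫ x in D, g i x ^ 2) := by gcongr
          _ = _ := by rw [div_eq_mul_inv]; ring

end Poincare

/-! ### The embedding of `H²` into the continuous functions on convex sets -/

section Sobolev

variable {n : ℕ} {D : Set (E n)} {R κ : ℝ}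

/-- The mean square of `f` over `D`. -/
def ms (D : Set (E n)) (f : E n → ℝ) : ℝ := (volume.real D)⁻¹ * ∫ x in D, f x ^ 2

theorem ms_nonneg (D : Set (E n)) (f : E n → ℝ) : 0 ≤ ms D f :=
  mul_nonneg (by positivity) (integral_nonneg fun _ => sq_nonneg _)

/-- Mean square equals squared mean plus variance. -/
theorem ms_eq_sq_add (h : FatConvex D R κ) {f : E n → ℝ} (hf : MemLp f 2 (volume.restrict D)) :
    ms D f = (⨍ x in D, f x) ^ 2 + ms D (fun x => f x - ⨍ y in D, f y) := by
  have := h.finite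
  have hV := h.vol_pos
  set a := ⨍ x in D, f x with ha
  have hI : ∫ x in D, f x = volume.real D * a := by
    rw [ha, setAverage_eq, smul_eq_mul]; field_simp
  have i1 := hf.integrable_sq
  have i2 : Integrable f (volume.restrict D) := hf.integrable (by norm_num)
  have : ∫ x in D, (f x - a) ^ 2 = (∫ x in D, f x ^ 2) - volume.real D * a ^ 2 := by
    have e : ∀ x, (f x - a) ^ 2 = (f x ^ 2 - 2 * a * f x) + a ^ 2 := fun x => by ring
    have i3 : Integrable (fun x => 2 * a * f x) (volume.restrict D) := i2.const_mul _
    have i4 : Integrable (fun x => f x ^ 2 - 2 * a * f x) (volume.restrict D) := i1.sub i3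
    simp only [e]
    rw [integral_add i4 (integrable_const _), integral_sub i1 i3, integral_const_mul, hI]
    simp only [integral_const, smul_eq_mul, measureReal_restrict_apply_univ]
    ring
  simp only [ms, this]
  field_simp
  ring

theorem abs_average_le (h : FatConvex D R κ) {f : E n → ℝ}
    (hf : MemLp f 2 (volume.restrict D)) : |⨍ x in D, f x| ≤ √(ms D f) := by
  refine Real.abs_le_sqrt ?_
  rw [ms_eq_sq_add h hf]
  exact le_add_of_nonneg_right (ms_nonneg _ _)

theorem sqrt_ms_le (h : FatConvex D R κ) {f : E n → ℝ} (hf : MemLp f 2 (volume.restrict D)) :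
    √(ms D f) ≤ |⨍ x in D, f x| + √(ms D (fun x => f x - ⨍ y in D, f y)) := by
  rw [ms_eq_sq_add h hf, ← Real.sqrt_sq_eq_abs]
  refine Real.sqrt_le_iff.2 ⟨by positivity, ?_⟩
  have h1 := Real.sq_sqrt (sq_nonneg (⨍ x in D, f x))
  have h2 := Real.sq_sqrt (ms_nonneg D (fun x => f x - ⨍ y in D, f y))
  have h3 := mul_nonneg (Real.sqrt_nonneg ((⨍ x in D, f x) ^ 2))
    (Real.sqrt_nonneg (ms D (fun x => f x - ⨍ y in D, f y)))
  nlinarith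

theorem ms_mono_set {D' : Set (E n)} {f : E n → ℝ} (hf : MemLp f 2 (volume.restrict D))
    (hD : D' ⊆ D) {q : ℝ} (hV : 0 < volume.real D) (hV' : 0 < volume.real D')
    (hq : volume.real D ≤ q * volume.real D') : ms D' f ≤ q * ms D f := by
  have hI : ∫ x in D', f x ^ 2 ≤ ∫ x in D, f x ^ 2 :=
    setIntegral_mono_set hf.integrable_sq (Filter.Eventually.of_forall fun _ => sq_nonneg _)
      (Filter.Eventually.of_forall hD)
  have h2 : (volume.real D')⁻¹ ≤ q * (volume.real D)⁻¹ := by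
    rw [inv_le_iff_one_le_mul₀ hV', mul_right_comm, ← div_eq_mul_inv, le_div_iff₀ hV]
    linarith
  unfold ms
  rw [← mul_assoc]
  exact mul_le_mul h2 hI (integral_nonneg fun _ => sq_nonneg _)
    (le_trans (by positivity) h2)

theorem poincare_ms (h : FatConvex D R κ) {v : E n → ℝ} {g : Fin n → E n → ℝ}
    (hv : MemLp v 2 (volume.restrict D))
    (hg : ∀ i, MemLp (g i) 2 (volume.restrict D))
    (hw : ∀ i, IsWeakDeriv (Pi.single i 1) D v (g i)) :
    ms D (fun x => v x - ⨍ y in D, v y) ≤ unitBallVol n / κ * R ^ 2 * ∑ i, ms D (g i) := by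
  have := poincare h hv hg hw
  have hV := h.vol_pos
  unfold ms
  rw [← Finset.mul_sum, mul_left_comm]
  exact mul_le_mul_of_nonneg_left this (by positivity)

/-- `D` contracted towards `x` by the factor `t`. -/
def shrink (D : Set (E n)) (x : E n) (t : ℝ) : Set (E n) := AffineMap.homothety x t '' D

theorem mem_shrink {x y : E n} {t : ℝ} (ht : 0 < t) :
    y ∈ shrink D x t ↔ x + t⁻¹ • (y - x) ∈ D := by
  simp only [shrink, mem_image, AffineMap.homothety_apply, vsub_eq_sub, vadd_eq_add]
  constructor
  · rintro ⟨z, hz, rfl⟩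
    rw [add_sub_cancel_right, smul_smul, inv_mul_cancel₀ ht.ne', one_smul]
    simpa using hz
  · intro hy
    refine ⟨_, hy, ?_⟩
    rw [add_sub_cancel_left, smul_smul, mul_inv_cancel₀ ht.ne', one_smul]
    simp

theorem volume_shrink (x : E n) {t : ℝ} (ht : 0 < t) :
    volume.real (shrink D x t) = t ^ n * volume.real D := by
  unfold Measure.real shrink
  rw [Measure.addHaar_image_homothety, ENNReal.toReal_mul, finrank_euclideanSpace_fin,
    ENNReal.toReal_ofReal (abs_nonneg _), abs_of_pos (pow_pos ht n)]

theorem shrink_subset (hDo : IsOpen D) (hD : Convex ℝ D) {x : E n} (hx : x ∈ closure D) {t : ℝ}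
    (ht : 0 < t) (ht1 : t ≤ 1) : shrink D x t ⊆ D := by
  rintro _ ⟨z, hz, rfl⟩
  have := hD.combo_interior_closure_mem_interior (x := z) (y := x)
    (by rwa [hDo.interior_eq]) hx ht (sub_nonneg.2 ht1) (by ring)
  rw [hDo.interior_eq] at this
  rw [AffineMap.homothety_apply]
  convert this using 1
  simp only [vsub_eq_sub, vadd_eq_add, smul_sub, sub_smul, one_smul]
  abel

theorem shrink_mono (hDo : IsOpen D) (hD : Convex ℝ D) {x : E n} (hx : x ∈ closure D) {s t : ℝ}
    (ht : 0 < t) (hts : t ≤ s) : shrink D x t ⊆ shrink D x s := by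
  intro y hy
  have hs : 0 < s := ht.trans_le hts
  rw [mem_shrink ht] at hy
  rw [mem_shrink hs]
  have h2 : x + s⁻¹ • (y - x) ∈ shrink D x (t / s) := by
    rw [mem_shrink (div_pos ht hs)]
    convert hy using 2
    rw [add_sub_cancel_left, smul_smul]
    congr 1
    field_simp
  exact shrink_subset hDo hD hx (div_pos ht hs) ((div_le_one hs).2 hts) h2

theorem isOpen_shrink (hDo : IsOpen D) (x : E n) {t : ℝ} (ht : 0 < t) :
    IsOpen (shrink D x t) := by
  have : shrink D x t = (fun y => x + t⁻¹ • (y - x)) ⁻¹' D := by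
    ext y; exact mem_shrink ht
  rw [this]
  exact hDo.preimage (by fun_prop)

/-- `κ` is invariant under homothety, so one Poincaré constant serves all scales. -/
theorem FatConvex.shrink (h : FatConvex D R κ) (x : E n) {t : ℝ} (ht : 0 < t) :
    FatConvex (shrink D x t) (t * R) κ where
  isOpen := isOpen_shrink h.isOpen x ht
  convex := h.convex.affine_image _
  R_pos := mul_pos ht h.R_pos
  κ_pos := h.κ_pos
  dist_le := by
    rintro _ ⟨y, hy, rfl⟩ _ ⟨z, hz, rfl⟩
    have := h.dist_le y hy z hz
    have e : dist (AffineMap.homothety x t y) (AffineMap.homothety x t z) = t * dist y z := by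
      rw [dist_eq_norm, dist_eq_norm, AffineMap.homothety_apply, AffineMap.homothety_apply]
      simp only [vsub_eq_sub, vadd_eq_add, add_sub_add_right_eq_sub]
      rw [← smul_sub, norm_smul, Real.norm_of_nonneg ht.le]
      simp
    rw [e]
    exact mul_le_mul_of_nonneg_left this ht.le
  le_vol := by
    rw [volume_shrink x ht, mul_pow]
    have := h.le_vol
    nlinarith [pow_pos ht n, mul_le_mul_of_nonneg_left this (pow_pos ht n).le]

/-- The difference is the average over `D'` of the deviation from the mean over `D`. Passing from
`D'` to `D` in the mean square costs the volume ratio `q`. -/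
theorem abs_average_sub_average_le (h : FatConvex D R κ) {D' : Set (E n)} {R' : ℝ}
    (h' : FatConvex D' R' κ) (hD : D' ⊆ D) {q : ℝ} (hq0 : 0 ≤ q)
    (hq : volume.real D ≤ q * volume.real D') {f : E n → ℝ}
    (hf : MemLp f 2 (volume.restrict D)) :
    |(⨍ x in D', f x) - ⨍ x in D, f x| ≤ √q * √(ms D (fun x => f x - ⨍ y in D, f y)) := by
  have := h.finite
  have := h'.finite
  set a := ⨍ x in D, f x
  have hfa : MemLp (fun x => f x - a) 2 (volume.restrict D) := hf.sub (memLp_const a)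
  have hfi : Integrable f (volume.restrict D') :=
    (hf.mono_measure (Measure.restrict_mono hD le_rfl)).integrable (by norm_num)
  have e' : (⨍ x in D', f x) - a = ⨍ x in D', (f x - a) := by
    have hV' := h'.vol_pos
    rw [setAverage_eq, setAverage_eq, integral_sub hfi (integrable_const _)]
    simp only [integral_const, smul_eq_mul, measureReal_restrict_apply_univ]
    field_simp
  rw [← Real.sqrt_mul hq0]
  rw [e']
  refine (abs_average_le h' (hfa.mono_measure (Measure.restrict_mono hD le_rfl))).trans ?_
  exact Real.sqrt_le_sqrt (ms_mono_set hfa hD h.vol_pos h'.vol_pos hq)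

/-- Dominated convergence: the indicator of the contracted set is continuous in the centre except at
points on its frontier, and the frontier of a convex set is null. -/
theorem continuousWithinAt_average_shrink (h : FatConvex D R κ) {v : E n → ℝ}
    (hv : Integrable v (volume.restrict D)) {t : ℝ} (ht : 0 < t) (ht1 : t ≤ 1) :
    ContinuousOn (fun x => ⨍ y in shrink D x t, v y) (closure D) := by
  have hDm := h.isOpen.measurableSet
  have hvi : Integrable (D.indicator v) := (integrable_indicator_iff hDm).2 hv
  have hcont : Continuous fun x => ∫ y, (shrink D x t).indicator (D.indicator v) y := by
    rw [continuous_iff_continuousAt]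
    intro x₀
    refine continuousAt_of_dominated (bound := fun y => ‖D.indicator v y‖)
      (Filter.Eventually.of_forall fun x =>
        (hvi.indicator (isOpen_shrink h.isOpen x ht).measurableSet).aestronglyMeasurable)
      (Filter.Eventually.of_forall fun x => Filter.Eventually.of_forall fun y =>
        norm_indicator_le_norm_self _ _) hvi.norm ?_
    have hnull : volume (AffineMap.homothety x₀ t '' frontier D) = 0 := by
      rw [Measure.addHaar_image_homothety, h.convex.addHaar_frontier volume, mul_zero]
    filter_upwards [measure_eq_zero_iff_ae_notMem.1 hnull] with y hy
    have hy' : x₀ + t⁻¹ • (y - x₀) ∉ frontier D := by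
      intro hc
      exact hy ((mem_shrink (D := frontier D) ht).2 hc)
    have hc : Continuous fun x : E n => x + t⁻¹ • (y - x) := by fun_prop
    by_cases hyD : x₀ + t⁻¹ • (y - x₀) ∈ D
    · have : ∀ᶠ x in nhds x₀, x + t⁻¹ • (y - x) ∈ D :=
        hc.continuousAt.eventually (h.isOpen.mem_nhds hyD)
      refine ContinuousAt.congr (f := fun _ => D.indicator v y) continuousAt_const ?_
      filter_upwards [this] with x hx
      rw [indicator_of_mem ((mem_shrink ht).2 hx)]
    · have hcl : x₀ + t⁻¹ • (y - x₀) ∈ (closure D)ᶜ := by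
        intro hcl
        exact hy' ⟨hcl, by rwa [h.isOpen.interior_eq]⟩
      have : ∀ᶠ x in nhds x₀, x + t⁻¹ • (y - x) ∈ (closure D)ᶜ :=
        hc.continuousAt.eventually (isClosed_closure.isOpen_compl.mem_nhds hcl)
      refine ContinuousAt.congr (f := fun _ => (0 : ℝ)) continuousAt_const ?_
      filter_upwards [this] with x hx
      rw [indicator_of_notMem fun hm => hx (subset_closure ((mem_shrink ht).1 hm))]
  refine ((hcont.const_smul (t ^ n * volume.real D)⁻¹).continuousOn).congr fun x hx => ?_
  rw [setAverage_eq, volume_shrink x ht]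
  congr 1
  change _ = ∫ y, (shrink D x t).indicator (D.indicator v) y
  rw [integral_indicator (isOpen_shrink h.isOpen x ht).measurableSet]
  refine setIntegral_congr_fun (isOpen_shrink h.isOpen x ht).measurableSet fun y hy => ?_
  exact (indicator_of_mem (shrink_subset h.isOpen h.convex hx ht ht1 hy) v).symm

/-- Lebesgue differentiation. The contracted sets are not balls, but they lie in the ball of radius
`t * R` about `x` and fill a proportion of it bounded below by `κ`. -/
theorem ae_tendsto_average_shrink (h : FatConvex D R κ) {v : E n → ℝ}
    (hv : Integrable v (volume.restrict D)) :
    ∀ᵐ x ∂volume.restrict D, Filter.Tendsto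
      (fun j : ℕ => ⨍ y in shrink D x ((1 / 4) ^ j), v y) Filter.atTop (nhds (v x)) := by
  have hDm := h.isOpen.measurableSet
  have hvi : Integrable (D.indicator v) := (integrable_indicator_iff hDm).2 hv
  have hδ : Filter.Tendsto (fun j : ℕ => (1 / 4 : ℝ) ^ j * R) Filter.atTop
      (nhdsWithin 0 (Ioi 0)) := by
    refine tendsto_nhdsWithin_iff.2 ⟨?_, Filter.Eventually.of_forall fun j =>
      mul_pos (by positivity) h.R_pos⟩
    have := (tendsto_pow_atTop_nhds_zero_of_lt_one (r := (1 / 4 : ℝ)) (by norm_num)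
      (by norm_num)).mul_const R
    simpa using this
  rw [ae_restrict_iff' hDm]
  filter_upwards [IsUnifLocDoublingMeasure.ae_tendsto_average_norm_sub volume
    hvi.locallyIntegrable 1] with x hx hxD
  have hlim := (hx (fun _ : ℕ => x) (fun j : ℕ => (1 / 4 : ℝ) ^ j * R) hδ
    (Filter.Eventually.of_forall fun j =>
      Metric.mem_closedBall_self (by have := h.R_pos; positivity))).const_mul
        (unitBallVol n / κ)
  rw [mul_zero] at hlim
  rw [tendsto_iff_norm_sub_tendsto_zero]
  refine squeeze_zero (fun j => norm_nonneg _) (fun j => ?_) hlim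
  set t : ℝ := (1 / 4) ^ j with htdef
  have ht : 0 < t := by positivity
  have ht1 : t ≤ 1 := pow_le_one₀ (by norm_num) (by norm_num)
  have hs := h.shrink x ht
  have hR := hs.R_pos
  have hVs := hs.vol_pos
  have hsub := shrink_subset h.isOpen h.convex (subset_closure hxD) ht ht1
  have hball : shrink D x t ⊆ Metric.closedBall x (t * R) := by
    rintro _ ⟨z, hz, rfl⟩
    rw [Metric.mem_closedBall, dist_homothety_center]
    rw [Real.norm_of_nonneg ht.le]
    exact mul_le_mul_of_nonneg_left (h.dist_le _ hxD _ hz) ht.le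
  have hfin := hs.finite
  have hvs : Integrable v (volume.restrict (shrink D x t)) :=
    hv.mono_measure (Measure.restrict_mono hsub le_rfl)
  have hsm := hs.isOpen.measurableSet
  have e : (⨍ y in shrink D x t, v y) - v x =
      (volume.real (shrink D x t))⁻¹ * ∫ y in shrink D x t, (v y - v x) := by
    rw [setAverage_eq, integral_sub hvs (integrable_const _)]
    simp only [integral_const, smul_eq_mul, measureReal_restrict_apply_univ]
    field_simp
  rw [e, norm_mul, Real.norm_of_nonneg (inv_nonneg.2 hVs.le), setAverage_eq, smul_eq_mul]
  have hIball : IntegrableOn (fun y => ‖D.indicator v y - D.indicator v x‖)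
      (Metric.closedBall x (t * R)) :=
    (hvi.integrableOn.sub (integrableOn_const measure_closedBall_lt_top.ne)).norm
  have h1 : ‖∫ y in shrink D x t, (v y - v x)‖ ≤
      ∫ y in Metric.closedBall x (t * R), ‖D.indicator v y - D.indicator v x‖ := by
    refine (norm_integral_le_integral_norm _).trans ?_
    rw [setIntegral_congr_fun (g := fun y => ‖D.indicator v y - D.indicator v x‖) hsm fun y hy => by
      simp only [indicator_of_mem (hsub hy), indicator_of_mem hxD]]
    exact setIntegral_mono_set hIball (Filter.Eventually.of_forall fun _ => norm_nonneg _)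
      (Filter.Eventually.of_forall hball)
  set J := ∫ y in Metric.closedBall x (t * R), ‖D.indicator v y - D.indicator v x‖
  have hJ : 0 ≤ J := integral_nonneg fun _ => norm_nonneg _
  have hω := unitBallVol_pos n
  have hκ := h.κ_pos
  have hB : volume.real (Metric.closedBall x (t * R)) = (t * R) ^ n * unitBallVol n := by
    rw [Measure.real, volume_closedBall_eq hR.le, ENNReal.toReal_ofReal (by positivity)]
  rw [hB]
  have h2 : (volume.real (shrink D x t))⁻¹ ≤ unitBallVol n / κ * ((t * R) ^ n * unitBallVol n)⁻¹ := by
    have : unitBallVol n / κ * ((t * R) ^ n * unitBallVol n)⁻¹ = (κ * (t * R) ^ n)⁻¹ := by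
      field_simp
    rw [this]
    exact inv_anti₀ (by positivity) hs.le_vol
  calc _ ≤ (unitBallVol n / κ * ((t * R) ^ n * unitBallVol n)⁻¹) * J :=
        mul_le_mul h2 h1 (norm_nonneg _) (by positivity)
    _ = _ := by ring

/-- The constant of the Sobolev inequality `sobolev_sup`. -/
def sobConst (n : ℕ) (κ : ℝ) : ℝ :=
  32 * √(unitBallVol n / κ) * (1 + 9 * √(unitBallVol n / κ))

/-- Contract `D` towards `x` by `4^(-j)`. Restricting a mean square to the `j`-th set costs at most
`64^j`. Applied directly to the gradient this would give `8^j` against the factor `4^(-j)` of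
Poincaré, which diverges. Instead the bound is applied to the second derivatives: the gradient then
oscillates by at most a multiple of `4^(-j) 8^j = 2^j`, its averages grow no faster by telescoping,
and a second use of Poincaré makes the averages of `v` change by a multiple of `4^(-j) 2^j =
2^(-j)`. -/
theorem dist_average_shrink_le (hn : n ≤ 3) (h : FatConvex D R κ) {v : E n → ℝ}
    {g : Fin n → E n → ℝ} {g2 : Fin n → Fin n → E n → ℝ}
    (hv : MemLp v 2 (volume.restrict D)) (hg : ∀ i, MemLp (g i) 2 (volume.restrict D))
    (hg2 : ∀ i j, MemLp (g2 i j) 2 (volume.restrict D))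
    (hw : ∀ i, IsWeakDeriv (Pi.single i 1) D v (g i))
    (hw2 : ∀ i j, IsWeakDeriv (Pi.single j 1) D (g i) (g2 i j)) {x : E n} (hx : x ∈ closure D)
    (j : ℕ) :
    |(⨍ y in shrink D x ((1 / 4) ^ (j + 1)), v y) - ⨍ y in shrink D x ((1 / 4) ^ j), v y| ≤
      (sobConst n κ / 2 * (R * √(∑ i, ms D (g i)) + R ^ 2 * √(∑ i, ∑ k, ms D (g2 i k)))) *
        (1 / 2) ^ j := by
  set c := √(unitBallVol n / κ) with hc
  have hκ := h.κ_pos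
  have hω := unitBallVol_pos n
  have hR := h.R_pos
  have hc0 : 0 ≤ c := Real.sqrt_nonneg _
  have hc2 : unitBallVol n / κ = c ^ 2 := (Real.sq_sqrt (by positivity)).symm
  set A1 := √(∑ i, ms D (g i)) with hA1
  set A2 := √(∑ i, ∑ k, ms D (g2 i k)) with hA2
  have hA10 : 0 ≤ A1 := Real.sqrt_nonneg _
  have hA20 : 0 ≤ A2 := Real.sqrt_nonneg _
  have hA2sq : ∑ i, ∑ k, ms D (g2 i k) = A2 ^ 2 :=
    (Real.sq_sqrt (Finset.sum_nonneg fun i _ => Finset.sum_nonneg fun k _ => ms_nonneg _ _)).symm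
  have tpos : ∀ j : ℕ, (0 : ℝ) < (1 / 4) ^ j := fun j => by positivity
  have tle : ∀ j : ℕ, (1 / 4 : ℝ) ^ j ≤ 1 := fun j => pow_le_one₀ (by norm_num) (by norm_num)
  set S : ℕ → Set (E n) := fun j => shrink D x ((1 / 4) ^ j) with hS
  have hSf : ∀ j, FatConvex (S j) ((1 / 4) ^ j * R) κ := fun j => h.shrink x (tpos j)
  have hSD : ∀ j, S j ⊆ D := fun j => shrink_subset h.isOpen h.convex hx (tpos j) (tle j)
  have hSS : ∀ j, S (j + 1) ⊆ S j := fun j => shrink_mono h.isOpen h.convex hx (tpos _)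
    (pow_le_pow_of_le_one (by norm_num) (by norm_num) (Nat.le_succ j))
  have hmem : ∀ {f : E n → ℝ} (j : ℕ), MemLp f 2 (volume.restrict D) →
      MemLp f 2 (volume.restrict (S j)) := fun j hf =>
    hf.mono_measure (Measure.restrict_mono (hSD j) le_rfl)
  -- The place where `n ≤ 3` matters: contraction by `1/4` divides the volume by `4^n ≤ 64`.
  have hq : ∀ j, volume.real (S j) ≤ 64 * volume.real (S (j + 1)) := by
    intro j
    have e : volume.real (S (j + 1)) = (1 / 4) ^ n * volume.real (S j) := by
      simp only [hS, volume_shrink x (tpos _)]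
      rw [pow_succ, mul_pow]; ring
    rw [e]
    have h4 : (1 / 64 : ℝ) ≤ (1 / 4) ^ n := by
      calc (1 / 64 : ℝ) = (1 / 4) ^ 3 := by norm_num
        _ ≤ (1 / 4) ^ n := pow_le_pow_of_le_one (by norm_num) (by norm_num) hn
    nlinarith [(hSf j).vol_pos]
  have hqD : ∀ j, volume.real D ≤ 64 ^ j * volume.real (S j) := by
    intro j
    induction j with
    | zero => simp [hS, volume_shrink]
    | succ j ih =>
      refine ih.trans ?_
      rw [pow_succ, mul_assoc]
      exact mul_le_mul_of_nonneg_left (hq j) (by positivity)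
  have hms : ∀ {f : E n → ℝ} (j : ℕ), MemLp f 2 (volume.restrict D) →
      ms (S j) f ≤ 64 ^ j * ms D f := fun j hf =>
    ms_mono_set hf (hSD j) h.vol_pos (hSf j).vol_pos (hqD j)
  have s64 : √(64 : ℝ) = 8 := by
    rw [show (64 : ℝ) = 8 ^ 2 by norm_num]; exact Real.sqrt_sq (by norm_num)
  -- oscillation of the gradient
  have hosc : ∀ i j, √(ms (S j) (fun y => g i y - ⨍ z in S j, g i z)) ≤ c * (2 ^ j * R * A2) := by
    intro i j
    refine Real.sqrt_le_iff.2 ⟨by positivity, ?_⟩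
    refine (poincare_ms (hSf j) (hmem j (hg i)) (fun k => hmem j (hg2 i k))
      (fun k => (hw2 i k).mono (hSD j))).trans ?_
    have h1 : ∑ k, ms (S j) (g2 i k) ≤ 64 ^ j * A2 ^ 2 := by
      calc ∑ k, ms (S j) (g2 i k) ≤ ∑ k, 64 ^ j * ms D (g2 i k) :=
            Finset.sum_le_sum fun k _ => hms j (hg2 i k)
        _ = 64 ^ j * ∑ k, ms D (g2 i k) := by rw [Finset.mul_sum]
        _ ≤ 64 ^ j * A2 ^ 2 := by
            refine mul_le_mul_of_nonneg_left ?_ (by positivity)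
            rw [← hA2sq]
            exact Finset.single_le_sum (f := fun i => ∑ k, ms D (g2 i k))
              (fun i _ => Finset.sum_nonneg fun k _ => ms_nonneg _ _) (Finset.mem_univ i)
    calc unitBallVol n / κ * ((1 / 4) ^ j * R) ^ 2 * ∑ k, ms (S j) (g2 i k)
        ≤ unitBallVol n / κ * ((1 / 4) ^ j * R) ^ 2 * (64 ^ j * A2 ^ 2) := by gcongr
      _ = c ^ 2 * (((1 / 4) ^ j) ^ 2 * 64 ^ j) * (R * A2) ^ 2 := by rw [hc2]; ring
      _ = (c * (2 ^ j * R * A2)) ^ 2 := by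
          have : ((1 / 4 : ℝ) ^ j) ^ 2 * 64 ^ j = (2 ^ j) ^ 2 := by
            rw [← pow_mul, mul_comm j 2, pow_mul, ← mul_pow, ← pow_mul, mul_comm j 2, pow_mul]
            norm_num
          rw [this]; ring
  -- averages of the gradient
  have havg : ∀ i j, |⨍ z in S j, g i z| ≤ A1 + 8 * c * R * A2 * (2 ^ j - 1) := by
    intro i j
    induction j with
    | zero =>
      refine (abs_average_le (hSf 0) (hmem 0 (hg i))).trans ?_
      simp only [pow_zero, sub_self, mul_zero, add_zero]
      refine Real.sqrt_le_sqrt ((hms 0 (hg i)).trans ?_)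
      rw [pow_zero, one_mul]
      exact Finset.single_le_sum (f := fun i => ms D (g i)) (fun i _ => ms_nonneg _ _)
        (Finset.mem_univ i)
    | succ j ih =>
      have h1 := abs_average_sub_average_le (hSf j) (hSf (j + 1)) (hSS j) (by norm_num) (hq j)
        (hmem j (hg i))
      rw [s64] at h1
      have h2 := hosc i j
      have h3 : |⨍ z in S (j + 1), g i z| ≤ |⨍ z in S j, g i z| +
          |(⨍ z in S (j + 1), g i z) - ⨍ z in S j, g i z| := by
        have := abs_add_le (⨍ z in S j, g i z) ((⨍ z in S (j + 1), g i z) - ⨍ z in S j, g i z)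
        simpa using this
      rw [pow_succ]
      nlinarith
  have hB : ∀ i j, √(ms (S j) (g i)) ≤ A1 + 9 * c * R * A2 * 2 ^ j := by
    intro i j
    have h1 := sqrt_ms_le (hSf j) (hmem j (hg i))
    have h2 := havg i j
    have h3 := hosc i j
    have h4 : 0 ≤ c * R * A2 := by positivity
    nlinarith
  -- the function itself
  have h1 := abs_average_sub_average_le (hSf j) (hSf (j + 1)) (hSS j) (by norm_num) (hq j)
    (hmem j hv)
  rw [s64] at h1
  refine h1.trans ?_
  have h2 : √(ms (S j) (fun y => v y - ⨍ z in S j, v z)) ≤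
      2 * c * ((1 / 4) ^ j * R) * (A1 + 9 * c * R * A2 * 2 ^ j) := by
    refine Real.sqrt_le_iff.2 ⟨by positivity, ?_⟩
    refine (poincare_ms (hSf j) (hmem j hv) (fun i => hmem j (hg i))
      (fun i => (hw i).mono (hSD j))).trans ?_
    -- The number `n` of terms is rounded up to the square `4`, so that the root is `2`.
    have h3 : ∑ i, ms (S j) (g i) ≤ 4 * (A1 + 9 * c * R * A2 * 2 ^ j) ^ 2 := by
      calc ∑ i, ms (S j) (g i) ≤ ∑ _i : Fin n, (A1 + 9 * c * R * A2 * 2 ^ j) ^ 2 :=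
            Finset.sum_le_sum fun i _ => (Real.sqrt_le_left (by positivity)).1 (hB i j)
        _ = n * (A1 + 9 * c * R * A2 * 2 ^ j) ^ 2 := by simp
        _ ≤ 4 * (A1 + 9 * c * R * A2 * 2 ^ j) ^ 2 := by
            gcongr
            exact_mod_cast hn.trans (by norm_num)
    calc unitBallVol n / κ * ((1 / 4) ^ j * R) ^ 2 * ∑ i, ms (S j) (g i)
        ≤ unitBallVol n / κ * ((1 / 4) ^ j * R) ^ 2 * (4 * (A1 + 9 * c * R * A2 * 2 ^ j) ^ 2) := by
          gcongr
      _ = _ := by rw [hc2]; ring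
  have h5 : (1 / 4 : ℝ) ^ j = (1 / 2) ^ j * (1 / 2) ^ j := by rw [← mul_pow]; norm_num
  have h6 : (1 / 2 : ℝ) ^ j * 2 ^ j = 1 := by rw [← mul_pow]; norm_num
  have h7 : (1 / 2 : ℝ) ^ j ≤ 1 := pow_le_one₀ (by norm_num) (by norm_num)
  have h8 : (0 : ℝ) < (1 / 2) ^ j := by positivity
  calc 8 * √(ms (S j) (fun y => v y - ⨍ z in S j, v z))
      ≤ 8 * (2 * c * ((1 / 4) ^ j * R) * (A1 + 9 * c * R * A2 * 2 ^ j)) := by gcongr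
    _ = (16 * c * (R * A1 * (1 / 2) ^ j + 9 * c * (R ^ 2 * A2) * ((1 / 2) ^ j * 2 ^ j))) *
          (1 / 2) ^ j := by rw [h5]; ring
    _ ≤ (16 * c * (R * A1 * 1 + 9 * c * (R ^ 2 * A2) * 1)) * (1 / 2) ^ j := by
        rw [h6]
        gcongr
    _ ≤ _ := by
        refine mul_le_mul_of_nonneg_right ?_ h8.le
        have hX : 0 ≤ R * A1 := by positivity
        have hY : 0 ≤ R ^ 2 * A2 := by positivity
        rw [sobConst, ← hc]
        have p1 : 0 ≤ c * (c * (R * A1)) := by positivity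
        have p2 : 0 ≤ c * (R ^ 2 * A2) := by positivity
        nlinarith

theorem sobConst_nonneg (n : ℕ) (κ : ℝ) : 0 ≤ sobConst n κ := by unfold sobConst; positivity

/-- On convex sets in dimension at most three, functions in `H²` are continuous up to the
boundary. -/
theorem sobolev_sup (hn : n ≤ 3) (h : FatConvex D R κ) {v : E n → ℝ}
    {g : Fin n → E n → ℝ} {g2 : Fin n → Fin n → E n → ℝ}
    (hv : MemLp v 2 (volume.restrict D)) (hg : ∀ i, MemLp (g i) 2 (volume.restrict D))
    (hg2 : ∀ i j, MemLp (g2 i j) 2 (volume.restrict D))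
    (hw : ∀ i, IsWeakDeriv (Pi.single i 1) D v (g i))
    (hw2 : ∀ i j, IsWeakDeriv (Pi.single j 1) D (g i) (g2 i j)) :
    ∃ w : E n → ℝ, ContinuousOn w (closure D) ∧ w =ᵐ[volume.restrict D] v ∧
      ∀ x ∈ closure D, |w x| ≤ √(ms D v) +
        sobConst n κ * (R * √(∑ i, ms D (g i)) + R ^ 2 * √(∑ i, ∑ k, ms D (g2 i k))) := by
  have hfin := h.finite
  have hvi : Integrable v (volume.restrict D) := hv.integrable (by norm_num)
  set Q := R * √(∑ i, ms D (g i)) + R ^ 2 * √(∑ i, ∑ k, ms D (g2 i k)) with hQ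
  set a : ℕ → E n → ℝ := fun j x => ⨍ y in shrink D x ((1 / 4) ^ j), v y with ha
  have hstep : ∀ x ∈ closure D, ∀ j, dist (a j x) (a (j + 1) x) ≤
      (sobConst n κ / 2 * Q) * (1 / 2) ^ j := by
    intro x hx j
    rw [dist_comm, Real.dist_eq]
    exact dist_average_shrink_le hn h hv hg hg2 hw hw2 hx j
  have hlim : ∀ x, ∃ y, x ∈ closure D → Filter.Tendsto (fun j => a j x) Filter.atTop (nhds y) := by
    intro x
    by_cases hx : x ∈ closure D
    · obtain ⟨y, hy⟩ := cauchySeq_tendsto_of_complete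
        (cauchySeq_of_le_geometric _ _ (by norm_num) (hstep x hx))
      exact ⟨y, fun _ => hy⟩
    · exact ⟨0, fun h => absurd h hx⟩
  choose w hwl using hlim
  refine ⟨w, ?_, ?_, ?_⟩
  -- The geometric bound does not depend on `x`, so continuity of the averages passes to the limit,
  -- up to the boundary of `D`.
  · have hu : TendstoUniformlyOn a w Filter.atTop (closure D) := by
      rw [Metric.tendstoUniformlyOn_iff]
      intro ε hε
      have h0 : Filter.Tendsto (fun j : ℕ => (sobConst n κ / 2 * Q) * (1 / 2) ^ j / (1 - 1 / 2))
          Filter.atTop (nhds 0) := by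
        have := ((tendsto_pow_atTop_nhds_zero_of_lt_one (r := (1 / 2 : ℝ)) (by norm_num)
          (by norm_num)).const_mul (sobConst n κ / 2 * Q)).div_const (1 - 1 / 2 : ℝ)
        simpa using this
      filter_upwards [h0.eventually (gt_mem_nhds hε)] with j hj x hx
      rw [dist_comm]
      exact (dist_le_of_le_geometric_of_tendsto _ _ (by norm_num) (hstep x hx) (hwl x hx)
        j).trans_lt hj
    exact hu.continuousOn (Filter.Frequently.of_forall fun j =>
      continuousWithinAt_average_shrink h hvi (by positivity)
        (pow_le_one₀ (by norm_num) (by norm_num)))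
  · have := ae_tendsto_average_shrink h hvi
    rw [Filter.EventuallyEq]
    filter_upwards [this, ae_restrict_mem h.isOpen.measurableSet] with x hx hxD
    exact tendsto_nhds_unique (hwl x (subset_closure hxD)) hx
  · intro x hx
    have h1 := dist_le_of_le_geometric_of_tendsto₀ _ _ (by norm_num) (hstep x hx) (hwl x hx)
    have h0 : shrink D x ((1 / 4) ^ 0) = D := by
      ext y; rw [mem_shrink (by norm_num)]; simp
    have h2 : |a 0 x| ≤ √(ms D v) := by
      simp only [ha, h0]
      exact abs_average_le h hv
    rw [Real.dist_eq] at h1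
    have h3 : |w x| ≤ |a 0 x| + |a 0 x - w x| := by
      have := abs_sub (a 0 x) (a 0 x - w x)
      simpa using this
    -- The sum of the geometric series doubles the constant of a single step; this is why that
    -- constant was written as `sobConst n κ / 2`.
    have h4 : sobConst n κ / 2 * Q / (1 - 1 / 2) = sobConst n κ * Q := by ring
    rw [h4] at h1
    linarith

end Sobolev

/-! ### Families of square integrable weak derivatives -/

section SobFam

variable {n k : ℕ} {U V D : Set (E n)} {R κ : ℝ} {u : E n → ℝ} {G : (Fin n → ℕ) → E n → ℝ}

/-- `G γ` is the weak derivative `D^γ u ∈ L²(U)` for all `|γ| ≤ k`. -/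
def SobFam (k : ℕ) (U : Set (E n)) (u : E n → ℝ) (G : (Fin n → ℕ) → E n → ℝ) : Prop :=
  ∀ γ, ∑ i, γ i ≤ k → IsWeakDeriv γ U u (G γ) ∧ MemLp (G γ) 2 (volume.restrict U)

theorem SobFam.mono (h : SobFam k U u G) (hV : V ⊆ U) : SobFam k V u G := fun γ hγ =>
  ⟨(h γ hγ).1.mono hV, (h γ hγ).2.mono_measure (Measure.restrict_mono hV le_rfl)⟩

theorem SobFam.of_le {k' : ℕ} (h : SobFam k U u G) (hk : k' ≤ k) : SobFam k' U u G := fun γ hγ =>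
  h γ (hγ.trans hk)

theorem SobFam.ae_eq_zero (h : SobFam k U u G) (hU : IsOpen U) : G 0 =ᵐ[volume.restrict U] u :=
  have h0 := (h 0 (by simp)).1
  h0.ae_eq hU (isWeakDeriv_zero h0.1)

theorem SobFam.weak_single (h : SobFam k U u G) {γ : Fin n → ℕ} (hγ : ∑ i, γ i < k) (i : Fin n) :
    IsWeakDeriv (Pi.single i 1) U (G γ) (G (γ + Pi.single i 1)) :=
  (h γ hγ.le).1.split_single (h _ (by rw [sum_add_single]; exact hγ)).1

theorem memLp_of_continuous (hD : Bornology.IsBounded D) (hDm : MeasurableSet D) {f : E n → ℝ}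
    (hf : Continuous f) : MemLp f 2 (volume.restrict D) := by
  have : IsFiniteMeasure (volume.restrict D) := ⟨by simpa using hD.measure_lt_top⟩
  obtain ⟨C, hC⟩ := hD.isCompact_closure.exists_bound_of_continuousOn hf.continuousOn
  refine MemLp.of_bound hf.aestronglyMeasurable C ?_
  filter_upwards [ae_restrict_mem hDm] with x hx
  exact hC x (subset_closure hx)

theorem SobFam.sub_contDiff (h : SobFam k D u G) (hD : Bornology.IsBounded D)
    (hDm : MeasurableSet D) {p : E n → ℝ} (hp : ContDiff ℝ ∞ p) :
    SobFam k D (fun x => u x - p x) (fun γ x => G γ x - multiDeriv γ p x) := fun γ hγ =>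
  ⟨(h γ hγ).1.sub (isWeakDeriv_of_contDiff hp γ),
    (h γ hγ).2.sub (memLp_of_continuous hD hDm (contDiff_multiDeriv hp γ).continuous)⟩

theorem SobFam.sup_le (hn : n ≤ 3) (h : FatConvex D R κ) (hu : SobFam 2 D u G) :
    ∃ w : E n → ℝ, ContinuousOn w (closure D) ∧ w =ᵐ[volume.restrict D] u ∧
      ∀ x ∈ closure D, |w x| ≤ √(ms D (G 0)) +
        sobConst n κ * (R * √(∑ i, ms D (G (Pi.single i 1))) +
          R ^ 2 * √(∑ i, ∑ k, ms D (G (Pi.single i 1 + Pi.single k 1)))) := by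
  have h0 : ∑ i, (0 : Fin n → ℕ) i < 2 := by simp
  have h1 : ∀ i, ∑ j, (Pi.single i 1 : Fin n → ℕ) j = 1 := by simp
  obtain ⟨w, hw, hwu, hb⟩ := sobolev_sup hn h (v := G 0) (g := fun i => G (Pi.single i 1))
    (g2 := fun i k => G (Pi.single i 1 + Pi.single k 1)) (hu 0 h0.le).2
    (fun i => (hu _ (by rw [h1]; norm_num)).2)
    (fun i k => (hu _ (by rw [sum_add_single, h1])).2)
    (fun i => by simpa using hu.weak_single h0 i)
    (fun i k => hu.weak_single (by rw [h1]; norm_num) k)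
  exact ⟨w, hw, hwu.trans (hu.ae_eq_zero h.isOpen), hb⟩

theorem eqOn_closure_of_ae_eq (hU : IsOpen U) {f g : E n → ℝ} {s : Set (E n)}
    (hf : ContinuousOn f s) (hg : ContinuousOn g s) (hUs : U ⊆ s)
    (h : f =ᵐ[volume.restrict U] g) : EqOn f g (s ∩ closure U) := by
  have h1 := Measure.eqOn_open_of_ae_eq h hU (hf.mono hUs) (hg.mono hUs)
  rintro x ⟨hxs, hxU⟩
  have : x ∈ closure U := hxU
  have hne : (nhdsWithin x U).NeBot := mem_closure_iff_nhdsWithin_neBot.1 hxU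
  have t1 : Filter.Tendsto f (nhdsWithin x U) (nhds (f x)) := (hf x hxs).mono_left (nhdsWithin_mono _ hUs)
  have t2 : Filter.Tendsto g (nhdsWithin x U) (nhds (g x)) := (hg x hxs).mono_left (nhdsWithin_mono _ hUs)
  refine tendsto_nhds_unique t1 (t2.congr' ?_)
  filter_upwards [self_mem_nhdsWithin] with y hy
  exact (h1 hy).symm

/-- Every point of `closure Ω \ Γ` has a ball that misses `Γ`, and the intersection of `Ω` with it
is convex, so the local embedding applies. Its `κ` may depend on the point because only continuity
is wanted. Two local representatives agree on overlaps, so the diagonal `x ↦ w x x` glues them. -/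
theorem exists_continuous_rep (hn : n ≤ 3) {Ω Γ : Set (E n)} (hΩo : IsOpen Ω)
    (hΩc : Convex ℝ Ω) (hΓ : IsClosed Γ) (hu : SobFam 2 (Ω \ Γ) u G) :
    ∃ w : E n → ℝ, ContinuousOn w (closure Ω \ Γ) ∧ w =ᵐ[volume.restrict (Ω \ Γ)] u := by
  have loc : ∀ x : E n, ∃ (r : ℝ) (w : E n → ℝ), x ∈ closure Ω \ Γ → 0 < r ∧
      Metric.ball x r ∩ Γ = ∅ ∧ ContinuousOn w (closure (Ω ∩ Metric.ball x r)) ∧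
      w =ᵐ[volume.restrict (Ω ∩ Metric.ball x r)] u := by
    intro x
    by_cases hx : x ∈ closure Ω \ Γ
    swap
    · exact ⟨0, 0, fun h => absurd h hx⟩
    obtain ⟨r, hr, hrΓ⟩ := Metric.isOpen_iff.1 hΓ.isOpen_compl x hx.2
    have hdis : Metric.ball x r ∩ Γ = ∅ :=
      eq_empty_of_forall_notMem fun y hy => hrΓ hy.1 hy.2
    have ho : IsOpen (Ω ∩ Metric.ball x r) := hΩo.inter Metric.isOpen_ball
    have hne : (Ω ∩ Metric.ball x r).Nonempty := by
      obtain ⟨y, hy, hxy⟩ := Metric.mem_closure_iff.1 hx.1 r hr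
      exact ⟨y, hy, by rwa [Metric.mem_ball, dist_comm]⟩
    have hpos : 0 < volume.real (Ω ∩ Metric.ball x r) :=
      ENNReal.toReal_pos (ho.measure_pos volume hne).ne'
        ((measure_mono inter_subset_right).trans_lt measure_ball_lt_top).ne
    have hfat : FatConvex (Ω ∩ Metric.ball x r) (2 * r)
        (volume.real (Ω ∩ Metric.ball x r) / (2 * r) ^ n) :=
      { isOpen := ho
        convex := hΩc.inter (convex_ball x r)
        R_pos := by positivity
        κ_pos := by positivity
        dist_le := by
          intro y hy z hz
          have h1 := Metric.mem_ball.1 hy.2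
          have h2 := Metric.mem_ball'.1 hz.2
          linarith [dist_triangle y x z]
        le_vol := by rw [div_mul_cancel₀ _ (by positivity)] }
    have hsub : Ω ∩ Metric.ball x r ⊆ Ω \ Γ := fun y hy => ⟨hy.1, fun hc => hrΓ hy.2 hc⟩
    obtain ⟨w, hw, hwu, -⟩ := SobFam.sup_le hn hfat (hu.mono hsub)
    exact ⟨r, w, fun _ => ⟨hr, hdis, hw, hwu⟩⟩
  choose r w hrw using loc
  have hagree : ∀ x ∈ closure Ω \ Γ, ∀ y ∈ closure Ω ∩ Metric.ball x (r x), w y y = w x y := by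
    rintro x hx y ⟨hyΩ, hyx⟩
    obtain ⟨hr, hd, hc, ha⟩ := hrw x hx
    have hy : y ∈ closure Ω \ Γ := ⟨hyΩ, fun h => (hd ▸ (⟨hyx, h⟩ : y ∈ Metric.ball x (r x) ∩ Γ) : y ∈ (∅ : Set (E n)))⟩
    obtain ⟨hr', hd', hc', ha'⟩ := hrw y hy
    set U := Ω ∩ (Metric.ball x (r x) ∩ Metric.ball y (r y)) with hU
    have hUo : IsOpen U := hΩo.inter (Metric.isOpen_ball.inter Metric.isOpen_ball)
    have hUx : U ⊆ Ω ∩ Metric.ball x (r x) := fun z hz => ⟨hz.1, hz.2.1⟩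
    have hUy : U ⊆ Ω ∩ Metric.ball y (r y) := fun z hz => ⟨hz.1, hz.2.2⟩
    have hyU : y ∈ closure U := by
      rw [hU, inter_comm]
      exact (Metric.isOpen_ball.inter Metric.isOpen_ball).inter_closure
        ⟨⟨hyx, Metric.mem_ball_self hr'⟩, hyΩ⟩
    have e1 : w y =ᵐ[volume.restrict U] u := ae_restrict_of_ae_restrict_of_subset hUy ha'
    have e2 : w x =ᵐ[volume.restrict U] u := ae_restrict_of_ae_restrict_of_subset hUx ha
    have e : w y =ᵐ[volume.restrict U] w x := e1.trans e2.symm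
    exact eqOn_closure_of_ae_eq hUo (hc'.mono (closure_mono hUy)) (hc.mono (closure_mono hUx))
      subset_closure e ⟨hyU, hyU⟩
  refine ⟨fun x => w x x, ?_, ?_⟩
  · intro x hx
    obtain ⟨hr, hd, hc, ha⟩ := hrw x hx
    have hball : Metric.ball x (r x) ∈ nhds x := Metric.ball_mem_nhds x hr
    have hxc : x ∈ closure (Ω ∩ Metric.ball x (r x)) := by
      rw [inter_comm]
      exact Metric.isOpen_ball.inter_closure ⟨Metric.mem_ball_self hr, hx.1⟩
    have h1 : ContinuousWithinAt (w x) (closure Ω ∩ Metric.ball x (r x)) x :=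
      (hc x hxc).mono fun z hz => by
        rw [inter_comm]
        exact Metric.isOpen_ball.inter_closure ⟨hz.2, hz.1⟩
    have h2 : ContinuousWithinAt (fun y => w y y) (closure Ω ∩ Metric.ball x (r x)) x :=
      h1.congr (fun y hy => hagree x hx y hy) rfl
    have h3 : ContinuousWithinAt (fun y => w y y) (closure Ω) x :=
      (continuousWithinAt_inter hball).1 h2
    exact h3.mono sdiff_subset
  · have hUo : IsOpen (Ω \ Γ) := hΩo.sdiff hΓ
    rw [Filter.EventuallyEq, ae_restrict_iff' hUo.measurableSet, ae_iff]
    -- The exceptional sets are uncountably many, one for each centre; a locally null set is null.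
    refine measure_null_of_locally_null _ fun x hx => ?_
    simp only [mem_ofPred_eq, Classical.not_imp] at hx
    have hxc : x ∈ closure Ω \ Γ := ⟨subset_closure hx.1.1, hx.1.2⟩
    obtain ⟨hr, hd, hc, ha⟩ := hrw x hxc
    refine ⟨_, inter_mem_nhdsWithin _ (Metric.ball_mem_nhds x hr), ?_⟩
    rw [Filter.EventuallyEq, ae_restrict_iff' (hΩo.inter Metric.isOpen_ball).measurableSet,
      ae_iff] at ha
    refine measure_mono_null ?_ ha
    rintro y ⟨hy, hyb⟩
    simp only [mem_ofPred_eq, Classical.not_imp] at hy ⊢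
    refine ⟨⟨hy.1.1, hyb⟩, ?_⟩
    rw [← hagree x hxc y ⟨subset_closure hy.1.1, hyb⟩]
    exact hy.2

theorem contRep_spec (hn : n ≤ 3) {Ω Γ : Set (E n)} (hΩo : IsOpen Ω)
    (hΩc : Convex ℝ Ω) (hΓ : IsClosed Γ) (hu : SobFam 2 (Ω \ Γ) u G) :
    ContinuousOn (contRep Ω Γ u) (closure Ω \ Γ) ∧
      contRep Ω Γ u =ᵐ[volume.restrict (Ω \ Γ)] u := by
  have h := exists_continuous_rep hn hΩo hΩc hΓ hu
  rw [contRep, dif_pos h]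
  exact h.choose_spec

end SobFam

/-! ### Approximation by polynomials -/

section Poly

variable {n : ℕ}

/-- The monomial `x^δ`. -/
def mono (δ : Fin n → ℕ) : E n → ℝ := fun x => ∏ i, x i ^ δ i

theorem contDiff_mono (δ : Fin n → ℕ) : ContDiff ℝ ∞ (mono δ) := by
  unfold mono
  exact contDiff_prod fun i _ => by fun_prop

/-- Truncated subtraction is harmless: if `δ i = 0`, the factor `δ i` vanishes. -/
theorem pderiv_mono (δ : Fin n → ℕ) (i : Fin n) :
    pderiv i (mono δ) = fun x => (δ i : ℝ) * mono (δ - Pi.single i 1) x := by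
  funext x
  have hd : DifferentiableAt ℝ (mono δ) x := (contDiff_mono δ).differentiable (by simp) x
  have h1 : HasDerivAt (fun t : ℝ => mono δ (x + t • EuclideanSpace.single i 1))
      (pderiv i (mono δ) x) 0 := by
    have h2 : HasDerivAt (fun t : ℝ => x + t • (EuclideanSpace.single i 1 : E n))
        (EuclideanSpace.single i 1) 0 := by
      simpa using ((hasDerivAt_id (0 : ℝ)).smul_const (EuclideanSpace.single i 1 : E n)).const_add x
    have h3 : HasFDerivAt (mono δ) (fderiv ℝ (mono δ) x)
        (x + (0 : ℝ) • (EuclideanSpace.single i 1 : E n)) := by simpa using hd.hasFDerivAt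
    exact h3.comp_hasDerivAt 0 h2
  have e : (fun t : ℝ => mono δ (x + t • EuclideanSpace.single i 1)) =
      fun t => (x i + t) ^ δ i * ∏ j ∈ Finset.univ.erase i, x j ^ δ j := by
    funext t
    rw [mono, ← Finset.mul_prod_erase _ _ (Finset.mem_univ i)]
    congr 1
    · simp
    · refine Finset.prod_congr rfl fun j hj => ?_
      simp [(Finset.mem_erase.1 hj).1]
  have h4 : HasDerivAt (fun t : ℝ => (x i + t) ^ δ i * ∏ j ∈ Finset.univ.erase i, x j ^ δ j)
      ((δ i : ℝ) * x i ^ (δ i - 1) * ∏ j ∈ Finset.univ.erase i, x j ^ δ j) 0 := by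
    have := (((hasDerivAt_id (0 : ℝ)).const_add (x i)).pow (δ i)).mul_const
      (∏ j ∈ Finset.univ.erase i, x j ^ δ j)
    simpa using this
  rw [e] at h1
  rw [h1.unique h4, mono, ← Finset.mul_prod_erase _ _ (Finset.mem_univ i), mul_assoc]
  congr 2
  · simp
  · refine Finset.prod_congr rfl fun j hj => ?_
    simp [(Finset.mem_erase.1 hj).1]

theorem multiDeriv_add_single_mono (γ δ : Fin n → ℕ) (i : Fin n) :
    multiDeriv (γ + Pi.single i 1) (mono δ) =
      fun x => (δ i : ℝ) * multiDeriv γ (mono (δ - Pi.single i 1)) x := by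
  rw [multiDeriv_add_single (contDiff_mono δ), pderiv_mono,
    multiDeriv_const_mul (contDiff_mono _)]

theorem sub_single_add_single {δ : Fin n → ℕ} {i : Fin n} (h : δ i ≠ 0) :
    δ - Pi.single i 1 + Pi.single i 1 = δ := by
  funext j
  by_cases hj : j = i
  · subst hj; simp; omega
  · simp [hj]

theorem multiDeriv_mono_of_lt {γ δ : Fin n → ℕ} (h : ∑ i, δ i < ∑ i, γ i) :
    multiDeriv γ (mono δ) = 0 := by
  induction γ using multiIndex_induction generalizing δ with
  | h0 => simp at h
  | hs γ i ih =>
    rw [multiDeriv_add_single_mono]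
    by_cases hi : δ i = 0
    · funext x; simp [hi]
    · rw [ih]
      · funext x; simp
      · rw [← sub_single_add_single hi, sum_add_single, sum_add_single] at h
        omega

/-- At equal order, differentiation and monomials pair diagonally. This lets the homogeneous top
part of a polynomial be read off from its top derivatives. -/
theorem multiDeriv_mono_of_eq {γ δ : Fin n → ℕ} (h : ∑ i, δ i = ∑ i, γ i) :
    ∃ c : ℝ, multiDeriv γ (mono δ) = (fun _ => c) ∧ (γ = δ → c ≠ 0) ∧ (γ ≠ δ → c = 0) := by
  induction γ using multiIndex_induction generalizing δ with
  | h0 =>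
    have : δ = 0 := by
      funext i
      have h' : ∑ i, δ i = 0 := by rw [h]; simp
      exact (Finset.sum_eq_zero_iff.1 h') i (Finset.mem_univ i)
    subst this
    refine ⟨1, ?_, by simp, by simp⟩
    rw [multiDeriv_zero]
    funext x
    simp [mono]
  | hs γ i ih =>
    rw [multiDeriv_add_single_mono]
    by_cases hi : δ i = 0
    · refine ⟨0, by funext x; simp [hi], fun he => ?_, fun _ => rfl⟩
      rw [← he] at hi
      simp at hi
    · have hδ := sub_single_add_single hi
      obtain ⟨c, hc, h1, h2⟩ := ih (δ := δ - Pi.single i 1) (by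
        rw [← hδ, sum_add_single, sum_add_single] at h
        omega)
      refine ⟨δ i * c, by rw [hc], fun he => ?_, fun he => ?_⟩
      · refine mul_ne_zero (by exact_mod_cast hi) (h1 ?_)
        rw [← he]
        funext j
        simp
      · rw [h2, mul_zero]
        intro hγ
        exact he (by rw [hγ, hδ])

/-- The polynomials of total degree less than `k`. -/
def polySpace (n k : ℕ) : Submodule ℝ (E n → ℝ) :=
  Submodule.span ℝ (mono '' {δ | ∑ i, δ i < k})

theorem mono_mem_polySpace {k : ℕ} {δ : Fin n → ℕ} (h : ∑ i, δ i < k) : mono δ ∈ polySpace n k :=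
  Submodule.subset_span ⟨δ, h, rfl⟩

theorem polySpace_mono {k k' : ℕ} (h : k ≤ k') : polySpace n k ≤ polySpace n k' :=
  Submodule.span_mono (image_mono fun _ hδ => lt_of_lt_of_le hδ h)

theorem contDiff_of_mem_polySpace {k : ℕ} {p : E n → ℝ} (hp : p ∈ polySpace n k) :
    ContDiff ℝ ∞ p := by
  induction hp using Submodule.span_induction with
  | mem p h => obtain ⟨δ, -, rfl⟩ := h; exact contDiff_mono δ
  | zero => exact contDiff_const
  | add p q _ _ hp hq => exact hp.add hq
  | smul c p _ hp => exact contDiff_const.smul hp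

theorem multiDeriv_eq_zero_of_mem_polySpace {k : ℕ} {p : E n → ℝ} (hp : p ∈ polySpace n k)
    {γ : Fin n → ℕ} (hγ : k ≤ ∑ i, γ i) : multiDeriv γ p = 0 := by
  induction hp using Submodule.span_induction with
  | mem p h => obtain ⟨δ, hδ, rfl⟩ := h; exact multiDeriv_mono_of_lt (lt_of_lt_of_le hδ hγ)
  | zero =>
    have := multiDeriv_const_mul (n := n) (f := fun _ => 0) contDiff_const 0 γ
    simp only [zero_mul] at this
    exact this
  | add p q hp hq h1 h2 =>
    have := multiDeriv_add (contDiff_of_mem_polySpace hp) (contDiff_of_mem_polySpace hq) γ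
    change multiDeriv γ (fun x => p x + q x) = 0
    rw [this, h1, h2]
    funext x; simp
  | smul c p hp h1 =>
    have := multiDeriv_const_mul (contDiff_of_mem_polySpace hp) c γ
    change multiDeriv γ (fun x => c * p x) = 0
    rw [this, h1]
    funext x; simp

variable {D : Set (E n)} {R κ : ℝ}

/-- Induction from the top degree downwards. The derivatives of highest order are constants and fix
the homogeneous part `q`; the averages still missing are supplied by a polynomial of lower degree,
which leaves the highest derivatives unchanged. -/
theorem exists_poly_average (h : FatConvex D R κ) (k : ℕ) (c : (Fin n → ℕ) → ℝ) :
    ∃ p ∈ polySpace n k, ∀ γ, ∑ i, γ i < k → ⨍ x in D, multiDeriv γ p x = c γ := by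
  have hfin := h.finite
  have hint : ∀ {p : E n → ℝ} (_ : ContDiff ℝ ∞ p) (γ : Fin n → ℕ),
      Integrable (multiDeriv γ p) (volume.restrict D) := fun hp γ =>
    (memLp_of_continuous h.isBounded h.isOpen.measurableSet
      (contDiff_multiDeriv hp γ).continuous).integrable (by norm_num)
  induction k generalizing c with
  | zero => exact ⟨0, zero_mem _, fun γ hγ => absurd hγ (by simp)⟩
  | succ k ih =>
    have hd : ∀ δ : Fin n → ℕ, ∃ a : ℝ, a ≠ 0 ∧ multiDeriv δ (mono δ) = fun _ => a := by
      intro δ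
      obtain ⟨a, h1, h2, -⟩ := multiDeriv_mono_of_eq (γ := δ) (δ := δ) rfl
      exact ⟨a, h2 rfl, h1⟩
    choose a ha0 ha using hd
    set s := Finset.piAntidiag (Finset.univ : Finset (Fin n)) k with hs
    set q : E n → ℝ := fun x => ∑ δ ∈ s, c δ / a δ * mono δ x with hq
    have hqm : q ∈ polySpace n (k + 1) := by
      have : q = ∑ δ ∈ s, (c δ / a δ) • mono δ := by
        funext x; simp [hq]
      rw [this]
      refine Submodule.sum_mem _ fun δ hδ => Submodule.smul_mem _ _ (mono_mem_polySpace ?_)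
      rw [(Finset.mem_piAntidiag.1 hδ).1]
      exact Nat.lt_succ_self k
    have hqD : ∀ γ : Fin n → ℕ, ∑ i, γ i = k → multiDeriv γ q = fun _ => c γ := by
      intro γ hγ
      rw [hq, multiDeriv_sum s (fun δ => contDiff_mono δ)]
      funext x
      rw [Finset.sum_eq_single γ]
      · rw [ha, div_mul_cancel₀ _ (ha0 γ)]
      · intro δ hδ hne
        obtain ⟨b, h1, -, h3⟩ := multiDeriv_mono_of_eq (γ := γ) (δ := δ)
          (by rw [(Finset.mem_piAntidiag.1 hδ).1, hγ])
        rw [h1, h3 hne.symm, mul_zero]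
      · intro hγs
        exact absurd (Finset.mem_piAntidiag.2 ⟨hγ, fun i _ => Finset.mem_univ i⟩) hγs
    obtain ⟨p, hp, hpc⟩ := ih (fun γ => c γ - ⨍ x in D, multiDeriv γ q x)
    have hps := contDiff_of_mem_polySpace hp
    have hqs := contDiff_of_mem_polySpace hqm
    refine ⟨p + q, add_mem (polySpace_mono (Nat.le_succ k) hp) hqm, fun γ hγ => ?_⟩
    have e : multiDeriv γ (p + q) = fun x => multiDeriv γ p x + multiDeriv γ q x :=
      multiDeriv_add hps hqs γ
    rcases Nat.lt_succ_iff_lt_or_eq.1 hγ with hlt | heq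
    · have h1 := hpc γ hlt
      rw [e, setAverage_eq, integral_add (hint hps γ) (hint hqs γ), smul_add, ← setAverage_eq,
        ← setAverage_eq, h1]
      ring
    · rw [e, multiDeriv_eq_zero_of_mem_polySpace hp heq.ge, hqD γ heq]
      have hV := h.vol_pos
      rw [setAverage_eq]
      simp only [Pi.zero_apply, zero_add, integral_const, smul_eq_mul,
        measureReal_restrict_apply_univ]
      field_simp

/-- The Bramble–Hilbert lemma on convex sets. -/
theorem bramble_hilbert (h : FatConvex D R κ) {k : ℕ} {u : E n → ℝ} {G : (Fin n → ℕ) → E n → ℝ}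
    (hu : SobFam k D u G) :
    ∃ p ∈ polySpace n k, ∀ γ, ∑ i, γ i ≤ k → ms D (fun x => G γ x - multiDeriv γ p x) ≤
      (unitBallVol n / κ * n * R ^ 2) ^ (k - ∑ i, γ i) *
        ∑ δ ∈ Finset.piAntidiag (Finset.univ : Finset (Fin n)) k, ms D (G δ) := by
  have hfin := h.finite
  obtain ⟨p, hp, hpc⟩ := exists_poly_average h k (fun γ => ⨍ x in D, G γ x)
  have hps := contDiff_of_mem_polySpace hp
  have hfam := hu.sub_contDiff h.isBounded h.isOpen.measurableSet hps
  refine ⟨p, hp, ?_⟩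
  have hV := h.vol_pos
  have hκ := h.κ_pos
  have hω := unitBallVol_pos n
  -- Induction on the distance `j` from the top order. At order `k` the derivatives of `p` vanish;
  -- below it, `G γ - multiDeriv γ p` has mean zero by the choice of `p`, so Poincaré passes to one
  -- order higher.
  have key : ∀ j, j ≤ k → ∀ γ : Fin n → ℕ, ∑ i, γ i = k - j →
      ms D (fun x => G γ x - multiDeriv γ p x) ≤ (unitBallVol n / κ * n * R ^ 2) ^ j *
        ∑ δ ∈ Finset.piAntidiag (Finset.univ : Finset (Fin n)) k, ms D (G δ) := by
    intro j
    induction j with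
    | zero =>
      intro _ γ hγ
      rw [Nat.sub_zero] at hγ
      rw [multiDeriv_eq_zero_of_mem_polySpace hp hγ.ge, pow_zero, one_mul]
      simp only [Pi.zero_apply, sub_zero]
      exact Finset.single_le_sum (f := fun δ => ms D (G δ)) (fun δ _ => ms_nonneg _ _)
        (Finset.mem_piAntidiag.2 ⟨hγ, fun i _ => Finset.mem_univ i⟩)
    | succ j ih =>
      intro hj γ hγ
      have hlt : ∑ i, γ i < k := by omega
      have hav : ⨍ x in D, (G γ x - multiDeriv γ p x) = 0 := by
        have i1 : Integrable (G γ) (volume.restrict D) :=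
          (hu γ hlt.le).2.integrable (by norm_num)
        have i2 : Integrable (multiDeriv γ p) (volume.restrict D) :=
          (memLp_of_continuous h.isBounded h.isOpen.measurableSet
            (contDiff_multiDeriv hps γ).continuous).integrable (by norm_num)
        rw [setAverage_eq, integral_sub i1 i2, smul_sub, ← setAverage_eq, ← setAverage_eq,
          hpc γ hlt, sub_self]
      have hP := poincare_ms h (hfam γ hlt.le).2
        (fun i => (hfam (γ + Pi.single i 1) (by rw [sum_add_single]; omega)).2)
        (fun i => hfam.weak_single hlt i)
      simp only [hav, sub_zero] at hP
      refine hP.trans ?_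
      calc unitBallVol n / κ * R ^ 2 * ∑ i, ms D (fun x => G (γ + Pi.single i 1) x -
              multiDeriv (γ + Pi.single i 1) p x)
          ≤ unitBallVol n / κ * R ^ 2 * ∑ _i : Fin n, (unitBallVol n / κ * n * R ^ 2) ^ j *
              ∑ δ ∈ Finset.piAntidiag (Finset.univ : Finset (Fin n)) k, ms D (G δ) := by
            gcongr with i
            exact ih (by omega) _ (by rw [sum_add_single]; omega)
        _ = _ := by
            rw [Finset.sum_const, Finset.card_univ, Fintype.card_fin, nsmul_eq_mul, pow_succ]
            ring
  intro γ hγ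
  exact key (k - ∑ i, γ i) (Nat.sub_le _ _) γ (by omega)

end Poly

/-! ### Separately polynomial functions and Lagrange interpolation on the reference cell -/

section Lagrange

variable {n r : ℕ}

/-- The `i`-th unit vector. -/
abbrev unitVec {n : ℕ} (i : Fin n) : E n := EuclideanSpace.single i 1

/-- `f` is a polynomial of degree at most `r` along each line parallel to a coordinate axis. -/
def SepPoly (r : ℕ) (f : E n → ℝ) : Prop :=
  ∀ i x, ∃ q : Polynomial ℝ, q.natDegree ≤ r ∧ ∀ t : ℝ, f (x + t • unitVec i) = q.eval t

theorem SepPoly.sub {f g : E n → ℝ} (hf : SepPoly r f) (hg : SepPoly r g) :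
    SepPoly r (fun x => f x - g x) := by
  intro i x
  obtain ⟨p, hp, hp'⟩ := hf i x
  obtain ⟨q, hq, hq'⟩ := hg i x
  exact ⟨p - q, (Polynomial.natDegree_sub_le_of_le hp hq).trans (max_self r).le,
    fun t => by simp [hp', hq']⟩

theorem SepPoly.add {f g : E n → ℝ} (hf : SepPoly r f) (hg : SepPoly r g) :
    SepPoly r (fun x => f x + g x) := by
  intro i x
  obtain ⟨p, hp, hp'⟩ := hf i x
  obtain ⟨q, hq, hq'⟩ := hg i x
  exact ⟨p + q, (Polynomial.natDegree_add_le_of_le hp hq).trans (max_self r).le,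
    fun t => by simp [hp', hq']⟩

theorem SepPoly.const_mul {f : E n → ℝ} (hf : SepPoly r f) (c : ℝ) :
    SepPoly r (fun x => c * f x) := by
  intro i x
  obtain ⟨p, hp, hp'⟩ := hf i x
  exact ⟨Polynomial.C c * p, (Polynomial.natDegree_C_mul_le c p).trans hp,
    fun t => by simp [hp']⟩

theorem SepPoly.sum {ι : Type*} (s : Finset ι) {f : ι → E n → ℝ} (hf : ∀ a ∈ s, SepPoly r (f a)) :
    SepPoly r (fun x => ∑ a ∈ s, f a x) := by
  classical
  induction s using Finset.induction_on with
  | empty => exact fun i x => ⟨0, by simp, by simp⟩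
  | insert a s ha ih =>
    simp only [Finset.sum_insert ha]
    exact (hf a (Finset.mem_insert_self a s)).add
      (ih fun b hb => hf b (Finset.mem_insert_of_mem hb))

theorem sepPoly_prod_eval {q : Fin n → Polynomial ℝ} (hq : ∀ i, (q i).natDegree ≤ r) :
    SepPoly r (fun x => ∏ i, (q i).eval (x i)) := by
  intro i x
  refine ⟨Polynomial.C (∏ j ∈ Finset.univ.erase i, (q j).eval (x j)) *
    (q i).comp (Polynomial.C (x i) + Polynomial.X), ?_, fun t => ?_⟩
  · refine (Polynomial.natDegree_C_mul_le _ _).trans ?_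
    refine Polynomial.natDegree_comp_le.trans ?_
    refine (Nat.mul_le_mul (hq i) ?_).trans (mul_one r).le
    exact (Polynomial.natDegree_add_le_of_le (m := 1) (n := 1) (by simp) (by simp)).trans (by simp)
  · beta_reduce
    rw [← Finset.mul_prod_erase _ _ (Finset.mem_univ i)]
    simp only [Polynomial.eval_mul, Polynomial.eval_C, Polynomial.eval_comp, Polynomial.eval_add,
      Polynomial.eval_X]
    rw [mul_comm]
    congr 1
    · refine Finset.prod_congr rfl fun j hj => ?_
      simp [(Finset.mem_erase.1 hj).1]
    · simp

theorem sepPoly_eval {p : MvPolynomial (Fin n) ℝ} (hp : ∀ i, p.degreeOf i ≤ r) :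
    SepPoly r (fun x : E n => MvPolynomial.eval (fun i => x i) p) := by
  simp only [MvPolynomial.eval_eq']
  refine SepPoly.sum _ fun m hm => SepPoly.const_mul ?_ _
  have := sepPoly_prod_eval (n := n) (r := r) (q := fun i => Polynomial.X ^ m i)
    (fun i => by
      rw [Polynomial.natDegree_X_pow]
      exact (MvPolynomial.monomial_le_degreeOf i hm).trans (hp i))
  simpa using this

/-- Total degree, unlike the degree in each variable, bounds the degree along lines in all
directions, so it survives an arbitrary affine map. -/
theorem sepPoly_comp_affine {p : E n → ℝ} (hp : p ∈ polySpace n (r + 1)) (F : E n →ᵃ[ℝ] E n) :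
    SepPoly r (fun y => p (F y)) := by
  induction hp using Submodule.span_induction with
  | mem p h =>
    obtain ⟨δ, hδ, rfl⟩ := h
    intro i x
    refine ⟨∏ j, (Polynomial.C (F x j) + Polynomial.C (F.linear (unitVec i) j) * Polynomial.X) ^ δ j,
      ?_, fun t => ?_⟩
    · refine (Polynomial.natDegree_prod_le _ _).trans (le_trans ?_ (Nat.lt_succ_iff.1 hδ))
      refine Finset.sum_le_sum fun j _ => Polynomial.natDegree_pow_le.trans ?_
      refine (Nat.mul_le_mul le_rfl ?_).trans (mul_one _).le
      refine (Polynomial.natDegree_add_le_of_le (m := 1) (n := 1) (by simp) ?_).trans (by simp)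
      exact (Polynomial.natDegree_C_mul_le _ _).trans (by simp)
    · have e : F (x + t • unitVec i) = F x + t • F.linear (unitVec i) := by
        rw [add_comm, ← vadd_eq_add, AffineMap.map_vadd, map_smul, vadd_eq_add, add_comm]
      simp only [mono, Polynomial.eval_prod, Polynomial.eval_pow, Polynomial.eval_add,
        Polynomial.eval_C, Polynomial.eval_mul, Polynomial.eval_X, e]
      refine Finset.prod_congr rfl fun j _ => ?_
      simp [mul_comm]
  | zero => exact fun i x => ⟨0, by simp, by simp⟩
  | add p q _ _ hp hq => exact hp.add hq
  | smul c p _ hp => exact hp.const_mul c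

/-- The grid points of the reference cell. -/
def gnode (r : ℕ) (a : Fin n → Fin (r + 1)) : E n := WithLp.toLp 2 fun i => ((a i : ℕ) : ℝ) / r

theorem gnode_apply (a : Fin n → Fin (r + 1)) (i : Fin n) : gnode r a i = ((a i : ℕ) : ℝ) / r := rfl

theorem grid_injective (hr : 0 < r) :
    Function.Injective fun j : Fin (r + 1) => ((j : ℕ) : ℝ) / r := by
  intro a b h
  have hr' : (r : ℝ) ≠ 0 := by exact_mod_cast hr.ne'
  have h' : ((a : ℕ) : ℝ) / r = ((b : ℕ) : ℝ) / r := h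
  rw [div_left_inj' hr'] at h'
  exact Fin.ext (by exact_mod_cast h')

theorem gnode_mem_refCube (a : Fin n → Fin (r + 1)) : gnode r a ∈ refCube n := by
  intro i
  rw [gnode_apply]
  refine ⟨by positivity, div_le_one_of_le₀ ?_ (by positivity)⟩
  exact Nat.cast_le.2 (Nat.lt_succ_iff.1 (a i).2)

/-- Unisolvence, on the coordinate subspace through `y` spanned by the directions in `S`. -/
theorem eq_zero_of_grid (hr : 0 < r) (S : Finset (Fin n)) (f : E n → ℝ) (y : E n)
    (hp : ∀ i ∈ S, ∀ x : E n, (∀ j ∉ S, x j = y j) →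
      ∃ q : Polynomial ℝ, q.natDegree ≤ r ∧ ∀ t : ℝ, f (x + t • unitVec i) = q.eval t)
    (h0 : ∀ x : E n, (∀ j ∉ S, x j = y j) → (∀ j ∈ S, ∃ a : Fin (r + 1), x j = ((a : ℕ) : ℝ) / r) →
      f x = 0) {x : E n} (hx : ∀ j ∉ S, x j = y j) : f x = 0 := by
  have key : ∀ T : Finset (Fin n), T ⊆ S → ∀ x : E n, (∀ j ∉ S, x j = y j) →
      (∀ j ∈ S, j ∉ T → ∃ a : Fin (r + 1), x j = ((a : ℕ) : ℝ) / r) → f x = 0 := by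
    intro T
    induction T using Finset.induction_on with
    | empty => exact fun _ x hx hg => h0 x hx fun j hj => hg j hj (by simp)
    | insert i T hi ih =>
      intro hT x hx hg
      have hiS := hT (Finset.mem_insert_self i T)
      obtain ⟨q, hq, hqe⟩ := hp i hiS x hx
      -- The line is parametrised from `x`, so its `r + 1` grid values occur at the parameters `j /
      -- r - x i`. They are distinct and are zeros of `q` by the induction hypothesis.
      have hq0 : q = 0 := by
        refine Polynomial.eq_zero_of_natDegree_lt_card_of_eval_eq_zero q
          (f := fun j : Fin (r + 1) => ((j : ℕ) : ℝ) / r - x i) ?_ (fun a => ?_)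
          (by rw [Fintype.card_fin]; exact Nat.lt_succ_of_le hq)
        · intro a b hab
          exact grid_injective hr (sub_left_injective hab)
        · rw [← hqe]
          refine ih (fun j hj => hT (Finset.mem_insert_of_mem hj)) _ (fun j hj => ?_)
            (fun j hj hjT => ?_)
          · have : j ≠ i := fun h => hj (h ▸ hiS)
            simpa [this] using hx j hj
          · by_cases hji : j = i
            · exact ⟨a, by simp [hji]⟩
            · obtain ⟨b, hb⟩ := hg j hj (by simp [hji, hjT])
              exact ⟨b, by simpa [hji] using hb⟩
      have := hqe 0
      rw [hq0] at this
      simpa using this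
  exact key S subset_rfl x hx fun j hj hj' => absurd hj hj'

/-- The one-dimensional Lagrange basis polynomials for equidistant nodes. -/
def lag (r : ℕ) (a : Fin (r + 1)) : Polynomial ℝ :=
  Lagrange.basis Finset.univ (fun j : Fin (r + 1) => ((j : ℕ) : ℝ) / r) a

theorem natDegree_lag_le (hr : 0 < r) (a : Fin (r + 1)) : (lag r a).natDegree ≤ r := by
  rw [lag, Lagrange.natDegree_basis (grid_injective hr).injOn (Finset.mem_univ a)]
  simp

theorem eval_lag (hr : 0 < r) (a b : Fin (r + 1)) :
    (lag r a).eval (((b : ℕ) : ℝ) / r) = if a = b then 1 else 0 := by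
  split_ifs with h
  · subst h
    exact Lagrange.eval_basis_self (v := fun j : Fin (r + 1) => ((j : ℕ) : ℝ) / r)
      (grid_injective hr).injOn (Finset.mem_univ a)
  · exact Lagrange.eval_basis_of_ne (v := fun j : Fin (r + 1) => ((j : ℕ) : ℝ) / r) h
      (Finset.mem_univ b)

/-- The tensor product Lagrange basis functions on the reference cell. -/
def shape (r : ℕ) (a : Fin n → Fin (r + 1)) : E n → ℝ := fun x => ∏ i, (lag r (a i)).eval (x i)

theorem sepPoly_shape (hr : 0 < r) (a : Fin n → Fin (r + 1)) : SepPoly r (shape r a) :=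
  sepPoly_prod_eval fun i => natDegree_lag_le hr (a i)

theorem shape_gnode (hr : 0 < r) (a b : Fin n → Fin (r + 1)) :
    shape r a (gnode r b) = if a = b then 1 else 0 := by
  simp only [shape, gnode_apply, eval_lag hr, Finset.prod_boole, Finset.mem_univ, true_imp_iff]
  simp [funext_iff]

theorem contDiff_shape (a : Fin n → Fin (r + 1)) : ContDiff ℝ ∞ (shape (n := n) r a) := by
  unfold shape
  refine contDiff_prod fun i _ => ?_
  have h1 : ContDiff ℝ ∞ fun t : ℝ => (lag r (a i)).eval t := by
    simpa using (lag r (a i)).contDiff_aeval (𝕜 := ℝ) ∞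
  exact h1.comp (by fun_prop)

/-- Both sides are separately polynomial and agree on the grid, so unisolvence makes them equal
everywhere, not only in the cube. -/
theorem SepPoly.eq_sum_shape (hr : 0 < r) {f : E n → ℝ} (hf : SepPoly r f) (y : E n) :
    f y = ∑ a, f (gnode r a) * shape r a y := by
  have hsum : SepPoly r (fun y => ∑ a, f (gnode r a) * shape r a y) :=
    SepPoly.sum _ fun a _ => (sepPoly_shape hr a).const_mul _
  have := eq_zero_of_grid hr Finset.univ (fun y => f y - ∑ a, f (gnode r a) * shape r a y) 0
    (fun i _ x _ => (hf.sub hsum) i x) (fun x _ hx => ?_) (x := y) (by simp)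
  · exact sub_eq_zero.1 this
  · choose b hb using fun j => hx j (Finset.mem_univ j)
    have e : x = gnode r b := by
      ext j; exact hb j
    rw [e]
    simp [shape_gnode hr]

/-- The basis function `shape r a` as a polynomial. -/
def shapePoly (r : ℕ) (a : Fin n → Fin (r + 1)) : MvPolynomial (Fin n) ℝ :=
  ∏ i, (lag r (a i)).toMvPolynomial i

theorem eval_shapePoly (a : Fin n → Fin (r + 1)) (x : E n) :
    MvPolynomial.eval (fun i => x i) (shapePoly r a) = shape r a x := by
  simp [shapePoly, shape, MvPolynomial.eval_toMvPolynomial]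

theorem degreeOf_toMvPolynomial_le (i j : Fin n) (q : Polynomial ℝ) :
    (q.toMvPolynomial i).degreeOf j ≤ if i = j then q.natDegree else 0 := by
  conv_lhs => rw [q.as_sum_range_C_mul_X_pow]
  rw [map_sum]
  refine (MvPolynomial.degreeOf_sum_le _ _ _).trans (Finset.sup_le fun k hk => ?_)
  simp only [map_mul, Polynomial.toMvPolynomial_C, map_pow, Polynomial.toMvPolynomial_X]
  refine (MvPolynomial.degreeOf_C_mul_le _ _ _).trans ?_
  refine (MvPolynomial.degreeOf_pow_le _ _ _).trans ?_
  have := Nat.lt_succ_iff.1 (Finset.mem_range.1 hk)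
  rw [MvPolynomial.degreeOf_X]
  by_cases hij : i = j
  · simpa [hij] using this
  · simp [hij, Ne.symm hij]

theorem degreeOf_shapePoly_le (hr : 0 < r) (a : Fin n → Fin (r + 1)) (j : Fin n) :
    (shapePoly r a).degreeOf j ≤ r := by
  refine (MvPolynomial.degreeOf_prod_le j _ _).trans ?_
  calc ∑ i, ((lag r (a i)).toMvPolynomial i).degreeOf j
      ≤ ∑ i, if i = j then (lag r (a i)).natDegree else 0 :=
        Finset.sum_le_sum fun i _ => degreeOf_toMvPolynomial_le i j _
    _ = (lag r (a j)).natDegree := by simp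
    _ ≤ r := natDegree_lag_le hr _

end Lagrange

/-! ### Affine maps between faces of the reference cell -/

section Faces

variable {n r : ℕ} {s t : Fin n → Option Bool} {T : E n ≃ᵃ[ℝ] E n}

/-- The vertex of the face `s` whose free coordinates are zero. -/
def faceBase (s : Fin n → Option Bool) : E n :=
  WithLp.toLp 2 fun i => if s i = some true then 1 else 0

theorem faceBase_apply (s : Fin n → Option Bool) (i : Fin n) :
    faceBase s i = if s i = some true then 1 else 0 := rfl

theorem mem_refFace_iff {x : E n} : x ∈ refFace s ↔
    (∀ i, 0 ≤ x i ∧ x i ≤ 1) ∧ ∀ i, s i ≠ none → x i = faceBase s i := by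
  refine and_congr Iff.rfl (forall_congr' fun i => ?_)
  rw [faceBase_apply]
  rcases s i with _ | _ | _ <;> simp

theorem affine_apply_eq_sum (T : E n ≃ᵃ[ℝ] E n) (x y : E n) :
    T y = T x + ∑ i, (y i - x i) • T.linear (unitVec i) := by
  have h1 : y - x = ∑ i, (y i - x i) • (unitVec i : E n) := by
    have := (EuclideanSpace.basisFun (Fin n) ℝ).sum_repr (y - x)
    simpa using this.symm
  have h2 : T y = T.linear (y - x) + T x := by
    have := T.map_vadd x (y - x)
    simpa using this
  rw [h2, h1, map_sum, add_comm]
  simp only [map_smul]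

theorem affine_add_smul (T : E n ≃ᵃ[ℝ] E n) (x : E n) (c : ℝ) (z : E n) :
    T (x + c • z) = T x + c • T.linear z := by
  have := T.map_vadd x (c • z)
  rw [vadd_eq_add, vadd_eq_add, add_comm, map_smul] at this
  rw [this, add_comm]

/-- An extreme point argument. If `T y` were strictly between `0` and `1` in coordinate `j`, that
coordinate would be free in `t`, and a short segment through `T y` would lie in the face. Its
preimage would be a nondegenerate segment in the cube centred at the corner `y`. -/
theorem vertex_map (hT : T '' refFace s = refFace t) {y : E n} (hy : y ∈ refFace s)
    (hv : ∀ i, y i = 0 ∨ y i = 1) (j : Fin n) : T y j = 0 ∨ T y j = 1 := by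
  have hz : T y ∈ refFace t := hT ▸ mem_image_of_mem T hy
  by_contra! hc
  have h0 := (mem_refFace_iff.1 hz).1 j
  have hlt0 : 0 < T y j := lt_of_le_of_ne h0.1 hc.1.symm
  have hlt1 : T y j < 1 := lt_of_le_of_ne h0.2 hc.2
  have htj : t j = none := by
    by_contra htj
    have := (mem_refFace_iff.1 hz).2 j htj
    rw [faceBase_apply] at this
    split_ifs at this
    · exact hc.2 this
    · exact hc.1 this
  have hmem : ∀ c : ℝ, 0 ≤ T y j + c → T y j + c ≤ 1 → T y + c • unitVec j ∈ refFace t := by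
    intro c h1 h2
    rw [mem_refFace_iff] at hz ⊢
    refine ⟨fun i => ?_, fun i hi => ?_⟩
    · by_cases hij : i = j
      · subst hij; simp [h1, h2]
      · simpa [hij] using hz.1 i
    · have hij : i ≠ j := fun h => hi (h ▸ htj)
      simpa [hij] using hz.2 i hi
  set w := T.symm.linear (unitVec j) with hw
  have hback : ∀ c : ℝ, 0 ≤ T y j + c → T y j + c ≤ 1 → y + c • w ∈ refFace s := by
    intro c h1 h2
    have hm := hmem c h1 h2
    rw [← hT] at hm
    obtain ⟨z, hz, hze⟩ := hm
    have : z = y + c • w := by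
      have := congrArg T.symm hze
      rw [affine_add_smul] at this
      simpa [hw] using this
    rwa [← this]
  have hw0 : w = 0 := by
    ext i
    set δ := min (T y j) (1 - T y j)
    have hδ : 0 < δ := lt_min hlt0 (by linarith)
    have hδ1 : δ ≤ T y j := min_le_left _ _
    have hδ2 : δ ≤ 1 - T y j := min_le_right _ _
    have h1 := (mem_refFace_iff.1 (hback δ (by linarith) (by linarith))).1 i
    have h2 := (mem_refFace_iff.1 (hback (-δ) (by linarith) (by linarith))).1 i
    simp only [PiLp.add_apply, PiLp.smul_apply, smul_eq_mul] at h1 h2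
    have : δ * w i = 0 := by rcases hv i with h | h <;> rw [h] at h1 h2 <;> linarith
    simpa using (mul_eq_zero.1 this).resolve_left hδ.ne'
  have hne : (unitVec j : E n) ≠ 0 := by
    intro h
    have := congrFun (congrArg (fun v : E n => (v : Fin n → ℝ)) h) j
    simp at this
  exact hne (T.symm.linear.injective (by rw [← hw, hw0, map_zero]))

theorem faceBase_mem (s : Fin n → Option Bool) : faceBase s ∈ refFace s :=
  mem_refFace_iff.2 ⟨fun i => by rw [faceBase_apply]; split_ifs <;> simp, fun _ _ => rfl⟩

theorem faceBase_add_mem {i : Fin n} (hi : s i = none) : faceBase s + unitVec i ∈ refFace s := by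
  refine mem_refFace_iff.2 ⟨fun j => ?_, fun j hj => ?_⟩
  · by_cases hij : j = i
    · subst hij; simp [faceBase_apply, hi]
    · have := (mem_refFace_iff.1 (faceBase_mem s)).1 j
      simpa [hij] using this
  · have hij : j ≠ i := fun h => hj (h ▸ hi)
    simp [hij]

theorem faceBase_add_add_mem {i k : Fin n} (hi : s i = none) (hk : s k = none) (hik : i ≠ k) :
    faceBase s + unitVec i + unitVec k ∈ refFace s := by
  refine mem_refFace_iff.2 ⟨fun j => ?_, fun j hj => ?_⟩
  · by_cases hij : j = i
    · subst hij; simp [faceBase_apply, hi, hik]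
    · by_cases hkj : j = k
      · subst hkj; simp [faceBase_apply, hk, hij]
      · have := (mem_refFace_iff.1 (faceBase_mem s)).1 j
        simpa [hij, hkj] using this
  · have hij : j ≠ i := fun h => hj (h ▸ hi)
    have hkj : j ≠ k := fun h => hj (h ▸ hk)
    simp [hij, hkj]

theorem faceBase_vertex (s : Fin n → Option Bool) (i : Fin n) :
    faceBase s i = 0 ∨ faceBase s i = 1 := by
  rw [faceBase_apply]; split_ifs <;> simp

/-- At the four corners of the square spanned by directions `i` and `k`, coordinate `j` of `T` takes
the values `a`, `a + b`, `a + c`, `a + b + c`. All are `0` or `1`, which excludes `b` and `c` both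
being nonzero. -/
theorem linear_row (hT : T '' refFace s = refFace t) {i k : Fin n} (hi : s i = none)
    (hk : s k = none) (hik : i ≠ k) (j : Fin n) :
    T.linear (unitVec i) j = 0 ∨ T.linear (unitVec k) j = 0 := by
  have hadd : ∀ x z : E n, T (x + z) = T x + T.linear z := fun x z => by
    simpa using affine_add_smul T x 1 z
  have v : ∀ (i l : Fin n), s i = none → (faceBase s + unitVec i) l = 0 ∨
      (faceBase s + unitVec i) l = 1 := by
    intro i l hi
    by_cases hl : l = i
    · subst hl; simp [faceBase_apply, hi]
    · simpa [hl] using faceBase_vertex s l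
  have h0 := vertex_map hT (faceBase_mem s) (faceBase_vertex s) j
  have h1 := vertex_map hT (faceBase_add_mem hi) (fun l => v i l hi) j
  have h2 := vertex_map hT (faceBase_add_mem hk) (fun l => v k l hk) j
  have h3 := vertex_map hT (faceBase_add_add_mem hi hk hik) (fun l => by
    by_cases hl : l = k
    · subst hl; simp [faceBase_apply, hk, hik.symm]
    · simpa [hl] using v i l hi) j
  rw [hadd] at h1 h2
  rw [hadd, hadd] at h3
  simp only [PiLp.add_apply] at h1 h2 h3
  by_contra! hc
  obtain ⟨c1, c2⟩ := hc
  rcases h0 with h0 | h0 <;> rw [h0] at h1 h2 h3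
  · have e1 := h1.resolve_left (by simpa using c1)
    have e2 := h2.resolve_left (by simpa using c2)
    rcases h3 with h3 | h3 <;> linarith
  · have e1 := h1.resolve_right (by simpa using c1)
    have e2 := h2.resolve_right (by simpa using c2)
    rcases h3 with h3 | h3 <;> linarith

theorem apply_eq_of_row (hT : T '' refFace s = refFace t) {i : Fin n} (hi : s i = none) {j : Fin n}
    (hij : T.linear (unitVec i) j ≠ 0) {y : E n} (hy : ∀ k, s k ≠ none → y k = faceBase s k) :
    T y j = T (faceBase s) j + y i * T.linear (unitVec i) j := by
  rw [affine_apply_eq_sum T (faceBase s) y]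
  simp only [PiLp.add_apply, WithLp.ofLp_sum, Finset.sum_apply, PiLp.smul_apply, smul_eq_mul]
  congr 1
  rw [Finset.sum_eq_single i]
  · simp [faceBase_apply, hi]
  · intro k _ hki
    by_cases hk : s k = none
    · rw [(linear_row hT hk hi hki j).resolve_right hij, mul_zero]
    · rw [hy k hk, sub_self, zero_mul]
  · simp

/-- If direction `i` moved both coordinates `j` and `j'`, then on the face both would be functions
of `y i` alone. But `j'` is free in the target face and can be varied while `j` stays put. -/
theorem linear_column (hT : T '' refFace s = refFace t) {i : Fin n} (hi : s i = none) {j j' : Fin n}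
    (hjj : j ≠ j') : T.linear (unitVec i) j = 0 ∨ T.linear (unitVec i) j' = 0 := by
  by_contra! hc
  obtain ⟨hj, hj'⟩ := hc
  have hb : T (faceBase s) ∈ refFace t := hT ▸ mem_image_of_mem T (faceBase_mem s)
  have hb' := mem_refFace_iff.1 hb
  have htj' : t j' = none := by
    by_contra htj
    have h1 : T (faceBase s + unitVec i) ∈ refFace t :=
      hT ▸ mem_image_of_mem T (faceBase_add_mem hi)
    have e1 := (mem_refFace_iff.1 h1).2 j' htj
    rw [apply_eq_of_row hT hi hj' (mem_refFace_iff.1 (faceBase_add_mem hi)).2,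
      hb'.2 j' htj] at e1
    have e2 : (faceBase s + unitVec i) i = 1 := by simp [faceBase_apply, hi]
    rw [e2] at e1
    exact hj' (by linarith)
  -- The image of the base vertex reflected in coordinate `j'` only. It agrees with that vertex in
  -- coordinate `j`, which forces `y i = 0` for its preimage and hence no change in coordinate `j'`.
  set z : E n := T (faceBase s) + (1 - 2 * T (faceBase s) j') • unitVec j' with hz
  have hzm : z ∈ refFace t := by
    refine mem_refFace_iff.2 ⟨fun l => ?_, fun l hl => ?_⟩
    · by_cases hl : l = j'
      · subst hl
        have := hb'.1 l
        simp only [hz, PiLp.add_apply, PiLp.smul_apply, PiLp.single_apply, if_true,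
          smul_eq_mul, mul_one]
        constructor <;> linarith
      · simpa [hz, hl] using hb'.1 l
    · have : l ≠ j' := fun h => hl (h ▸ htj')
      simpa [hz, this] using hb'.2 l hl
  rw [← hT] at hzm
  obtain ⟨y, hy, hyz⟩ := hzm
  have hy' := (mem_refFace_iff.1 hy).2
  have e1 := apply_eq_of_row hT hi hj hy'
  have e2 := apply_eq_of_row hT hi hj' hy'
  rw [hyz] at e1 e2
  have z1 : z j = T (faceBase s) j := by simp [hz, hjj]
  have z2 : z j' = 1 - T (faceBase s) j' := by
    simp only [hz, PiLp.add_apply, PiLp.smul_apply, PiLp.single_apply, if_true,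
          smul_eq_mul, mul_one]
    ring
  rw [z1] at e1
  have hyi : y i = 0 := by
    have : y i * T.linear (unitVec i) j = 0 := by linarith
    exact (mul_eq_zero.1 this).resolve_right hj
  rw [z2, hyi] at e2
  rcases vertex_map hT (faceBase_mem s) (faceBase_vertex s) j' with h | h <;>
    rw [h] at e2 <;> linarith

theorem linear_unitVec (hT : T '' refFace s = refFace t) {i : Fin n} (hi : s i = none) :
    ∃ (j : Fin n) (c : ℝ), T.linear (unitVec i) = c • unitVec j := by
  by_cases h : ∃ j, T.linear (unitVec i) j ≠ 0
  · obtain ⟨j, hj⟩ := h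
    refine ⟨j, T.linear (unitVec i) j, ?_⟩
    ext l
    by_cases hl : l = j
    · subst hl; simp
    · have := (linear_column hT hi hl).resolve_right hj
      rw [this]
      simp [hl]
  · push Not at h
    exact ⟨i, 0, by ext l; simpa using h l⟩

/-- On the face each coordinate of `T` is constantly `0` or `1`, or equals `y i` or `1 - y i` for
one free `i`. The equidistant grid is invariant under the reflection, which is `Fin.rev` on indices.
-/
theorem grid_map (hr : 0 < r) (hT : T '' refFace s = refFace t) {a : Fin n → Fin (r + 1)}
    (ha : gnode r a ∈ refFace s) : ∃ b, T (gnode r a) = gnode r b := by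
  have hr' : (r : ℝ) ≠ 0 := by exact_mod_cast hr.ne'
  have zero_one : ∀ x : ℝ, x = 0 ∨ x = 1 → ∃ b : Fin (r + 1), x = ((b : ℕ) : ℝ) / r := by
    rintro x (rfl | rfl)
    · exact ⟨0, by simp⟩
    · exact ⟨Fin.last r, by simp [hr']⟩
  have key : ∀ j, ∃ b : Fin (r + 1), T (gnode r a) j = ((b : ℕ) : ℝ) / r := by
    intro j
    have h0 := vertex_map hT (faceBase_mem s) (faceBase_vertex s) j
    by_cases h : ∃ i, s i = none ∧ T.linear (unitVec i) j ≠ 0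
    · obtain ⟨i, hi, hij⟩ := h
      have e := apply_eq_of_row hT hi hij (mem_refFace_iff.1 ha).2
      have h1 := vertex_map hT (faceBase_add_mem hi) (fun l => by
        by_cases hl : l = i
        · subst hl; simp [faceBase_apply, hi]
        · simpa [hl] using faceBase_vertex s l) j
      rw [apply_eq_of_row hT hi hij (mem_refFace_iff.1 (faceBase_add_mem hi)).2] at h1
      have e2 : (faceBase s + unitVec i) i = 1 := by simp [faceBase_apply, hi]
      rw [e2, one_mul] at h1
      rcases h0 with h0 | h0 <;> rw [h0] at h1 e
      · have : T.linear (unitVec i) j = 1 := by simpa [hij] using h1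
        exact ⟨a i, by rw [e, this, gnode_apply]; ring⟩
      · have : T.linear (unitVec i) j = -1 := by
          rcases h1 with h1 | h1
          · linarith
          · exact absurd (by linarith) hij
        refine ⟨Fin.rev (a i), ?_⟩
        rw [e, this, gnode_apply, Fin.val_rev]
        have h3 : (a i : ℕ) ≤ r := Nat.lt_succ_iff.1 (a i).2
        have h4 : r + 1 - ((a i : ℕ) + 1) = r - (a i : ℕ) := by omega
        rw [h4, Nat.cast_sub h3]
        field_simp
        ring
    · push Not at h
      have e : T (gnode r a) j = T (faceBase s) j := by
        rw [affine_apply_eq_sum T (faceBase s) (gnode r a)]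
        simp only [PiLp.add_apply, WithLp.ofLp_sum, Finset.sum_apply, PiLp.smul_apply, smul_eq_mul]
        rw [add_eq_left]
        refine Finset.sum_eq_zero fun k _ => ?_
        by_cases hk : s k = none
        · rw [h k hk, mul_zero]
        · rw [(mem_refFace_iff.1 ha).2 k hk, sub_self, zero_mul]
      rw [e]
      exact zero_one _ h0
  choose b hb using key
  exact ⟨b, by ext j; exact hb j⟩

/-- Two separately polynomial functions that agree at corresponding grid points of a common face
agree on that face. -/
theorem eq_on_face (hr : 0 < r) (hT : T '' refFace s = refFace t) {f g : E n → ℝ}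
    (hf : SepPoly r f) (hg : SepPoly r g)
    (hfg : ∀ a b, T (gnode r a) = gnode r b → f (gnode r a) = g (gnode r b))
    {y : E n} (hy : y ∈ refFace s) : f y = g (T y) := by
  have hr' : (r : ℝ) ≠ 0 := by exact_mod_cast hr.ne'
  set S := Finset.univ.filter fun i => s i = none with hS
  have hmem : ∀ i, i ∈ S ↔ s i = none := fun i => by simp [hS]
  have := eq_zero_of_grid hr S (fun y => f y - g (T y)) (faceBase s) (fun i hi x _ => ?_)
    (fun x hx hg' => ?_) (x := y) (fun j hj => ?_)
  · exact sub_eq_zero.1 this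
  · obtain ⟨p, hp, hpe⟩ := hf i x
    obtain ⟨j, c, hc⟩ := linear_unitVec hT ((hmem i).1 hi)
    obtain ⟨q, hq, hqe⟩ := hg j (T x)
    refine ⟨p - q.comp (Polynomial.C c * Polynomial.X), ?_, fun t => ?_⟩
    · refine (Polynomial.natDegree_sub_le_of_le hp ?_).trans (max_self r).le
      refine Polynomial.natDegree_comp_le.trans ((Nat.mul_le_mul hq ?_).trans (mul_one r).le)
      exact (Polynomial.natDegree_C_mul_le _ _).trans (by simp)
    · simp only [hpe, affine_add_smul, hc, smul_smul, hqe, Polynomial.eval_sub,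
        Polynomial.eval_comp, Polynomial.eval_mul, Polynomial.eval_C, Polynomial.eval_X]
      rw [mul_comm]
  · have : ∀ j, ∃ b : Fin (r + 1), x j = ((b : ℕ) : ℝ) / r := by
      intro j
      by_cases hj : j ∈ S
      · exact hg' j hj
      · rw [hx j hj]
        rcases faceBase_vertex s j with h | h <;> rw [h]
        · exact ⟨0, by simp⟩
        · exact ⟨Fin.last r, by simp [hr']⟩
    choose a ha using this
    have hxa : x = gnode r a := by ext j; exact ha j
    have hxf : gnode r a ∈ refFace s := by
      refine mem_refFace_iff.2 ⟨gnode_mem_refCube a, fun j hj => ?_⟩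
      rw [← hxa]
      exact hx j (by rwa [hmem])
    obtain ⟨b, hb⟩ := grid_map hr hT hxf
    rw [hxa, hb, hfg a b hb, sub_self]
  · exact (mem_refFace_iff.1 hy).2 j (by rwa [hmem] at hj)

end Faces

/-! ### The nodal basis -/

section Nodal

variable {n r : ℕ} {Ω : Set (E n)}

open Classical in
/-- The restriction to the cell `K`, in reference coordinates, of the nodal basis function
at `p`. -/
def localBasis (M : Mesh Ω) (r : ℕ) (p : E n) (K : Fin M.N) : E n → ℝ := fun y =>
  ∑ a, (if M.F K (gnode r a) = p then 1 else 0) * shape r a y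

theorem sepPoly_localBasis (hr : 0 < r) (M : Mesh Ω) (p : E n) (K : Fin M.N) :
    SepPoly r (localBasis M r p K) :=
  SepPoly.sum _ fun a _ => (sepPoly_shape hr a).const_mul _

open Classical in
theorem localBasis_gnode (hr : 0 < r) (M : Mesh Ω) (p : E n) (K : Fin M.N)
    (b : Fin n → Fin (r + 1)) :
    localBasis M r p K (gnode r b) = if M.F K (gnode r b) = p then 1 else 0 := by
  simp [localBasis, shape_gnode hr]

theorem continuous_localBasis (M : Mesh Ω) (p : E n) (K : Fin M.N) :
    Continuous (localBasis M r p K) :=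
  continuous_finsetSum _ fun a _ => continuous_const.mul (contDiff_shape a).continuous

/-- Conformity makes the intersection a face of both cells, carried onto itself by the transition
map. The nodal data are prescribed at physical points, so both sides agree at corresponding grid
points and `eq_on_face` applies. -/
theorem localBasis_consistent (hr : 0 < r) (M : Mesh Ω) (p : E n) {i j : Fin M.N} {x : E n}
    (hi : x ∈ M.cell i) (hj : x ∈ M.cell j) :
    localBasis M r p i ((M.F i).symm x) = localBasis M r p j ((M.F j).symm x) := by
  by_cases hij : i = j
  · rw [hij]
  rcases M.conforming i j hij with h | ⟨s, t, -, -, hs, ht⟩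
  · exact absurd (h ▸ (⟨hi, hj⟩ : x ∈ M.F i '' refCube n ∩ M.F j '' refCube n)) (notMem_empty x)
  set T : E n ≃ᵃ[ℝ] E n := (M.F i).trans (M.F j).symm with hT
  have hTa : ∀ y, T y = (M.F j).symm (M.F i y) := fun y => rfl
  have hTst : T '' refFace s = refFace t := by
    have e : M.F i '' refFace s = M.F j '' refFace t := hs.symm.trans ht
    have : T '' refFace s = (M.F j).symm '' (M.F i '' refFace s) := by
      rw [image_image]; rfl
    rw [this, e, image_image]
    simp
  have hx : x ∈ M.F i '' refFace s := hs ▸ ⟨hi, hj⟩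
  obtain ⟨y, hy, rfl⟩ := hx
  rw [AffineEquiv.symm_apply_apply, ← hTa]
  refine eq_on_face hr hTst (sepPoly_localBasis hr M p i) (sepPoly_localBasis hr M p j)
    (fun a b hab => ?_) hy
  have : M.F j (gnode r b) = M.F i (gnode r a) := by
    rw [← hab, hTa, AffineEquiv.apply_symm_apply]
  rw [localBasis_gnode hr, localBasis_gnode hr, this]

/-- A functional `f` separates `M.F K y` from `Ω`; over the reference cube it is affine with a
maximum at `y`. A grid point `gnode r a` mapped to `p ∈ Ω` has a strictly smaller value, so in some
direction `i` the slope is nonzero and the coordinates differ. Maximality forces `y i` to be `0` or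
`1`, a grid value other than that of `a`, where the `i`-th Lagrange factor vanishes. -/
theorem localBasis_eq_zero (hr : 0 < r) (hΩo : IsOpen Ω) (hΩc : Convex ℝ Ω) (M : Mesh Ω) {p : E n}
    (hp : p ∈ Ω) {K : Fin M.N} {y : E n} (hy : y ∈ refCube n) (hyΩ : M.F K y ∉ Ω) :
    localBasis M r p K y = 0 := by
  obtain ⟨f, hf⟩ := geometric_hahn_banach_open_point hΩc hΩo hyΩ
  have hcl : ∀ z ∈ refCube n, f (M.F K z) ≤ f (M.F K y) := by
    intro z hz
    have hz' : M.F K z ∈ closure Ω := by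
      rw [M.cover]
      exact mem_iUnion.2 ⟨K, mem_image_of_mem _ hz⟩
    exact le_on_closure (fun a ha => (hf a ha).le) f.continuous.continuousOn
      continuousOn_const hz'
  have hexp : ∀ z, f (M.F K z) = f (M.F K y) +
      ∑ i, (z i - y i) * f ((M.F K).linear (unitVec i)) := by
    intro z
    rw [affine_apply_eq_sum (M.F K) y z, map_add, map_sum]
    simp
  refine Finset.sum_eq_zero fun a _ => ?_
  split_ifs with ha
  swap
  · rw [zero_mul]
  rw [one_mul]
  have hlt : f (M.F K (gnode r a)) < f (M.F K y) := by rw [ha]; exact hf p hp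
  rw [hexp] at hlt
  have : ∃ i, (gnode r a i - y i) * f ((M.F K).linear (unitVec i)) < 0 := by
    by_contra! hc
    have := Finset.sum_nonneg fun i (_ : i ∈ Finset.univ) => hc i
    linarith
  obtain ⟨i, hi⟩ := this
  have hg := gnode_mem_refCube a i
  have hyi := hy i
  -- moving `y` in direction `i` inside the cube cannot increase `f`
  have hmove : ∀ c : ℝ, 0 ≤ y i + c → y i + c ≤ 1 → c * f ((M.F K).linear (unitVec i)) ≤ 0 := by
    intro c h0 h1
    have hz : y + c • unitVec i ∈ refCube n := by
      intro j
      by_cases hj : j = i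
      · subst hj; simp [h0, h1]
      · simpa [hj] using hy j
    have := hcl _ hz
    rw [affine_add_smul, map_add, map_smul, smul_eq_mul] at this
    linarith
  have hm0 := hmove (-y i) (by linarith) (by linarith)
  have hm1 := hmove (1 - y i) (by linarith) (by linarith)
  have hy01 : (y i = 0 ∨ y i = 1) ∧ gnode r a i ≠ y i := by
    refine ⟨?_, fun h => by rw [h, sub_self, zero_mul] at hi; exact lt_irrefl _ hi⟩
    by_contra! hc
    have h0 : 0 < y i := lt_of_le_of_ne hyi.1 hc.1.symm
    have h1 : y i < 1 := lt_of_le_of_ne hyi.2 hc.2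
    have : f ((M.F K).linear (unitVec i)) = 0 := by nlinarith
    rw [this, mul_zero] at hi
    exact lt_irrefl _ hi
  have hr' : (r : ℝ) ≠ 0 := by exact_mod_cast hr.ne'
  have hgrid : ∃ b : Fin (r + 1), y i = ((b : ℕ) : ℝ) / r := by
    rcases hy01.1 with h | h
    · exact ⟨0, by simp [h]⟩
    · exact ⟨Fin.last r, by simp [h, hr']⟩
  obtain ⟨b, hb⟩ := hgrid
  refine Finset.prod_eq_zero (Finset.mem_univ i) ?_
  rw [hb, eval_lag hr, if_neg]
  rintro rfl
  exact hy01.2 hb.symm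

theorem isClosed_refCube : IsClosed (refCube n) := by
  have : refCube n = ⋂ i, {x : E n | 0 ≤ x i} ∩ {x | x i ≤ 1} := by
    ext x; simp [refCube]
  rw [this]
  exact isClosed_iInter fun i => (isClosed_le continuous_const (by fun_prop)).inter
    (isClosed_le (by fun_prop) continuous_const)

/-- An affine automorphism of `ℝⁿ` as a homeomorphism. -/
def affHomeo (F : E n ≃ᵃ[ℝ] E n) : E n ≃ₜ E n := (AffineEquiv.toContinuousAffineEquiv F).toHomeomorph

theorem continuous_affine (F : E n ≃ᵃ[ℝ] E n) : Continuous F := (affHomeo F).continuous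

theorem isClosed_cell (M : Mesh Ω) (K : Fin M.N) : IsClosed (M.cell K) :=
  (affHomeo (M.F K)).isClosedMap _ isClosed_refCube

theorem symm_mem_refCube {M : Mesh Ω} {K : Fin M.N} {x : E n} (hx : x ∈ M.cell K) :
    (M.F K).symm x ∈ refCube n := by
  obtain ⟨y, hy, rfl⟩ := hx
  rwa [AffineEquiv.symm_apply_apply]

theorem mem_nodes_iff {M : Mesh Ω} {q : E n} :
    q ∈ M.nodes r ↔ (∃ K a, M.F K (gnode r a) = q) ∧ q ∈ Ω := by
  classical
  simp only [Mesh.nodes, Finset.mem_filter, Finset.mem_image, Finset.mem_univ, true_and,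
    Prod.exists]
  rfl

theorem exists_nodal (hr : 0 < r) (hΩo : IsOpen Ω) (hΩc : Convex ℝ Ω) (M : Mesh Ω) {p : E n}
    (hp : p ∈ Ω) :
    ∃ v ∈ M.feSpace r, ∀ q ∈ M.nodes r, v q = if q = p then 1 else 0 := by
  classical
  set v : E n → ℝ := fun x =>
    if h : ∃ K, x ∈ M.cell K then localBasis M r p h.choose ((M.F h.choose).symm x) else 0 with hv
  have hvK : ∀ K, ∀ x ∈ M.cell K, v x = localBasis M r p K ((M.F K).symm x) := by
    intro K x hx
    have h : ∃ K, x ∈ M.cell K := ⟨K, hx⟩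
    simp only [hv, dif_pos h]
    exact localBasis_consistent hr M p h.choose_spec hx
  have hvΩ : ∀ x ∉ Ω, v x = 0 := by
    intro x hx
    by_cases h : ∃ K, x ∈ M.cell K
    · obtain ⟨K, hK⟩ := h
      rw [hvK K x hK]
      refine localBasis_eq_zero hr hΩo hΩc M hp (symm_mem_refCube hK) ?_
      rwa [AffineEquiv.apply_symm_apply]
    · simp only [hv, dif_neg h]
  refine ⟨v, ⟨?_, hvΩ, fun K => ?_⟩, fun q hq => ?_⟩
  -- Continuity is checked on a finite closed cover: the cells, and the complement of `Ω` under the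
  -- index `none`.
  · let A : Option (Fin M.N) → Set (E n) := fun o => o.elim Ωᶜ M.cell
    have hA : LocallyFinite A := locallyFinite_of_finite A
    refine hA.continuous (iUnion_eq_univ_iff.2 fun x => ?_) (fun o => ?_) (fun o => ?_)
    · by_cases hx : x ∈ Ω
      · have : x ∈ closure Ω := subset_closure hx
        rw [M.cover] at this
        obtain ⟨K, hK⟩ := mem_iUnion.1 this
        exact ⟨some K, hK⟩
      · exact ⟨none, hx⟩
    · rcases o with _ | K
      · exact hΩo.isClosed_compl
      · exact isClosed_cell M K
    · rcases o with _ | K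
      · exact continuousOn_const.congr fun x hx => hvΩ x hx
      · exact (((continuous_localBasis M p K).comp
          (continuous_affine (M.F K).symm)).continuousOn).congr fun x hx => hvK K x hx
  · refine ⟨∑ a, MvPolynomial.C (if M.F K (gnode r a) = p then 1 else 0) * shapePoly r a,
      fun i => ?_, fun x hx => ?_⟩
    · refine (MvPolynomial.degreeOf_sum_le _ _ _).trans (Finset.sup_le fun a _ => ?_)
      exact (MvPolynomial.degreeOf_C_mul_le _ _ _).trans (degreeOf_shapePoly_le hr a i)
    · rw [hvK K x hx, map_sum]
      refine Finset.sum_congr rfl fun a _ => ?_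
      rw [map_mul, MvPolynomial.eval_C, eval_shapePoly]
  · obtain ⟨⟨K, b, rfl⟩, -⟩ := mem_nodes_iff.1 hq
    rw [hvK K _ (mem_image_of_mem _ (gnode_mem_refCube b)), AffineEquiv.symm_apply_apply,
      localBasis_gnode hr]

theorem feSpace_eq_sum_shape (hr : 0 < r) {M : Mesh Ω} {v : E n → ℝ} (hv : v ∈ M.feSpace r)
    (K : Fin M.N) {y : E n} (hy : y ∈ refCube n) :
    v (M.F K y) = ∑ a, v (M.F K (gnode r a)) * shape r a y := by
  obtain ⟨p, hp, hpe⟩ := hv.2.2 K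
  have e : ∀ y ∈ refCube n, v (M.F K y) = MvPolynomial.eval (fun i => y i) p := by
    intro y hy
    rw [hpe _ (mem_image_of_mem _ hy), AffineEquiv.symm_apply_apply]
  rw [e y hy, (sepPoly_eval hp).eq_sum_shape hr y]
  exact Finset.sum_congr rfl fun a _ => by rw [e _ (gnode_mem_refCube a)]

/-- The values of `Π_h u` at the nodal points. -/
def nodeVal (M : Mesh Ω) (Γ : Set (E n)) (σ h : ℝ) (u : E n → ℝ) (p : E n) : ℝ :=
  open Classical in
  if p ∈ Ω ∧ ∃ K, ¬ M.IsIn Γ σ h K ∧ p ∈ M.cell K then contRep Ω Γ u p else 0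

/-- The basis functions are obtained by choice, but their values at all grid points are known: the
delta property at nodes, and zero outside `Ω`. Unisolvence on the cell does the rest. -/
theorem interp_eq_sum_shape (hr : 0 < r) (hΩo : IsOpen Ω) (hΩc : Convex ℝ Ω) (M : Mesh Ω)
    (Γ : Set (E n)) (σ h : ℝ) (u : E n → ℝ) (K : Fin M.N) {y : E n} (hy : y ∈ refCube n) :
    M.interp Γ σ h r u (M.F K y) =
      ∑ a, nodeVal M Γ σ h u (M.F K (gnode r a)) * shape r a y := by
  classical
  have spec : ∀ p ∈ M.nodes r, M.nodalBasis r p ∈ M.feSpace r ∧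
      ∀ q ∈ M.nodes r, M.nodalBasis r p q = if q = p then 1 else 0 := by
    intro p hp
    have hex := exists_nodal hr hΩo hΩc M (mem_nodes_iff.1 hp).2
    have h1 : M.nodalBasis r p = hex.choose := by
      rw [Mesh.nodalBasis]
      exact dif_pos hex
    rw [h1]
    exact ⟨hex.choose_spec.1, fun q hq => by rw [hex.choose_spec.2 q hq]⟩
  have hnode : ∀ a, M.interp Γ σ h r u (M.F K (gnode r a)) =
      nodeVal M Γ σ h u (M.F K (gnode r a)) := by
    intro a
    set q := M.F K (gnode r a) with hq
    rw [Mesh.interp]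
    by_cases hqΩ : q ∈ Ω
    · have hqn : q ∈ M.nodes r := mem_nodes_iff.2 ⟨⟨K, a, rfl⟩, hqΩ⟩
      have e : ∀ p ∈ (M.nodes r).filter (fun p => ∃ K, ¬ M.IsIn Γ σ h K ∧ p ∈ M.cell K),
          contRep Ω Γ u p * M.nodalBasis r p q = if q = p then contRep Ω Γ u p else 0 := by
        intro p hp
        rw [(spec p (Finset.mem_filter.1 hp).1).2 q hqn]
        split_ifs <;> simp
      rw [Finset.sum_congr rfl e, Finset.sum_ite_eq, nodeVal]
      simp only [Finset.mem_filter, hqn, true_and, hqΩ]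
    · rw [nodeVal, if_neg fun hc => hqΩ hc.1]
      refine Finset.sum_eq_zero fun p hp => ?_
      rw [(spec p (Finset.mem_filter.1 hp).1).1.2.1 q hqΩ, mul_zero]
  simp only [← hnode]
  simp only [Mesh.interp, Finset.sum_mul]
  rw [Finset.sum_comm]
  refine Finset.sum_congr rfl fun p hp => ?_
  rw [feSpace_eq_sum_shape hr (spec p (Finset.mem_filter.1 hp).1).1 K hy, Finset.mul_sum]
  exact Finset.sum_congr rfl fun a _ => by ring

end Nodal

/-! ### Integrals of powers of the distance to a Lipschitz surface -/

section Surface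

variable {n : ℕ}

/-- A packing argument. Translates of the tube by multiples of `2 * s` along `ν` are disjoint,
because `f` grows with slope one in that direction. About `R / s` of them fit into the ball of
radius `(3 + 2 * b) * R`. -/
theorem volume_graph_tube_le {ν : E n} (hν : ‖ν‖ = 1) {f : E n → ℝ} (hf : Continuous f)
    (hfν : ∀ y s, f (y + s • ν) = f y + s) (x : E n) {R s b : ℝ} (hR : 0 < R) (hs : 0 < s)
    (hsb : s ≤ b * R) :
    volume ({y | |f y| < s} ∩ Metric.closedBall x R) ≤
      ENNReal.ofReal (s / R * ((3 + 2 * b) ^ n * unitBallVol n * R ^ n)) := by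
  set A := {y | |f y| < s} ∩ Metric.closedBall x R with hA
  have hAm : MeasurableSet A :=
    (isOpen_lt hf.abs continuous_const).measurableSet.inter Metric.isClosed_closedBall.measurableSet
  have hb : 0 < b := by
    by_contra! hb
    nlinarith
  set J := ⌈R / s⌉₊ with hJ
  have hJ1 : R / s ≤ J := Nat.le_ceil _
  have hJ2 : (J : ℝ) < R / s + 1 := Nat.ceil_lt_add_one (by positivity)
  set B : ℕ → Set (E n) := fun j => (fun y => y + (-(2 * s * j)) • ν) ⁻¹' A with hB
  have hBm : ∀ j, MeasurableSet (B j) := fun j => hAm.preimage (by fun_prop)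
  have hBv : ∀ j, volume (B j) = volume A := fun j =>
    measure_preimage_add_right volume ((-(2 * s * j)) • ν) A
  have hdis : Pairwise (Function.onFun Disjoint B) := by
    intro i j hij
    rw [Function.onFun, Set.disjoint_left]
    rintro y ⟨hi, -⟩ ⟨hj, -⟩
    simp only [mem_ofPred_eq, hfν, abs_lt] at hi hj
    rcases lt_or_gt_of_ne hij with h | h
    · have : (i : ℝ) + 1 ≤ j := by exact_mod_cast h
      nlinarith
    · have : (j : ℝ) + 1 ≤ i := by exact_mod_cast h
      nlinarith
  have hsub : ⋃ j ∈ Finset.range J, B j ⊆ Metric.closedBall x ((3 + 2 * b) * R) := by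
    refine iUnion₂_subset fun j hj y hy => ?_
    have hjJ : (j : ℝ) ≤ J := by exact_mod_cast (Finset.mem_range.1 hj).le
    have h1 : dist (y + (-(2 * s * j)) • ν) x ≤ R := hy.2
    have h2 : dist y (y + (-(2 * s * j)) • ν) = 2 * s * j := by
      rw [dist_self_add_right, norm_smul, hν, mul_one, norm_neg, Real.norm_of_nonneg (by positivity)]
    have h3 : s * J ≤ R + s := by
      have := mul_le_mul_of_nonneg_left hJ2.le hs.le
      rw [mul_add, mul_div_cancel₀ _ hs.ne'] at this
      linarith
    have h4 : s * j ≤ s * J := mul_le_mul_of_nonneg_left hjJ hs.le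
    rw [Metric.mem_closedBall]
    nlinarith [dist_triangle y (y + (-(2 * s * j)) • ν) x]
  have hsum : (J : ℝ≥0∞) * volume A ≤ ENNReal.ofReal ((3 + 2 * b) ^ n * unitBallVol n * R ^ n) := by
    calc (J : ℝ≥0∞) * volume A = ∑ j ∈ Finset.range J, volume (B j) := by
          simp [hBv]
      _ = volume (⋃ j ∈ Finset.range J, B j) :=
          (measure_biUnion_finset (fun i _ j _ h => hdis h) fun j _ => hBm j).symm
      _ ≤ volume (Metric.closedBall x ((3 + 2 * b) * R)) := measure_mono hsub
      _ = _ := by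
          rw [volume_closedBall_eq (by positivity), mul_pow]
          congr 1
          ring
  have h1 : ENNReal.ofReal (R / s) * volume A ≤ (J : ℝ≥0∞) * volume A := by
    gcongr
    rw [← ENNReal.ofReal_natCast]
    exact ENNReal.ofReal_le_ofReal hJ1
  have h2 : ENNReal.ofReal (s / R) * ENNReal.ofReal (R / s) = 1 := by
    rw [← ENNReal.ofReal_mul (by positivity)]
    rw [show s / R * (R / s) = 1 by field_simp]
    simp
  calc volume A = ENNReal.ofReal (s / R) * (ENNReal.ofReal (R / s) * volume A) := by
        rw [← mul_assoc, h2, one_mul]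
    _ ≤ ENNReal.ofReal (s / R) * ENNReal.ofReal ((3 + 2 * b) ^ n * unitBallVol n * R ^ n) := by
        exact mul_le_mul' le_rfl (h1.trans hsum)
    _ = _ := by rw [← ENNReal.ofReal_mul (by positivity)]

/-- The volume of the part of a tube around `Γ` that lies in a ball. -/
theorem exists_tube_bound {Γ : Set (E n)} (hΓ : IsClosedLipschitzSurface Γ) :
    ∃ C : ℝ, 0 ≤ C ∧ ∀ (x : E n) (R t : ℝ), 0 < t → t ≤ R →
      volume ({y | Metric.infEDist y Γ < ENNReal.ofReal t} ∩ Metric.closedBall x R) ≤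
        ENNReal.ofReal (C * (t / R) * R ^ n) := by
  have hloc : ∀ z : E n, ∃ (ν : E n) (f : E n → ℝ) (b ρ : ℝ), z ∈ Γ → ‖ν‖ = 1 ∧ 0 < ρ ∧ 0 < b ∧
      Continuous f ∧ (∀ y s, f (y + s • ν) = f y + s) ∧ (∀ y w, |f y - f w| ≤ b * dist y w) ∧
      ∀ y ∈ Metric.ball z ρ, y ∈ Γ → f y = 0 := by
    intro z
    by_cases hz : z ∈ Γ
    swap
    · exact ⟨0, 0, 0, 0, fun h => absurd h hz⟩
    obtain ⟨ν, L, g, ρ, hν, hρ, hg, hG⟩ := hΓ.2 z hz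
    have hi : Continuous fun y : E n => (inner ℝ ν y : ℝ) := by fun_prop
    -- The height above the graph, with Lipschitz constant `1 + 2 * L` because the projection onto
    -- the hyperplane is estimated crudely by `2`.
    refine ⟨ν, fun y => inner ℝ ν y - g (y - inner ℝ ν y • ν), 1 + 2 * L, ρ, fun _ =>
      ⟨hν, hρ, by positivity, hi.sub (hg.continuous.comp (continuous_id.sub (hi.smul continuous_const))),
        fun y s => ?_, fun y w => ?_, fun y hy hyΓ => ?_⟩⟩
    · have e : (inner ℝ ν (y + s • ν) : ℝ) = inner ℝ ν y + s := by
        rw [inner_add_right, inner_smul_right, real_inner_self_eq_norm_sq, hν]; ring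
      have e2 : y + s • ν - (inner ℝ ν y + s) • ν = y - (inner ℝ ν y : ℝ) • ν := by
        rw [add_smul]; abel
      beta_reduce
      rw [e, e2]
      ring
    · have h1 : |(inner ℝ ν y : ℝ) - inner ℝ ν w| ≤ dist y w := by
        rw [← inner_sub_right, dist_eq_norm]
        simpa [hν] using abs_real_inner_le_norm ν (y - w)
      have h2 : dist (y - (inner ℝ ν y : ℝ) • ν) (w - (inner ℝ ν w : ℝ) • ν) ≤ 2 * dist y w := by
        refine (dist_sub_sub_le _ _ _ _).trans ?_
        have : dist ((inner ℝ ν y : ℝ) • ν) ((inner ℝ ν w : ℝ) • ν) ≤ dist y w := by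
          rw [dist_eq_norm, ← sub_smul, norm_smul, hν, mul_one]
          exact h1
        linarith
      have h3 := hg.dist_le_mul (y - (inner ℝ ν y : ℝ) • ν) (w - (inner ℝ ν w : ℝ) • ν)
      rw [Real.dist_eq] at h3
      have h4 : (L : ℝ) * dist (y - (inner ℝ ν y : ℝ) • ν) (w - (inner ℝ ν w : ℝ) • ν) ≤
          L * (2 * dist y w) := mul_le_mul_of_nonneg_left h2 L.2
      calc _ = |((inner ℝ ν y : ℝ) - inner ℝ ν w) - (g (y - (inner ℝ ν y : ℝ) • ν) -
              g (w - (inner ℝ ν w : ℝ) • ν))| := by congr 1; ring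
        _ ≤ |(inner ℝ ν y : ℝ) - inner ℝ ν w| + |g (y - (inner ℝ ν y : ℝ) • ν) -
              g (w - (inner ℝ ν w : ℝ) • ν)| := abs_sub _ _
        _ ≤ _ := by linarith
    · exact sub_eq_zero.2 ((hG y hy).1 hyΓ)
  choose ν f b ρ H using hloc
  obtain ⟨T, hTΓ, hcov⟩ := hΓ.1.elim_nhds_subcover (fun z => Metric.ball z (ρ z))
    fun z hz => Metric.ball_mem_nhds z (H z hz).2.1
  have hω := unitBallVol_pos n
  refine ⟨∑ z ∈ T, b z * (3 + 2 * b z) ^ n * unitBallVol n, Finset.sum_nonneg fun z hz => ?_,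
    fun x R t ht htR => ?_⟩
  · have := (H z (hTΓ z hz)).2.2.1
    positivity
  have hR := ht.trans_le htR
  -- Only the nearby point `w` of `Γ` has to lie in a chart. The height function is Lipschitz on the
  -- whole space, so `y` itself may lie outside the chart and `t` need not be small.
  have hsub : {y | Metric.infEDist y Γ < ENNReal.ofReal t} ∩ Metric.closedBall x R ⊆
      ⋃ z ∈ T, {y | |f z y| < b z * t} ∩ Metric.closedBall x R := by
    rintro y ⟨hy, hyB⟩
    obtain ⟨w, hw, hyw⟩ := Metric.infEDist_lt_iff.1 hy
    obtain ⟨z, hzT, hzw⟩ := mem_iUnion₂.1 (hcov hw)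
    obtain ⟨-, -, hb, -, -, hlip, h0⟩ := H z (hTΓ z hzT)
    refine mem_iUnion₂.2 ⟨z, hzT, ?_, hyB⟩
    have h1 := hlip y w
    rw [h0 w hzw hw, sub_zero] at h1
    rw [edist_dist, ENNReal.ofReal_lt_ofReal_iff ht] at hyw
    exact h1.trans_lt (mul_lt_mul_of_pos_left hyw hb)
  refine (measure_mono hsub).trans ((measure_biUnion_finset_le _ _).trans ?_)
  calc ∑ z ∈ T, volume ({y | |f z y| < b z * t} ∩ Metric.closedBall x R)
      ≤ ∑ z ∈ T, ENNReal.ofReal (b z * t / R * ((3 + 2 * b z) ^ n * unitBallVol n * R ^ n)) := by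
        refine Finset.sum_le_sum fun z hz => ?_
        obtain ⟨hν, -, hb, hc, htr, -, -⟩ := H z (hTΓ z hz)
        exact volume_graph_tube_le hν hc htr x hR (by positivity) (by gcongr)
    _ = ENNReal.ofReal (∑ z ∈ T, b z * t / R * ((3 + 2 * b z) ^ n * unitBallVol n * R ^ n)) := by
        rw [ENNReal.ofReal_sum_of_nonneg]
        intro z hz
        have := (H z (hTΓ z hz)).2.2.1
        positivity
    _ = _ := by
        congr 1
        rw [Finset.sum_mul, Finset.sum_mul]
        refine Finset.sum_congr rfl fun z _ => ?_
        ring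

/-- For `α ≥ 0` the integrand is bounded. For `α < 0`, dyadic layers of the distance are summed: the
layer at distance `R 2^(-j)` has volume of order `2^(-j) R^n` and weight of order `R^(2α) 2^(-2αj)`.
The ratio `q = 2^(-(1 + 2α))` is less than one exactly when `α > -1/2`. -/
theorem exists_lintegral_dist_rpow_le {Γ : Set (E n)} (hΓ : IsClosedLipschitzSurface Γ) {α : ℝ}
    (hα : -(1 / 2) < α) :
    ∃ C : ℝ, 0 ≤ C ∧ ∀ (K : Set (E n)) (x : E n) (R : ℝ), 0 < R → MeasurableSet K →
      K ⊆ Metric.closedBall x R → (∀ y ∈ K, Metric.infEDist y Γ ≤ ENNReal.ofReal R) →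
      ∫⁻ y in K, Metric.infEDist y Γ ^ (2 * α) ≤ ENNReal.ofReal (C * (R ^ (2 * α) * R ^ n)) := by
  have hω := unitBallVol_pos n
  rcases le_or_gt 0 α with hα0 | hα0
  · refine ⟨unitBallVol n, hω.le, fun K x R hR hK hKx hd => ?_⟩
    calc ∫⁻ y in K, Metric.infEDist y Γ ^ (2 * α)
        ≤ ∫⁻ _y in K, ENNReal.ofReal R ^ (2 * α) :=
          setLIntegral_mono' hK fun y hy => ENNReal.rpow_le_rpow (hd y hy) (by positivity)
      _ = ENNReal.ofReal R ^ (2 * α) * volume K := by simp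
      _ ≤ ENNReal.ofReal R ^ (2 * α) * volume (Metric.closedBall x R) :=
          mul_le_mul' le_rfl (measure_mono hKx)
      _ = _ := by
          rw [volume_closedBall_eq hR.le, ENNReal.ofReal_rpow_of_pos hR,
            ← ENNReal.ofReal_mul (by positivity)]
          congr 1; ring
  obtain ⟨C, hC, htube⟩ := exists_tube_bound hΓ
  set q : ℝ := (1 / 2) ^ (1 + 2 * α) with hq
  have hq0 : 0 < q := by positivity
  have hq1 : q < 1 := Real.rpow_lt_one (by norm_num) (by norm_num) (by linarith)
  refine ⟨(1 / 2) ^ (2 * α) * C * 2 ^ n * (1 - q)⁻¹,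
    mul_nonneg (by positivity) (inv_nonneg.2 (by linarith)), fun K x R hR hK hKx hd => ?_⟩
  -- The factor `2` makes `d < t j` strict for a distance `d` in the `j`-th dyadic interval.
  set t : ℕ → ℝ := fun j => 2 * R * (1 / 2) ^ j with ht
  set w : ℕ → ℝ := fun j => (R * (1 / 2) ^ (j + 1)) ^ (2 * α) with hw
  set A : ℕ → Set (E n) := fun j => {y | Metric.infEDist y Γ < ENNReal.ofReal (t j)} with hA
  have hAm : ∀ j, MeasurableSet (A j) := fun j =>
    (isOpen_lt Metric.continuous_infEDist continuous_const).measurableSet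
  have hpt : ∀ y ∈ K, Metric.infEDist y Γ ^ (2 * α) ≤
      ∑' j, (A j).indicator (fun _ => ENNReal.ofReal (w j)) y := by
    intro y hy
    -- On `Γ` the weight is infinite, but such points lie in every layer and the sum of the weights
    -- diverges too. So the pointwise bound needs no exceptional set.
    by_cases h0 : Metric.infEDist y Γ = 0
    · have hlow : ∀ j, ENNReal.ofReal (R ^ (2 * α)) ≤
          (A j).indicator (fun _ => ENNReal.ofReal (w j)) y := by
        intro j
        have : y ∈ A j := by
          change Metric.infEDist y Γ < ENNReal.ofReal (t j)
          rw [h0]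
          exact ENNReal.ofReal_pos.2 (by positivity)
        rw [indicator_of_mem this]
        refine ENNReal.ofReal_le_ofReal ?_
        refine Real.rpow_le_rpow_of_nonpos (by positivity) ?_ (by linarith)
        exact mul_le_of_le_one_right hR.le (pow_le_one₀ (by norm_num) (by norm_num))
      refine le_trans le_top (le_trans (le_of_eq ?_) (ENNReal.tsum_le_tsum hlow))
      exact (ENNReal.tsum_const_eq_top_of_ne_zero
        (ENNReal.ofReal_pos.2 (by positivity)).ne').symm
    · have hfin : Metric.infEDist y Γ ≠ ⊤ := ((hd y hy).trans_lt ENNReal.ofReal_lt_top).ne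
      set δ := (Metric.infEDist y Γ).toReal with hδ
      have hδe : Metric.infEDist y Γ = ENNReal.ofReal δ := (ENNReal.ofReal_toReal hfin).symm
      have hδ0 : 0 < δ := ENNReal.toReal_pos h0 hfin
      have hδR : δ ≤ R := by
        have := hd y hy
        rwa [hδe, ENNReal.ofReal_le_ofReal_iff hR.le] at this
      obtain ⟨j, hj1, hj2⟩ := exists_nat_pow_near_of_lt_one (x := δ / R) (y := (1 / 2 : ℝ))
        (by positivity) ((div_le_one hR).2 hδR) (by norm_num) (by norm_num)
      rw [lt_div_iff₀ hR] at hj1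
      rw [div_le_iff₀ hR] at hj2
      have hmem : y ∈ A j := by
        change Metric.infEDist y Γ < ENNReal.ofReal (t j)
        rw [hδe, ENNReal.ofReal_lt_ofReal_iff (by positivity)]
        have : 0 < R * (1 / 2) ^ j := by positivity
        simp only [ht]
        linarith
      refine le_trans ?_ (ENNReal.le_tsum j)
      rw [indicator_of_mem hmem, hδe, ENNReal.ofReal_rpow_of_pos hδ0]
      refine ENNReal.ofReal_le_ofReal
        (Real.rpow_le_rpow_of_nonpos (by positivity) ?_ (by linarith))
      linarith
  have hw' : ∀ j, w j * (C * (t j / (2 * R)) * (2 * R) ^ n) =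
      (1 / 2) ^ (2 * α) * C * 2 ^ n * (R ^ (2 * α) * R ^ n) * q ^ j := by
    intro j
    have e1 : t j / (2 * R) = (1 / 2) ^ j := by simp only [ht]; field_simp
    have e2 : w j = R ^ (2 * α) * ((1 / 2) ^ (2 * α) * ((1 / 2) ^ j) ^ (2 * α)) := by
      simp only [hw]
      rw [Real.mul_rpow hR.le (by positivity), pow_succ', Real.mul_rpow (by norm_num) (by positivity)]
    have e3 : ((1 / 2 : ℝ) ^ j) ^ (2 * α) * (1 / 2) ^ j = q ^ j := by
      rw [hq, ← Real.rpow_natCast ((1 / 2) ^ (1 + 2 * α)) j, ← Real.rpow_mul (by norm_num),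
        ← Real.rpow_natCast (1 / 2) j, ← Real.rpow_mul (by norm_num),
        ← Real.rpow_add (by norm_num)]
      congr 1; ring
    rw [e1, e2, mul_pow, ← e3]
    ring
  calc ∫⁻ y in K, Metric.infEDist y Γ ^ (2 * α)
      ≤ ∫⁻ y in K, ∑' j, (A j).indicator (fun _ => ENNReal.ofReal (w j)) y :=
        setLIntegral_mono' hK hpt
    _ ≤ ∫⁻ y in Metric.closedBall x (2 * R), ∑' j, (A j).indicator
          (fun _ => ENNReal.ofReal (w j)) y :=
        lintegral_mono_set (hKx.trans (Metric.closedBall_subset_closedBall (by linarith)))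
    _ = ∑' j, ENNReal.ofReal (w j) * volume (A j ∩ Metric.closedBall x (2 * R)) := by
        rw [lintegral_tsum fun j => (measurable_const.indicator (hAm j)).aemeasurable]
        refine tsum_congr fun j => ?_
        rw [lintegral_indicator_const (hAm j), Measure.restrict_apply (hAm j)]
    _ ≤ ∑' j, ENNReal.ofReal ((1 / 2) ^ (2 * α) * C * 2 ^ n * (R ^ (2 * α) * R ^ n) * q ^ j) := by
        refine ENNReal.tsum_le_tsum fun j => ?_
        have h1 := htube x (2 * R) (t j) (by positivity)
          (mul_le_of_le_one_right (by positivity) (pow_le_one₀ (by norm_num) (by norm_num)))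
        refine (mul_le_mul' le_rfl h1).trans ?_
        rw [← ENNReal.ofReal_mul (by positivity), hw']
    _ = ENNReal.ofReal (∑' j, (1 / 2) ^ (2 * α) * C * 2 ^ n * (R ^ (2 * α) * R ^ n) * q ^ j) :=
        (ENNReal.ofReal_tsum_of_nonneg (fun j => by positivity)
          ((summable_geometric_of_lt_one hq0.le hq1).mul_left _)).symm
    _ = _ := by
        rw [tsum_mul_left, tsum_geometric_of_lt_one hq0.le hq1]
        congr 1; ring

end Surface

/-! ### `H¹` does not embed into `L^∞` in dimension two and more -/

section Embedding

variable {n : ℕ}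

/-- Used for the test function and for its gradient. The pointwise hypothesis is Cauchy–Schwarz with
`S = J`, `a = 1` in the first case, and disjointness of supports with `S = 1`, `a j = 4^j` in the
second. Scaling by `4^j` multiplies the integral by `4^(-jn)`. -/
theorem lintegral_sq_sum_scaled_le {ψ : E n → ℝ} (hψ : Continuous ψ) (hc : HasCompactSupport ψ)
    (Ω : Set (E n)) (x₀ : E n) {J : ℕ} (hJ : 0 < J) {S : ℝ} (hS : 0 ≤ S) (a : ℕ → ℝ)
    (hpt : ∀ x, (∑ j ∈ Finset.range J, a j * ψ ((4 : ℝ) ^ j • (x - x₀))) ^ 2 ≤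
      S * ∑ j ∈ Finset.range J, (a j * ψ ((4 : ℝ) ^ j • (x - x₀))) ^ 2)
    (hb : S * ∑ j ∈ Finset.range J, a j ^ 2 * (1 / (4 : ℝ) ^ j) ^ n ≤ 2 * J) :
    ∫⁻ x in Ω, ‖∑ j ∈ Finset.range J, (1 / (J : ℝ)) * (a j * ψ ((4 : ℝ) ^ j • (x - x₀)))‖ₑ ^ 2 ≤
      ENNReal.ofReal (2 / J * ∫ x, ψ x ^ 2) := by
  have hJ' : (0 : ℝ) < J := by exact_mod_cast hJ
  have hψ2 : Integrable fun x => ψ x ^ 2 := by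
    have := (hψ.mul hψ).integrable_of_hasCompactSupport (μ := volume) hc.mul_left
    simp only [sq]
    exact this
  have hint : ∀ j, Integrable fun x => (a j * ψ ((4 : ℝ) ^ j • (x - x₀))) ^ 2 := by
    intro j
    have h1 := ((hψ2.comp_smul (R := (4 : ℝ) ^ j) (by positivity)).comp_sub_right x₀).const_mul
      (a j ^ 2)
    simpa [mul_pow] using h1
  have hval : ∀ j, ∫ x, (a j * ψ ((4 : ℝ) ^ j • (x - x₀))) ^ 2 =
      a j ^ 2 * (1 / (4 : ℝ) ^ j) ^ n * ∫ x, ψ x ^ 2 := by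
    intro j
    simp only [mul_pow]
    rw [integral_const_mul, integral_sub_right_eq_self (fun x => ψ ((4 : ℝ) ^ j • x) ^ 2),
      Measure.integral_comp_smul_of_nonneg volume (fun x => ψ x ^ 2) _
        (hR := by positivity)]
    simp [mul_assoc]
  have hI : 0 ≤ ∫ x, ψ x ^ 2 := integral_nonneg fun x => sq_nonneg _
  calc ∫⁻ x in Ω, ‖∑ j ∈ Finset.range J, (1 / (J : ℝ)) * (a j * ψ ((4 : ℝ) ^ j • (x - x₀)))‖ₑ ^ 2
      ≤ ∫⁻ x, ‖∑ j ∈ Finset.range J, (1 / (J : ℝ)) * (a j * ψ ((4 : ℝ) ^ j • (x - x₀)))‖ₑ ^ 2 :=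
        setLIntegral_le_lintegral _ _
    _ ≤ ∫⁻ x, ENNReal.ofReal (S / J ^ 2 *
          ∑ j ∈ Finset.range J, (a j * ψ ((4 : ℝ) ^ j • (x - x₀))) ^ 2) := by
        refine lintegral_mono fun x => ?_
        rw [ofReal_sq_eq_enorm, ← Finset.mul_sum]
        refine ENNReal.ofReal_le_ofReal ?_
        rw [mul_pow, one_div, inv_pow, inv_mul_le_iff₀ (by positivity)]
        refine (hpt x).trans (le_of_eq ?_)
        field_simp
    _ = ENNReal.ofReal (∫ x, S / J ^ 2 *
          ∑ j ∈ Finset.range J, (a j * ψ ((4 : ℝ) ^ j • (x - x₀))) ^ 2) :=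
        (ofReal_integral_eq_lintegral_ofReal
          ((integrable_finsetSum _ fun j _ => hint j).const_mul _)
          (Filter.Eventually.of_forall fun x => mul_nonneg (by positivity)
            (Finset.sum_nonneg fun j _ => sq_nonneg _))).symm
    _ ≤ _ := by
        refine ENNReal.ofReal_le_ofReal ?_
        rw [integral_const_mul, integral_finsetSum _ fun j _ => hint j]
        simp only [hval]
        rw [← Finset.sum_mul, ← mul_assoc]
        refine mul_le_mul_of_nonneg_right ?_ hI
        rw [div_mul_eq_mul_div, div_le_div_iff₀ (by positivity) hJ']
        calc _ ≤ 2 * (J : ℝ) * J := mul_le_mul_of_nonneg_right hb hJ'.le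
          _ = _ := by ring

theorem pderiv_comp_scale {φ : E n → ℝ} (hφ : ContDiff ℝ ∞ φ) (c : ℝ) (x₀ : E n) (i : Fin n) :
    pderiv i (fun x => φ (c • (x - x₀))) = fun x => c * pderiv i φ (c • (x - x₀)) := by
  funext x
  have h1 : HasFDerivAt (fun x : E n => c • (x - x₀)) (c • ContinuousLinearMap.id ℝ (E n)) x :=
    ((hasFDerivAt_id x).sub_const x₀).const_smul c
  have h2 := ((hφ.differentiable (by simp) (c • (x - x₀))).hasFDerivAt.comp x h1).fderiv
  have h3 : fderiv ℝ (fun x => φ (c • (x - x₀))) x =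
      (fderiv ℝ φ (c • (x - x₀))).comp (c • ContinuousLinearMap.id ℝ (E n)) := h2
  simp [pderiv, h3]

/-- The bump is locally constant off the closed annulus, so its derivatives can only live there. -/
theorem pderiv_bump_eq_zero (φ : ContDiffBump (0 : E n)) (h1 : φ.rIn = 1) (h2 : φ.rOut = 2)
    (i : Fin n) {y : E n} (hy : pderiv i φ y ≠ 0) : 1 ≤ ‖y‖ ∧ ‖y‖ ≤ 2 := by
  have hz : ∀ c : ℝ, (φ : E n → ℝ) =ᶠ[nhds y] (fun _ => c) → False := by
    intro c hc
    apply hy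
    rw [pderiv, hc.fderiv_eq]
    simp
  constructor
  · by_contra! hlt
    exact hz 1 (φ.eventuallyEq_one_of_mem_ball (by simpa [h1] using hlt))
  · by_contra! hlt
    refine hz 0 ?_
    filter_upwards [(isOpen_lt continuous_const continuous_norm).mem_nhds hlt] with w hw
    exact φ.zero_of_le_dist (by rw [h2, dist_zero_right]; exact le_of_lt hw)

/-- The counterexample is the average of `J` copies of a bump, concentrated at the scales `4^(-j)`
about one point. It equals `1` near that point. The gradients live on disjoint annuli, and for `n ≥
2` each copy has bounded Dirichlet energy, so the average has squared `H¹` norm of order `1 / J`. -/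
theorem two_le_of_embedsInLinfty (hn : 2 ≤ n) {Ω : Set (E n)} (hΩo : IsOpen Ω)
    (hΩ : Ω.Nonempty) {l : ℕ} (hemb : EmbedsInLinfty l Ω) : 2 ≤ l := by
  by_contra! hl
  obtain ⟨x₀, hx₀⟩ := hΩ
  obtain ⟨C, hC⟩ := hemb
  let φ : ContDiffBump (0 : E n) := ⟨1, 2, by norm_num, by norm_num⟩
  have hφ : ContDiff ℝ ∞ φ := φ.contDiff
  have hφc : HasCompactSupport φ := φ.hasCompactSupport
  set I : ℝ := (∫ x, φ x ^ 2) + ∑ i, ∫ x, pderiv i φ x ^ 2 with hI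
  have hI1 : 0 ≤ ∫ x, φ x ^ 2 := integral_nonneg fun x => sq_nonneg _
  have hI2 : ∀ i, 0 ≤ ∫ x, pderiv i φ x ^ 2 := fun i => integral_nonneg fun x => sq_nonneg _
  set N : ℝ := ∑ j ∈ Finset.range 2,
    ∑ _γ ∈ Finset.piAntidiag (Finset.univ : Finset (Fin n)) j, (1 : ℝ) with hN
  have hN0 : 0 ≤ N := Finset.sum_nonneg fun j _ => Finset.sum_nonneg fun _ _ => zero_le_one
  have hI0 : 0 ≤ I := add_nonneg hI1 (Finset.sum_nonneg fun i _ => hI2 i)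
  obtain ⟨J₀, hJ₀⟩ := exists_nat_gt ((C : ℝ) ^ 2 * (N * (2 * I)))
  set J := J₀ + 1 with hJdef
  have hJ : 0 < J := Nat.succ_pos _
  have hJ' : (0 : ℝ) < J := by exact_mod_cast hJ
  set f : ℕ → E n → ℝ := fun j x => φ ((4 : ℝ) ^ j • (x - x₀)) with hf
  have hfs : ∀ j, ContDiff ℝ ∞ (f j) := fun j => hφ.comp (by fun_prop)
  set u : E n → ℝ := fun x => ∑ j ∈ Finset.range J, (1 / (J : ℝ)) * f j x with hu
  have hus : ContDiff ℝ ∞ u := ContDiff.sum fun j _ => contDiff_const.mul (hfs j)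
  -- the derivatives of `u`
  have hder : ∀ γ : Fin n → ℕ, ∑ i, γ i < 2 →
      ∫⁻ x in Ω, ‖multiDeriv γ u x‖ₑ ^ 2 ≤ ENNReal.ofReal (2 * I / J) := by
    intro γ hγ
    rcases Nat.lt_succ_iff_lt_or_eq.1 hγ with h0 | h1
    · have hγ0 : γ = 0 := by
        funext i
        exact (Finset.sum_eq_zero_iff.1 (Nat.lt_one_iff.1 h0)) i (Finset.mem_univ i)
      rw [hγ0, multiDeriv_zero]
      have := lintegral_sq_sum_scaled_le hφ.continuous hφc Ω x₀ hJ hJ'.le (fun _ => 1)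
        (fun x => by
          have := sq_sum_le_card_mul_sum_sq (s := Finset.range J)
            (f := fun j => (1 : ℝ) * φ ((4 : ℝ) ^ j • (x - x₀)))
          simpa using this) (by
          rw [mul_comm]
          refine mul_le_mul_of_nonneg_right ?_ hJ'.le
          calc ∑ j ∈ Finset.range J, (1 : ℝ) ^ 2 * (1 / (4 : ℝ) ^ j) ^ n
              ≤ ∑ j ∈ Finset.range J, (1 / 2 : ℝ) ^ j := by
                refine Finset.sum_le_sum fun j _ => ?_
                rw [one_pow, one_mul, ← one_div_pow]
                calc (((1 : ℝ) / 4) ^ j) ^ n ≤ ((1 / 4) ^ j) ^ 1 :=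
                      pow_le_pow_of_le_one (by positivity)
                        (pow_le_one₀ (by norm_num) (by norm_num)) (by omega)
                  _ = (1 / 4) ^ j := pow_one _
                  _ ≤ (1 / 2) ^ j := by gcongr; norm_num
            _ ≤ 2 := by
                rw [geom_sum_eq (by norm_num)]
                have : (0 : ℝ) < (1 / 2) ^ J := by positivity
                rw [div_le_iff_of_neg (by norm_num)]
                linarith)
      simp only [one_mul] at this
      refine this.trans (ENNReal.ofReal_le_ofReal ?_)
      rw [div_mul_eq_mul_div]
      gcongr
      exact le_add_of_nonneg_right (Finset.sum_nonneg fun i _ => hI2 i)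
    · obtain ⟨i, δ, rfl, hδ⟩ := exists_eq_add_single h1
      have hδ0 : δ = 0 := by
        funext i
        exact (Finset.sum_eq_zero_iff.1 hδ) i (Finset.mem_univ i)
      rw [hδ0, zero_add]
      have e : multiDeriv (Pi.single i 1) u = fun x => ∑ j ∈ Finset.range J,
          (1 / (J : ℝ)) * ((4 : ℝ) ^ j * pderiv i φ ((4 : ℝ) ^ j • (x - x₀))) := by
        rw [hu, multiDeriv_sum (Finset.range J) hfs (fun _ => 1 / (J : ℝ))]
        funext x
        refine Finset.sum_congr rfl fun j _ => ?_
        rw [multiDeriv_single (hfs j), hf, pderiv_comp_scale hφ]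
      rw [e]
      have hdis : ∀ (x : E n) (j k : ℕ), j < k →
          pderiv i φ ((4 : ℝ) ^ j • (x - x₀)) ≠ 0 → pderiv i φ ((4 : ℝ) ^ k • (x - x₀)) ≠ 0 →
          False := by
        intro x j k hjk h1 h2
        have b1 := (pderiv_bump_eq_zero φ rfl rfl i h1).1
        have b2 := (pderiv_bump_eq_zero φ rfl rfl i h2).2
        rw [norm_smul, Real.norm_of_nonneg (by positivity)] at b1 b2
        have h4 : (4 : ℝ) ^ (j + 1) ≤ 4 ^ k := pow_le_pow_right₀ (by norm_num) hjk
        rw [pow_succ] at h4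
        nlinarith [norm_nonneg (x - x₀)]
      refine (lintegral_sq_sum_scaled_le (contDiff_pderiv hφ i).continuous
        (hasCompactSupport_pderiv hφc i) Ω x₀ hJ zero_le_one (fun j => (4 : ℝ) ^ j)
        (fun x => ?_) ?_).trans (ENNReal.ofReal_le_ofReal ?_)
      · rw [one_mul]
        by_cases hex : ∃ j ∈ Finset.range J, pderiv i φ ((4 : ℝ) ^ j • (x - x₀)) ≠ 0
        · obtain ⟨j, hj, hne⟩ := hex
          have hz : ∀ k ∈ Finset.range J, k ≠ j → pderiv i φ ((4 : ℝ) ^ k • (x - x₀)) = 0 := by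
            intro k _ hkj
            by_contra hk
            rcases lt_or_gt_of_ne hkj with h | h
            · exact hdis x k j h hk hne
            · exact hdis x j k h hne hk
          rw [Finset.sum_eq_single j (fun k hk hkj => by rw [hz k hk hkj, mul_zero])
            (fun h => absurd hj h)]
          exact Finset.single_le_sum
            (f := fun j => ((4 : ℝ) ^ j * pderiv i φ ((4 : ℝ) ^ j • (x - x₀))) ^ 2)
            (fun k _ => sq_nonneg _) hj
        · push Not at hex
          rw [Finset.sum_eq_zero fun k hk => by rw [hex k hk, mul_zero]]
          simp only [ne_eq, OfNat.ofNat_ne_zero, not_false_eq_true, zero_pow]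
          exact Finset.sum_nonneg fun k _ => sq_nonneg _
      · rw [one_mul]
        calc ∑ j ∈ Finset.range J, ((4 : ℝ) ^ j) ^ 2 * (1 / (4 : ℝ) ^ j) ^ n
            ≤ ∑ _j ∈ Finset.range J, (1 : ℝ) := by
              refine Finset.sum_le_sum fun j _ => ?_
              have h4 : (0 : ℝ) < 4 ^ j := by positivity
              calc ((4 : ℝ) ^ j) ^ 2 * (1 / (4 : ℝ) ^ j) ^ n
                  ≤ ((4 : ℝ) ^ j) ^ 2 * (1 / (4 : ℝ) ^ j) ^ 2 := by
                    refine mul_le_mul_of_nonneg_left ?_ (by positivity)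
                    exact pow_le_pow_of_le_one (by positivity)
                      ((div_le_one h4).2 (one_le_pow₀ (by norm_num))) hn
                _ = 1 := by rw [← mul_pow, mul_one_div_cancel h4.ne', one_pow]
          _ = J := by simp
          _ ≤ 2 * J := by linarith
      · rw [div_mul_eq_mul_div]
        gcongr
        refine le_trans ?_ (le_add_of_nonneg_left hI1)
        exact Finset.single_le_sum (f := fun i => ∫ x, pderiv i φ x ^ 2) (fun i _ => hI2 i)
          (Finset.mem_univ i)
  -- the norms of `u`
  have hsq : ∀ x : ℝ≥0∞, (x ^ (1 / 2 : ℝ)) ^ 2 = x := by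
    intro x
    rw [← ENNReal.rpow_natCast, ← ENNReal.rpow_mul]
    norm_num
  have hnorm : sobNorm l Ω u ≤ ENNReal.ofReal (N * (2 * I / J)) ^ (1 / 2 : ℝ) := by
    unfold sobNorm
    refine ENNReal.rpow_le_rpow ?_ (by norm_num)
    calc ∑ j ∈ Finset.range (l + 1), semi0 j Ω u ^ 2
        ≤ ∑ j ∈ Finset.range 2, semi0 j Ω u ^ 2 :=
          Finset.sum_le_sum_of_subset (Finset.range_mono (by omega))
      _ ≤ ∑ j ∈ Finset.range 2, ∑ _γ ∈ Finset.piAntidiag (Finset.univ : Finset (Fin n)) j,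
            ENNReal.ofReal (2 * I / J) := by
          refine Finset.sum_le_sum fun j hj => ?_
          rw [semi0_eq hΩo j (G := fun γ => multiDeriv γ u)
            (fun γ _ => isWeakDeriv_of_contDiff hus γ), hsq]
          refine Finset.sum_le_sum fun γ hγ => hder γ ?_
          rw [(Finset.mem_piAntidiag.1 hγ).1]
          exact Finset.mem_range.1 hj
      _ = ENNReal.ofReal (N * (2 * I / J)) := by
          rw [hN, Finset.sum_mul, ENNReal.ofReal_sum_of_nonneg]
          · refine Finset.sum_congr rfl fun j _ => ?_
            rw [Finset.sum_mul, ENNReal.ofReal_sum_of_nonneg]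
            · simp
            · intros; positivity
          · intro j _
            exact mul_nonneg (Finset.sum_nonneg fun _ _ => zero_le_one) (by positivity)
  have hfinite : MemH l Ω u :=
    hnorm.trans_lt (ENNReal.rpow_lt_top_of_nonneg (by norm_num) ENNReal.ofReal_ne_top)
  have hbound := hC u hfinite
  -- but `u = 1` near `x₀`
  have hone : (1 : ℝ≥0∞) ≤ eLpNorm u ⊤ (volume.restrict Ω) := by
    rw [eLpNorm_exponent_top]
    by_contra! hlt
    have hae := enorm_ae_le_eLpNormEssSup u (volume.restrict Ω)
    rw [ae_restrict_iff' hΩo.measurableSet] at hae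
    set V := Ω ∩ Metric.ball x₀ ((1 / 4) ^ J) with hV
    have hVo : IsOpen V := hΩo.inter Metric.isOpen_ball
    have hVne : V.Nonempty := ⟨x₀, hx₀, Metric.mem_ball_self (by positivity)⟩
    have hVpos := hVo.measure_pos volume hVne
    obtain ⟨x, hx, hxV⟩ : ∃ x, (x ∈ Ω → ‖u x‖ₑ ≤ eLpNormEssSup u (volume.restrict Ω)) ∧ x ∈ V := by
      by_contra! hcon
      refine hVpos.ne' (measure_mono_null (fun x hx => ?_) (ae_iff.1 hae))
      exact fun h => hcon x h hx
    have hux : u x = 1 := by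
      have h1 : ∀ j ∈ Finset.range J, f j x = 1 := by
        intro j hj
        refine φ.one_of_mem_closedBall ?_
        have h2 : ‖x - x₀‖ < (1 / 4) ^ J := by
          have := hxV.2
          rwa [Metric.mem_ball, dist_eq_norm] at this
        rw [mem_closedBall_zero_iff, norm_smul, Real.norm_of_nonneg (by positivity)]
        change (4 : ℝ) ^ j * ‖x - x₀‖ ≤ 1
        calc (4 : ℝ) ^ j * ‖x - x₀‖ ≤ 4 ^ J * (1 / 4) ^ J := by
              gcongr
              · norm_num
              · exact (Finset.mem_range.1 hj).le
          _ = 1 := by rw [← mul_pow]; norm_num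
      simp only [hu]
      rw [Finset.sum_congr rfl fun j hj => by rw [h1 j hj]]
      simp only [mul_one, Finset.sum_const, Finset.card_range, nsmul_eq_mul]
      field_simp
    have := hx hxV.1
    rw [hux] at this
    simp only [enorm_one] at this
    exact absurd (this.trans_lt hlt) (lt_irrefl _)
  have hfinal : (1 : ℝ≥0∞) ≤ C * ENNReal.ofReal (N * (2 * I / J)) ^ (1 / 2 : ℝ) :=
    hone.trans (hbound.trans (mul_le_mul' le_rfl hnorm))
  have hsqf : (1 : ℝ≥0∞) ≤ (C * ENNReal.ofReal (N * (2 * I / J)) ^ (1 / 2 : ℝ)) ^ 2 :=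
    one_le_pow₀ hfinal
  rw [mul_pow, hsq, ← ENNReal.ofReal_coe_nnreal, ← ENNReal.ofReal_pow C.coe_nonneg,
    ← ENNReal.ofReal_mul (by positivity), ENNReal.one_le_ofReal] at hsqf
  have hlt : (C : ℝ) ^ 2 * (N * (2 * I)) < J := by
    refine hJ₀.trans ?_
    rw [hJdef]
    push_cast
    linarith
  have : (C : ℝ) ^ 2 * (N * (2 * I / J)) = (C : ℝ) ^ 2 * (N * (2 * I)) / J := by ring
  rw [this, le_div_iff₀ hJ', one_mul] at hsqf
  linarith

end Embedding

/-! ### The geometry of regular meshes -/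

section MeshGeometry

variable {n r : ℕ} {Ω Γ : Set (E n)} {M : Mesh Ω} {h Cs c₁ c₂ σ : ℝ}

theorem convex_cell (M : Mesh Ω) (K : Fin M.N) : Convex ℝ (M.cell K) := by
  have : Convex ℝ (refCube n) := by
    intro x hx y hy a b ha hb hab i
    have h1 := hx i
    have h2 := hy i
    simp only [PiLp.add_apply, PiLp.smul_apply, smul_eq_mul]
    constructor <;> nlinarith
  exact this.affine_image (M.F K : E n →ᵃ[ℝ] E n)

theorem norm_sub_le_of_mem_refCube {x y : E n} (hx : x ∈ refCube n) (hy : y ∈ refCube n) :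
    ‖x - y‖ ≤ √n := by
  rw [EuclideanSpace.norm_eq]
  refine Real.sqrt_le_sqrt ?_
  calc ∑ i, ‖(x - y) i‖ ^ 2 ≤ ∑ _i : Fin n, (1 : ℝ) := by
        refine Finset.sum_le_sum fun i _ => ?_
        have h1 := hx i
        have h2 := hy i
        rw [PiLp.sub_apply, Real.norm_eq_abs, sq_abs]
        nlinarith
    _ = n := by simp

theorem isCompact_refCube : IsCompact (refCube n) := by
  refine Metric.isCompact_of_isClosed_isBounded isClosed_refCube
    (Metric.isBounded_iff.2 ⟨√n, fun x hx y hy => ?_⟩)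
  rw [dist_eq_norm]
  exact norm_sub_le_of_mem_refCube hx hy

theorem isCompact_cell (M : Mesh Ω) (K : Fin M.N) : IsCompact (M.cell K) :=
  isCompact_refCube.image (continuous_affine (M.F K))

theorem dist_le_hK {K : Fin M.N} {x y : E n} (hx : x ∈ M.cell K) (hy : y ∈ M.cell K) :
    dist x y ≤ M.hK K :=
  Metric.dist_le_diam_of_mem (isCompact_cell M K).isBounded hx hy

theorem cell_subset_closure (M : Mesh Ω) (K : Fin M.N) : M.cell K ⊆ closure Ω := by
  rw [M.cover]
  exact subset_iUnion (fun i => M.F i '' refCube n) K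

theorem interior_cell_subset (hΩo : IsOpen Ω) (hΩc : Convex ℝ Ω) (M : Mesh Ω) (K : Fin M.N) :
    interior (M.cell K) ⊆ Ω := by
  rcases Ω.eq_empty_or_nonempty with rfl | hne
  · refine interior_subset.trans ((cell_subset_closure M K).trans ?_)
    rw [closure_empty]
  have h1 := hΩc.interior_closure_eq_interior_of_nonempty_interior (by rwa [hΩo.interior_eq])
  rw [hΩo.interior_eq] at h1
  exact (interior_mono (cell_subset_closure M K)).trans h1.subset

namespace Mesh.Regular

/-- Half of the guaranteed radius `h / Cs` is used because the supremum defining `rhoK` need not be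
attained among open balls known beforehand. The sign of `Cs` is a consequence of regularity once a
cell exists. -/
theorem Cs_pos_and_exists_ball (hM : M.Regular h Cs c₁ c₂) (K : Fin M.N) :
    0 < Cs ∧ ∃ x, Metric.closedBall x (h / (2 * Cs)) ⊆ interior (M.cell K) := by
  have hh := hM.h_pos
  have h1 := (hM.shape K).2
  set S : Set ℝ := {ρ : ℝ | ∃ x, Metric.ball x ρ ⊆ M.cell K} with hS
  have h0 : (0 : ℝ) ∈ S := ⟨0, by simp⟩
  have hρ : M.rhoK K = sSup S := rfl
  -- The supremum of an unbounded set is `0` by convention, which would contradict `0 < h ≤ Cs *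
  -- rhoK`.
  have hbd : BddAbove S := by
    by_contra hcon
    rw [hρ, Real.sSup_of_not_bddAbove hcon, mul_zero] at h1
    linarith
  have hρ0 : 0 ≤ M.rhoK K := le_csSup hbd h0
  have hprod : 0 < Cs * M.rhoK K := hh.trans_le h1
  have hρpos : 0 < M.rhoK K := lt_of_le_of_ne hρ0 fun e => by
    rw [← e, mul_zero] at hprod
    exact lt_irrefl _ hprod
  have hCs : 0 < Cs := pos_of_mul_pos_left hprod hρ0
  refine ⟨hCs, ?_⟩
  have hlt : h / (2 * Cs) < sSup S := by
    rw [← hρ, div_lt_iff₀ (by positivity)]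
    nlinarith
  obtain ⟨ρ, ⟨x, hx⟩, hlt'⟩ := exists_lt_of_lt_csSup ⟨0, h0⟩ hlt
  exact ⟨x, (Metric.closedBall_subset_ball hlt').trans (interior_maximal hx Metric.isOpen_ball)⟩

theorem c₂_pos (hM : M.Regular h Cs c₁ c₂) (hc₁ : 0 < c₁) (K : Fin M.N) : 0 < c₂ := by
  have h1 := hM.quasiUniform K
  have h2 := h1.1.trans h1.2
  exact hc₁.trans_le (le_of_mul_le_mul_right h2 hM.h_pos)

theorem hK_pos (hM : M.Regular h Cs c₁ c₂) (hc₁ : 0 < c₁) (K : Fin M.N) : 0 < M.hK K :=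
  (mul_pos hc₁ hM.h_pos).trans_le (hM.quasiUniform K).1

theorem dist_le (hM : M.Regular h Cs c₁ c₂) {K : Fin M.N} {x y : E n} (hx : x ∈ M.cell K)
    (hy : y ∈ M.cell K) : dist x y ≤ c₂ * h :=
  (dist_le_hK hx hy).trans (hM.quasiUniform K).2

/-- The inscribed ball supplies the volume. The resulting `κ` involves only `n`, `Cs` and `c₂`,
which is the source of all uniformity in the mesh. -/
theorem fatConvex (hM : M.Regular h Cs c₁ c₂) (hc₁ : 0 < c₁) (K : Fin M.N) :
    FatConvex (interior (M.cell K)) (c₂ * h) (unitBallVol n / (2 * Cs * c₂) ^ n) := by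
  have hh := hM.h_pos
  have hc₂ := hM.c₂_pos hc₁ K
  obtain ⟨hCs, x, hx⟩ := hM.Cs_pos_and_exists_ball K
  have hω := unitBallVol_pos n
  refine ⟨isOpen_interior, (convex_cell M K).interior, by positivity, by positivity,
    fun x hx y hy => hM.dist_le (interior_subset hx) (interior_subset hy), ?_⟩
  have hfin : volume (interior (M.cell K)) ≠ ⊤ :=
    ((isCompact_cell M K).isBounded.subset interior_subset).measure_lt_top.ne
  calc unitBallVol n / (2 * Cs * c₂) ^ n * (c₂ * h) ^ n
      = volume.real (Metric.closedBall x (h / (2 * Cs))) := by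
        rw [measureReal_def, volume_closedBall_eq (by positivity),
          ENNReal.toReal_ofReal (by positivity)]
        simp only [div_pow, mul_pow]
        field_simp
    _ ≤ _ := measureReal_mono hx hfin

theorem closure_interior (hM : M.Regular h Cs c₁ c₂) (K : Fin M.N) :
    closure (interior (M.cell K)) = M.cell K := by
  obtain ⟨hCs, x, hx⟩ := hM.Cs_pos_and_exists_ball K
  have hh := hM.h_pos
  rw [(convex_cell M K).closure_interior_eq_closure_of_nonempty_interior
    ⟨x, hx (Metric.mem_closedBall_self (by positivity))⟩, (isClosed_cell M K).closure_eq]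

/-- The inverse of the transformation of a cell has a derivative of the order `1 / h`. -/
theorem norm_linear_symm_le (hM : M.Regular h Cs c₁ c₂) (K : Fin M.N) :
    ‖LinearMap.toContinuousLinearMap ((M.F K).symm.linear : E n →ₗ[ℝ] E n)‖ ≤
      √n * (2 * Cs) / h := by
  obtain ⟨hCs, x, hx⟩ := hM.Cs_pos_and_exists_ball K
  have hh := hM.h_pos
  refine ContinuousLinearMap.opNorm_le_of_unit_norm (by positivity) fun z hz => ?_
  have hs : 0 < h / (2 * Cs) := by positivity
  -- A radius of the inscribed ball is mapped by the inverse into the cube, whose diameter is at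
  -- most `√n`.
  have h1 : x + (h / (2 * Cs)) • z ∈ M.cell K := by
    refine interior_subset (hx ?_)
    rw [Metric.mem_closedBall, dist_eq_norm, add_sub_cancel_left, norm_smul, hz, mul_one,
      Real.norm_of_nonneg hs.le]
  have h2 : x ∈ M.cell K := interior_subset (hx (Metric.mem_closedBall_self hs.le))
  have h3 := norm_sub_le_of_mem_refCube (symm_mem_refCube h1) (symm_mem_refCube h2)
  rw [affine_add_smul, add_sub_cancel_left, norm_smul, Real.norm_of_nonneg hs.le] at h3
  change ‖(M.F K).symm.linear z‖ ≤ _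
  rw [le_div_iff₀ hh]
  rw [div_mul_eq_mul_div, div_le_iff₀ (by positivity)] at h3
  linarith

end Mesh.Regular

/-- The shape functions of a cell. -/
def cellShape (M : Mesh Ω) (K : Fin M.N) (r : ℕ) (a : Fin n → Fin (r + 1)) : E n → ℝ :=
  fun x => shape r a ((M.F K).symm x)

theorem symm_eq_linear_add (F : E n ≃ᵃ[ℝ] E n) (x : E n) :
    F.symm x = LinearMap.toContinuousLinearMap (F.symm.linear : E n →ₗ[ℝ] E n) x + F.symm 0 := by
  have := affine_add_smul F.symm 0 1 x
  rw [zero_add, one_smul, one_smul] at this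
  rw [this, add_comm]
  rfl

theorem contDiff_cellShape (M : Mesh Ω) (K : Fin M.N) (a : Fin n → Fin (r + 1)) :
    ContDiff ℝ ∞ (cellShape M K r a) := by
  have e : cellShape M K r a = fun x => shape r a
      (LinearMap.toContinuousLinearMap ((M.F K).symm.linear : E n →ₗ[ℝ] E n) x + (M.F K).symm 0) :=
    funext fun x => by rw [cellShape, symm_eq_linear_add]
  rw [e]
  exact (contDiff_shape a).comp
    ((ContinuousLinearMap.contDiff _).add contDiff_const)

/-- The chain rule for an affine map, with the derivatives of the finitely many reference functions
bounded on the compact cube. -/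
theorem exists_multiDeriv_cellShape_le (n r m : ℕ) : ∃ C : ℝ, 0 ≤ C ∧
    ∀ {Ω : Set (E n)} {M : Mesh Ω} {h Cs c₁ c₂ : ℝ}, M.Regular h Cs c₁ c₂ → ∀ (K : Fin M.N)
      (a : Fin n → Fin (r + 1)) (γ : Fin n → ℕ), ∑ i, γ i = m → ∀ x ∈ M.cell K,
        |multiDeriv γ (cellShape M K r a) x| ≤ C * (√n * (2 * Cs) / h) ^ m := by
  have hb : ∀ a : Fin n → Fin (r + 1), ∃ C : ℝ, ∀ y ∈ refCube n,
      ‖iteratedFDeriv ℝ m (shape r a) y‖ ≤ C := fun a =>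
    isCompact_refCube.exists_bound_of_continuousOn
      ((contDiff_shape a).continuous_iteratedFDeriv (by exact_mod_cast le_top)).continuousOn
  choose C hC using hb
  have h0 : (0 : E n) ∈ refCube n := fun i => by simp
  have hC0 : ∀ a, 0 ≤ C a := fun a => (norm_nonneg _).trans (hC a 0 h0)
  refine ⟨∑ a, C a, Finset.sum_nonneg fun a _ => hC0 a, ?_⟩
  intro Ω M h Cs c₁ c₂ hM K a γ hγ x hx
  refine (abs_multiDeriv_le (contDiff_cellShape M K a) γ x).trans ?_
  rw [hγ]
  set A := LinearMap.toContinuousLinearMap ((M.F K).symm.linear : E n →ₗ[ℝ] E n) with hA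
  set b := (M.F K).symm 0 with hb
  set g : E n → ℝ := fun y => shape r a (y + b) with hg
  have hgs : ContDiff ℝ ∞ g := (contDiff_shape a).comp (contDiff_id.add contDiff_const)
  have e : cellShape M K r a = g ∘ A := by
    funext y
    simp only [cellShape, Function.comp, hg]
    rw [symm_eq_linear_add]
  rw [e, A.iteratedFDeriv_comp_right hgs x (by exact_mod_cast le_top)]
  refine (ContinuousMultilinearMap.norm_compContinuousLinearMap_le _ _).trans ?_
  rw [hg, iteratedFDeriv_comp_add_right, ← symm_eq_linear_add]
  simp only [Finset.prod_const, Finset.card_univ, Fintype.card_fin]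
  have h1 : C a ≤ ∑ a, C a := Finset.single_le_sum (fun a _ => hC0 a) (Finset.mem_univ a)
  exact mul_le_mul ((hC a _ (symm_mem_refCube hx)).trans h1)
    (pow_le_pow_left₀ (norm_nonneg _) (hM.norm_linear_symm_le K) m) (by positivity)
    ((hC0 a).trans h1)

/-! Cells and the distance to the interface -/

theorem infEDist_le_of_isIn {K : Fin M.N} (hK : M.IsIn Γ σ h K) {x : E n} (hx : x ∈ M.cell K) :
    Metric.infEDist x Γ ≤ ENNReal.ofReal (σ * h) :=
  (iSup₂_le_iff.1 hK) x hx

theorem Mesh.Regular.infEDist_le (hM : M.Regular h Cs c₁ c₂) {K : Fin M.N} {x y : E n}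
    (hx : x ∈ M.cell K) (hy : y ∈ M.cell K) :
    Metric.infEDist x Γ ≤ Metric.infEDist y Γ + ENNReal.ofReal (c₂ * h) := by
  refine (Metric.infEDist_le_infEDist_add_edist (y := y)).trans ?_
  gcongr
  rw [edist_dist]
  exact ENNReal.ofReal_le_ofReal (hM.dist_le hx hy)

/-- Otherwise one point closer than `(σ - c₂) * h`, together with the diameter bound `c₂ * h`, would
put the whole cell within `σ * h` of `Γ`. The assumption `c₂ < σ` makes the bound positive. -/
theorem Mesh.Regular.le_infEDist_of_not_isIn (hM : M.Regular h Cs c₁ c₂) (hc₁ : 0 < c₁)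
    (hσ : c₂ < σ) {K : Fin M.N} (hK : ¬ M.IsIn Γ σ h K) {x : E n} (hx : x ∈ M.cell K) :
    ENNReal.ofReal ((σ - c₂) * h) ≤ Metric.infEDist x Γ := by
  have hh := hM.h_pos
  have hc₂ := hM.c₂_pos hc₁ K
  by_contra! hlt
  refine hK (iSup₂_le fun y hy => (hM.infEDist_le hy hx).trans ?_)
  refine (add_le_add_left hlt.le _).trans ?_
  rw [← ENNReal.ofReal_add (mul_nonneg (sub_pos.2 hσ).le hh.le) (by positivity)]
  exact ENNReal.ofReal_le_ofReal (by linarith)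

theorem Mesh.Regular.infEDist_le_of_inter (hM : M.Regular h Cs c₁ c₂) (hc₁ : 0 < c₁)
    (hσ : c₂ < σ) {K K' : Fin M.N} (hK : M.IsIn Γ σ h K)
    (hKK : (M.cell K' ∩ M.cell K).Nonempty) {x : E n} (hx : x ∈ M.cell K') :
    Metric.infEDist x Γ ≤ ENNReal.ofReal ((σ + c₂) * h) := by
  have hh := hM.h_pos
  have hc₂ := hM.c₂_pos hc₁ K
  have hσ0 := hc₂.trans hσ
  obtain ⟨y, hy', hy⟩ := hKK
  refine (hM.infEDist_le hx hy').trans ?_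
  rw [add_mul, ENNReal.ofReal_add (by positivity) (by positivity)]
  gcongr
  exact infEDist_le_of_isIn hK hy

theorem Mesh.Regular.cell_subset_sdiff (hM : M.Regular h Cs c₁ c₂) (hc₁ : 0 < c₁)
    (hσ : c₂ < σ) {K : Fin M.N} (hK : ¬ M.IsIn Γ σ h K) : M.cell K ⊆ closure Ω \ Γ := by
  refine fun x hx => ⟨cell_subset_closure M K hx, fun hxΓ => ?_⟩
  have h1 := hM.le_infEDist_of_not_isIn hc₁ hσ hK hx
  rw [Metric.infEDist_zero_of_mem hxΓ] at h1
  have h2 : 0 < (σ - c₂) * h := mul_pos (sub_pos.2 hσ) hM.h_pos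
  exact absurd h1 (not_le.2 (ENNReal.ofReal_pos.2 h2))

theorem Mesh.Regular.interior_subset_sdiff (hΩo : IsOpen Ω) (hΩc : Convex ℝ Ω)
    (hM : M.Regular h Cs c₁ c₂) (hc₁ : 0 < c₁) (hσ : c₂ < σ) {K : Fin M.N}
    (hK : ¬ M.IsIn Γ σ h K) : interior (M.cell K) ⊆ Ω \ Γ := fun _ hx =>
  ⟨interior_cell_subset hΩo hΩc M K hx, (hM.cell_subset_sdiff hc₁ hσ hK (interior_subset hx)).2⟩

end MeshGeometry

/-! ### Estimates for the interpolation operator -/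

section Interpolation

variable {n r : ℕ} {Ω Γ D : Set (E n)} {M : Mesh Ω} {R κ h Cs c₁ c₂ σ : ℝ} {u : E n → ℝ}
  {G : (Fin n → ℕ) → E n → ℝ}

theorem lintegral_sq_eq_ms (h : FatConvex D R κ) {f : E n → ℝ}
    (hf : MemLp f 2 (volume.restrict D)) :
    ∫⁻ x in D, ‖f x‖ₑ ^ 2 = ENNReal.ofReal (volume.real D * ms D f) := by
  have hV := h.vol_pos
  simp only [ofReal_sq_eq_enorm]
  rw [← ofReal_integral_eq_lintegral_ofReal hf.integrable_sq
    (Filter.Eventually.of_forall fun x => sq_nonneg _), ms, mul_inv_cancel_left₀ hV.ne']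

/-- The scaled form of the embedding shared by both estimates: a single `T` dominates the mean
squares of all derivatives up to order two, each multiplied by its natural power of `R`. -/
theorem abs_le_of_ms_le (hn : n ≤ 3) (h : FatConvex D R κ) (hu : SobFam 2 D u G) {w : E n → ℝ}
    (hw : ContinuousOn w (closure D)) (hwu : w =ᵐ[volume.restrict D] u) {T : ℝ} (hT : 0 ≤ T)
    (hG : ∀ γ, ∑ i, γ i ≤ 2 → R ^ (2 * ∑ i, γ i) * ms D (G γ) ≤ T ^ 2) {x : E n}
    (hx : x ∈ closure D) : |w x| ≤ (1 + sobConst n κ * (2 * n)) * T := by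
  obtain ⟨v, hv, hvu, hb⟩ := hu.sup_le hn h
  have e : w x = v x := eqOn_closure_of_ae_eq h.isOpen hw hv subset_closure
    (hwu.trans hvu.symm) ⟨hx, hx⟩
  rw [e]
  refine (hb x hx).trans ?_
  have hR := h.R_pos
  have h1s : ∀ i : Fin n, ∑ j, (Pi.single i 1 : Fin n → ℕ) j = 1 := by simp
  have h2s : ∀ i k : Fin n, ∑ j, (Pi.single i 1 + Pi.single k 1 : Fin n → ℕ) j = 2 := fun i k => by
    rw [sum_add_single, h1s]
  have hn1 : √(n : ℝ) ≤ n := by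
    rw [Real.sqrt_le_left (by positivity), ← Nat.cast_pow]
    exact_mod_cast Nat.le_self_pow two_ne_zero n
  have t0 : √(ms D (G 0)) ≤ T := by
    rw [Real.sqrt_le_left hT]
    simpa using hG 0 (by simp)
  have t1 : R * √(∑ i, ms D (G (Pi.single i 1))) ≤ n * T := by
    have : R * √(∑ i, ms D (G (Pi.single i 1))) = √(∑ i, R ^ 2 * ms D (G (Pi.single i 1))) := by
      rw [← Finset.mul_sum, Real.sqrt_mul (by positivity), Real.sqrt_sq hR.le]
    rw [this]
    calc √(∑ i, R ^ 2 * ms D (G (Pi.single i 1))) ≤ √(∑ _i : Fin n, T ^ 2) :=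
          Real.sqrt_le_sqrt (Finset.sum_le_sum fun i _ => by
            have := hG (Pi.single i 1) (by rw [h1s]; norm_num)
            rwa [h1s] at this)
      _ = √n * T := by simp [Real.sqrt_sq hT]
      _ ≤ _ := mul_le_mul_of_nonneg_right hn1 hT
  have t2 : R ^ 2 * √(∑ i, ∑ k, ms D (G (Pi.single i 1 + Pi.single k 1))) ≤ n * T := by
    have : R ^ 2 * √(∑ i, ∑ k, ms D (G (Pi.single i 1 + Pi.single k 1))) =
        √(∑ i, ∑ k, R ^ 4 * ms D (G (Pi.single i 1 + Pi.single k 1))) := by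
      simp only [← Finset.mul_sum]
      rw [Real.sqrt_mul (by positivity), show R ^ 4 = (R ^ 2) ^ 2 by ring,
        Real.sqrt_sq (by positivity)]
    rw [this]
    calc √(∑ i, ∑ k, R ^ 4 * ms D (G (Pi.single i 1 + Pi.single k 1)))
        ≤ √(∑ _i : Fin n, ∑ _k : Fin n, T ^ 2) :=
          Real.sqrt_le_sqrt (Finset.sum_le_sum fun i _ => Finset.sum_le_sum fun k _ => by
            have := hG (Pi.single i 1 + Pi.single k 1) (h2s i k).le
            rwa [h2s] at this)
      _ = √((n * T) ^ 2) := by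
          congr 1
          simp only [Finset.sum_const, Finset.card_univ, Fintype.card_fin, nsmul_eq_mul]
          ring
      _ = n * T := Real.sqrt_sq (by positivity)
  have hs := sobConst_nonneg n κ
  calc _ ≤ T + sobConst n κ * (n * T + n * T) := by gcongr
    _ = _ := by ring

theorem ms_sub_le (h : FatConvex D R κ) {f g : E n → ℝ} (hf : MemLp f 2 (volume.restrict D))
    {β : ℝ} (hg : ∀ x ∈ D, |g x| ≤ β) :
    ms D (fun x => f x - g x) ≤ 2 * ms D f + 2 * β ^ 2 := by
  have hV := h.vol_pos
  have hfin := h.finite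
  have h1 : ∫ x in D, (f x - g x) ^ 2 ≤ ∫ x in D, (2 * f x ^ 2 + 2 * β ^ 2) := by
    refine integral_mono_of_nonneg (Filter.Eventually.of_forall fun x => sq_nonneg _)
      ((hf.integrable_sq.const_mul 2).add (integrable_const _)) ?_
    filter_upwards [ae_restrict_mem h.isOpen.measurableSet] with x hx
    have h2 : g x ^ 2 ≤ β ^ 2 := sq_le_sq' (abs_le.1 (hg x hx)).1 (abs_le.1 (hg x hx)).2
    nlinarith [sq_nonneg (f x + g x)]
  rw [integral_add (hf.integrable_sq.const_mul 2) (integrable_const _), integral_const_mul,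
    integral_const] at h1
  simp only [measureReal_restrict_apply_univ, smul_eq_mul] at h1
  unfold ms
  rw [inv_mul_le_iff₀ hV]
  calc _ ≤ _ := h1
    _ = _ := by field_simp

theorem interp_eq_sum_cellShape (hr : 0 < r) (hΩo : IsOpen Ω) (hΩc : Convex ℝ Ω) (M : Mesh Ω)
    (Γ : Set (E n)) (σ h : ℝ) (u : E n → ℝ) {K : Fin M.N} {x : E n} (hx : x ∈ M.cell K) :
    M.interp Γ σ h r u x = ∑ a, nodeVal M Γ σ h u (M.F K (gnode r a)) * cellShape M K r a x := by
  have := interp_eq_sum_shape hr hΩo hΩc M Γ σ h u K (symm_mem_refCube hx)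
  rwa [AffineEquiv.apply_symm_apply] at this

theorem isWeakDeriv_interp (hr : 0 < r) (hΩo : IsOpen Ω) (hΩc : Convex ℝ Ω) (M : Mesh Ω)
    (Γ : Set (E n)) (σ h : ℝ) (u : E n → ℝ) (K : Fin M.N) (γ : Fin n → ℕ) :
    IsWeakDeriv γ (interior (M.cell K)) (M.interp Γ σ h r u) (fun x =>
      ∑ a, nodeVal M Γ σ h u (M.F K (gnode r a)) * multiDeriv γ (cellShape M K r a) x) := by
  have hs : ContDiff ℝ ∞ fun x =>
      ∑ a, nodeVal M Γ σ h u (M.F K (gnode r a)) * cellShape M K r a x :=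
    ContDiff.sum fun a _ => contDiff_const.mul (contDiff_cellShape M K a)
  have h1 := isWeakDeriv_of_contDiff (U := interior (M.cell K)) hs γ
  rw [multiDeriv_sum Finset.univ (fun a => contDiff_cellShape M K a)] at h1
  refine h1.congr ?_ (Filter.EventuallyEq.refl _ _)
  filter_upwards [ae_restrict_mem isOpen_interior.measurableSet] with x hx
  exact (interp_eq_sum_cellShape hr hΩo hΩc M Γ σ h u (interior_subset hx)).symm

/-- Reproduction of polynomials of total degree at most `r`, valid on the whole space and hence for
derivatives. -/
theorem multiDeriv_eq_sum_cellShape (hr : 0 < r) (M : Mesh Ω) (K : Fin M.N) {p : E n → ℝ}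
    (hp : p ∈ polySpace n (r + 1)) (γ : Fin n → ℕ) :
    multiDeriv γ p = fun x =>
      ∑ a, p (M.F K (gnode r a)) * multiDeriv γ (cellShape M K r a) x := by
  have e : p = fun x => ∑ a, p (M.F K (gnode r a)) * cellShape M K r a x := by
    funext x
    have := (sepPoly_comp_affine hp (M.F K : E n →ᵃ[ℝ] E n)).eq_sum_shape hr ((M.F K).symm x)
    simpa [cellShape] using this
  conv_lhs => rw [e]
  exact multiDeriv_sum Finset.univ (fun a => contDiff_cellShape M K a) _ γ

theorem abs_sum_mul_le {c s : (Fin n → Fin (r + 1)) → ℝ} {T B : ℝ} (hc : ∀ a, |c a| ≤ T)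
    (hs : ∀ a, |s a| ≤ B) : |∑ a, c a * s a| ≤ (r + 1) ^ n * (T * B) := by
  refine (Finset.abs_sum_le_sum_abs _ _).trans ?_
  calc ∑ a, |c a * s a| ≤ ∑ _a : Fin n → Fin (r + 1), T * B := by
        refine Finset.sum_le_sum fun a _ => ?_
        rw [abs_mul]
        exact mul_le_mul (hc a) (hs a) (abs_nonneg _) ((abs_nonneg _).trans (hc a))
    _ = _ := by simp

theorem rpow_half_le_mul {X Y Z : ℝ≥0∞} (hX : X ≤ Y ^ 2 * Z) :
    X ^ (1 / 2 : ℝ) ≤ Y * Z ^ (1 / 2 : ℝ) := by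
  refine (ENNReal.rpow_le_rpow hX (by norm_num)).trans (le_of_eq ?_)
  rw [ENNReal.mul_rpow_of_nonneg _ _ (by norm_num), ← ENNReal.rpow_natCast, ← ENNReal.rpow_mul]
  norm_num

theorem scaled_error_eq (N c C l T : ℝ) (hc₂ : 0 < c₂) (hh : 0 < h) (m : ℕ) :
    2 * (T ^ 2 / (c₂ ^ (2 * m) * h ^ (2 * m))) + 2 * (N * (c * T * (C * (l / h) ^ m))) ^ 2 =
      (2 / c₂ ^ (2 * m) + 2 * (N * (c * (C * l ^ m))) ^ 2) * T ^ 2 / h ^ (2 * m) := by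
  rw [div_pow, pow_mul' h, pow_mul' c₂]
  have h1 : 0 < h ^ m := by positivity
  have h2 : 0 < c₂ ^ m := by positivity
  generalize h ^ m = x at *
  generalize c₂ ^ m = y at *
  generalize l ^ m = z at *
  field_simp

theorem scaled_sum_eq (N Q B S c₂ : ℝ) (hh : 0 < h) (m d : ℕ) :
    N * (Q * (B * S * (c₂ * h) ^ (2 * (m + d))) / h ^ (2 * m)) =
      N * (Q * (B * c₂ ^ (2 * (m + d)))) * (h ^ d) ^ 2 * S := by
  rw [mul_pow c₂ h, mul_add, pow_add h, pow_mul' h 2 d]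
  have h1 : 0 < h ^ (2 * m) := by positivity
  generalize h ^ (2 * m) = x at *
  field_simp

/-- Replaces powers of `h` by powers of `h_K`, through `c₁ * h ≤ h_K`. -/
theorem mul_sq_le_sq_sqrt_div {A c x y : ℝ} (hA : 0 ≤ A) (hc : 0 < c) (hx : 0 ≤ x)
    (hxy : c * x ≤ y) : A * x ^ 2 ≤ (√A / c * y) ^ 2 := by
  calc A * x ^ 2 = (√A / c * (c * x)) ^ 2 := by
        rw [← mul_assoc, div_mul_cancel₀ _ hc.ne', mul_pow, Real.sq_sqrt hA]
    _ ≤ _ := pow_le_pow_left₀ (by positivity)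
        (mul_le_mul_of_nonneg_left hxy (by positivity)) 2

set_option maxHeartbeats 800000 in
/-- The interpolation error on a cell away from the interface. -/
theorem exists_semi0_sub_interp_le (hn : n ≤ 3) (hΩo : IsOpen Ω) (hΩc : Convex ℝ Ω)
    (hΓ : IsClosed Γ) {k m : ℕ} (hk : 1 ≤ k) (hm : m ≤ k + 1) (hr : k ≤ r) (Cs : ℝ)
    (hc₁ : 0 < c₁) (hσ : c₂ < σ) :
    ∃ C : ℝ, 0 ≤ C ∧ ∀ (M : Mesh Ω) (h : ℝ), M.Regular h Cs c₁ c₂ →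
      ∀ u : E n → ℝ, MemH (k + 1) (Ω \ Γ) u → ∀ K, ¬ M.IsIn Γ σ h K →
        (∀ x ∈ M.cell K ∩ frontier Ω, contRep Ω Γ u x = 0) →
        semi0 m (interior (M.cell K)) (fun x => u x - M.interp Γ σ h r u x) ≤
          ENNReal.ofReal (C * M.hK K ^ ((k : ℝ) + 1 - m)) *
            semi0 (k + 1) (interior (M.cell K)) u := by
  obtain ⟨C', hC'0, hC'⟩ := exists_multiDeriv_cellShape_le n r m
  set κ : ℝ := unitBallVol n / (2 * Cs * c₂) ^ n with hκ
  set b : ℝ := unitBallVol n / κ * n with hb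
  -- Dominates `b^d` for all `d ≤ k + 1`. The absolute value keeps it nonnegative before a cell has
  -- supplied the signs of `Cs` and `c₂`.
  set B : ℝ := (1 + |b|) ^ (k + 1) with hB
  set c : ℝ := 1 + sobConst n κ * (2 * n) with hc
  set L : ℝ := (r + 1) ^ n * (c * (C' * (√n * (2 * Cs)) ^ m)) with hL
  set Q : ℝ := 2 / c₂ ^ (2 * m) + 2 * L ^ 2 with hQ
  set N : ℝ := ((Finset.piAntidiag (Finset.univ : Finset (Fin n)) m).card : ℝ) with hN
  set A : ℝ := N * (Q * (B * c₂ ^ (2 * (k + 1)))) with hA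
  refine ⟨√A / c₁ ^ (k + 1 - m), by positivity, fun M h hM u hu K hK hbd => ?_⟩
  have hh := hM.h_pos
  have hc₂ := hM.c₂_pos hc₁ K
  have hCs := (hM.Cs_pos_and_exists_ball K).1
  have hs := sobConst_nonneg n κ
  have hc0 : 0 ≤ c := by positivity
  have hB0 : 0 ≤ B := by positivity
  have hQ0 : 0 ≤ Q := by positivity
  have hA0 : 0 ≤ A := by positivity
  have hr0 : 0 < r := by omega
  have hF := hM.fatConvex hc₁ K
  rw [← hκ] at hF
  set D := interior (M.cell K) with hD
  set R := c₂ * h with hR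
  have hcl : closure D = M.cell K := hM.closure_interior K
  have hDΓ : D ⊆ Ω \ Γ := hM.interior_subset_sdiff hΩo hΩc hc₁ hσ hK
  have hcellΓ : M.cell K ⊆ closure Ω \ Γ := hM.cell_subset_sdiff hc₁ hσ hK
  obtain ⟨G, hG⟩ := hu.exists_weakDeriv
  have hGΩ : SobFam (k + 1) (Ω \ Γ) u G := hG
  have hGD : SobFam (k + 1) D u G := hGΩ.mono hDΓ
  obtain ⟨hwc, hwu⟩ := contRep_spec hn hΩo hΩc hΓ (hGΩ.of_le (by omega : 2 ≤ k + 1))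
  set w := contRep Ω Γ u with hw
  obtain ⟨p, hp, hpb⟩ := bramble_hilbert hF hGD
  have hps := contDiff_of_mem_polySpace hp
  set S : ℝ := ∑ δ ∈ Finset.piAntidiag (Finset.univ : Finset (Fin n)) (k + 1), ms D (G δ) with hS
  have hS0 : 0 ≤ S := Finset.sum_nonneg fun δ _ => ms_nonneg _ _
  -- One bound for the scaled mean squares of all derivatives of `u - p` up to order `k + 1`.
  set T : ℝ := √(B * S) * R ^ (k + 1) with hT
  have hRpos : 0 < R := hF.R_pos
  have hT0 : 0 ≤ T := by positivity
  have hT2 : T ^ 2 = B * S * R ^ (2 * (k + 1)) := by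
    rw [hT, mul_pow, Real.sq_sqrt (by positivity), ← pow_mul, mul_comm (k + 1) 2]
  have hms : ∀ γ : Fin n → ℕ, ∑ i, γ i ≤ k + 1 →
      R ^ (2 * ∑ i, γ i) * ms D (fun x => G γ x - multiDeriv γ p x) ≤ T ^ 2 := by
    intro γ hγ
    obtain ⟨d, hd⟩ := Nat.exists_eq_add_of_le hγ
    have h1 := hpb γ hγ
    have hd' : k + 1 - ∑ i, γ i = d := by omega
    rw [hd'] at h1
    have hbd : b ^ d ≤ B :=
      calc b ^ d ≤ |b| ^ d := by rw [← abs_pow]; exact le_abs_self _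
        _ ≤ (1 + |b|) ^ d := by gcongr; linarith
        _ ≤ B := pow_le_pow_right₀ (by linarith [abs_nonneg b]) (by omega)
    calc _ ≤ R ^ (2 * ∑ i, γ i) * ((b * R ^ 2) ^ d * S) := by gcongr
      _ = b ^ d * (S * R ^ (2 * (k + 1))) := by rw [hd]; ring
      _ ≤ B * (S * R ^ (2 * (k + 1))) := by gcongr
      _ = T ^ 2 := by rw [hT2]; ring
  have hsub : SobFam (k + 1) D (fun x => u x - p x) (fun γ x => G γ x - multiDeriv γ p x) :=
    hGD.sub_contDiff hF.isBounded hF.isOpen.measurableSet hps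
  have hsup : ∀ x ∈ M.cell K, |w x - p x| ≤ c * T := by
    intro x hx
    refine abs_le_of_ms_le hn hF (hsub.of_le (by omega : 2 ≤ k + 1))
      (w := fun x => w x - p x) ?_ ?_ hT0 (fun γ hγ => hms γ (by omega)) (hcl ▸ hx)
    · rw [hcl]
      exact (hwc.mono hcellΓ).sub hps.continuous.continuousOn
    · have := ae_restrict_of_ae_restrict_of_subset hDΓ hwu
      filter_upwards [this] with x hx
      rw [hx]
  have hnode : ∀ a, nodeVal M Γ σ h u (M.F K (gnode r a)) = w (M.F K (gnode r a)) := by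
    intro a
    have hmem : M.F K (gnode r a) ∈ M.cell K := mem_image_of_mem _ (gnode_mem_refCube a)
    unfold nodeVal
    split_ifs with hcase
    · rfl
    -- The node belongs to the outer cell `K`, so it can only have been dropped for lying on the
    -- boundary of `Ω`, where `u` vanishes by assumption.
    · have hnΩ : M.F K (gnode r a) ∉ Ω := fun hin => hcase ⟨hin, K, hK, hmem⟩
      refine (hbd _ ⟨hmem, ?_⟩).symm
      rw [hΩo.frontier_eq]
      exact ⟨cell_subset_closure M K hmem, hnΩ⟩
  set H : (Fin n → ℕ) → E n → ℝ := fun γ x => G γ x -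
    ∑ a, nodeVal M Γ σ h u (M.F K (gnode r a)) * multiDeriv γ (cellShape M K r a) x with hH
  have hHw : ∀ γ, ∑ i, γ i = m →
      IsWeakDeriv γ D (fun x => u x - M.interp Γ σ h r u x) (H γ) := fun γ hγ =>
    (hGD γ (hγ.trans_le hm)).1.sub (isWeakDeriv_interp hr0 hΩo hΩc M Γ σ h u K γ)
  have hHL : ∀ γ, ∑ i, γ i = m → MemLp (H γ) 2 (volume.restrict D) := fun γ hγ =>
    (hGD γ (hγ.trans_le hm)).2.sub (memLp_of_continuous hF.isBounded hF.isOpen.measurableSet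
      (continuous_finsetSum _ fun a _ => continuous_const.mul
        (contDiff_multiDeriv (contDiff_cellShape M K a) γ).continuous))
  have hHms : ∀ γ, ∑ i, γ i = m → ms D (H γ) ≤ Q * (B * S * R ^ (2 * (k + 1))) / h ^ (2 * m) := by
    intro γ hγ
    -- Since `p` is reproduced, the error of `u` is `u - p` minus the interpolant of `u - p`.
    have e : H γ = fun x => (G γ x - multiDeriv γ p x) -
        ∑ a, (w (M.F K (gnode r a)) - p (M.F K (gnode r a))) *
          multiDeriv γ (cellShape M K r a) x := by
      funext x
      rw [multiDeriv_eq_sum_cellShape hr0 M K (polySpace_mono (by omega) hp) γ]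
      simp only [hH, hnode, sub_mul, Finset.sum_sub_distrib]
      ring
    rw [e]
    have hβ := ms_sub_le hF (f := fun x => G γ x - multiDeriv γ p x)
      (hsub γ (hγ.trans_le hm)).2 (g := fun x =>
        ∑ a, (w (M.F K (gnode r a)) - p (M.F K (gnode r a))) * multiDeriv γ (cellShape M K r a) x)
      (fun x hx => abs_sum_mul_le
        (fun a => hsup _ (mem_image_of_mem _ (gnode_mem_refCube a)))
        (fun a => hC' hM K a γ hγ x (interior_subset hx)))
    refine hβ.trans ?_
    have h1 := hms γ (hγ.trans_le hm)
    rw [hγ, mul_comm, ← le_div_iff₀ (by positivity)] at h1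
    calc _ ≤ 2 * (T ^ 2 / R ^ (2 * m)) +
          2 * ((r + 1) ^ n * (c * T * (C' * (√n * (2 * Cs) / h) ^ m))) ^ 2 := by gcongr
      _ = Q * T ^ 2 / h ^ (2 * m) := by
          rw [hQ, hL, hR, mul_pow c₂ h]
          exact scaled_error_eq _ _ _ _ _ hc₂ hh m
      _ = _ := by rw [hT2]
  rw [semi0_eq hF.isOpen m hHw, semi0_eq hF.isOpen (k + 1) fun γ hγ => (hGD γ hγ.le).1]
  refine rpow_half_le_mul ?_
  have hV := hF.vol_pos
  rw [Finset.sum_congr rfl fun γ hγ => lintegral_sq_eq_ms hF (hHL γ (Finset.mem_piAntidiag.1 hγ).1),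
    Finset.sum_congr rfl fun γ hγ => lintegral_sq_eq_ms hF
      (hGD γ (Finset.mem_piAntidiag.1 hγ).1.le).2,
    ← ENNReal.ofReal_sum_of_nonneg fun γ _ => mul_nonneg hV.le (ms_nonneg _ _),
    ← ENNReal.ofReal_sum_of_nonneg fun γ _ => mul_nonneg hV.le (ms_nonneg _ _),
    ← Finset.mul_sum, ← Finset.mul_sum, ← hS]
  have hKpos := hM.hK_pos hc₁ K
  have he : M.hK K ^ ((k : ℝ) + 1 - m) = M.hK K ^ (k + 1 - m) := by
    rw [← Real.rpow_natCast, Nat.cast_sub hm]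
    push_cast
    rfl
  rw [he, ← ENNReal.ofReal_pow (by positivity), ← ENNReal.ofReal_mul (by positivity)]
  refine ENNReal.ofReal_le_ofReal ?_
  obtain ⟨d, hd⟩ := Nat.exists_eq_add_of_le hm
  have hd' : k + 1 - m = d := by omega
  rw [hd']
  have hsum : ∑ γ ∈ Finset.piAntidiag (Finset.univ : Finset (Fin n)) m, ms D (H γ) ≤
      A * (h ^ d) ^ 2 * S := by
    calc _ ≤ ∑ γ ∈ Finset.piAntidiag (Finset.univ : Finset (Fin n)) m,
          Q * (B * S * R ^ (2 * (k + 1))) / h ^ (2 * m) :=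
          Finset.sum_le_sum fun γ hγ => hHms γ (Finset.mem_piAntidiag.1 hγ).1
      _ = N * (Q * (B * S * R ^ (2 * (k + 1))) / h ^ (2 * m)) := by
          rw [Finset.sum_const, nsmul_eq_mul]
      _ = _ := by
          rw [hA, hR, hd]
          exact scaled_sum_eq _ _ _ _ _ hh m d
  have hKh : c₁ ^ d * h ^ d ≤ M.hK K ^ d := by
    rw [← mul_pow]
    exact pow_le_pow_left₀ (by positivity) (hM.quasiUniform K).1 d
  have hsq : A * (h ^ d) ^ 2 ≤ (√A / c₁ ^ d * M.hK K ^ d) ^ 2 :=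
    mul_sq_le_sq_sqrt_div hA0 (by positivity) (by positivity) hKh
  calc volume.real D * ∑ γ ∈ Finset.piAntidiag (Finset.univ : Finset (Fin n)) m, ms D (H γ)
      ≤ volume.real D * (A * (h ^ d) ^ 2 * S) := by gcongr
    _ ≤ volume.real D * ((√A / c₁ ^ d * M.hK K ^ d) ^ 2 * S) := by gcongr
    _ = _ := by ring

end Interpolation

/-! ### The interpolation operator near the interface -/

section NearInterface

variable {n r : ℕ} {Ω Γ D : Set (E n)} {M : Mesh Ω} {R κ h Cs c₁ c₂ σ : ℝ} {u : E n → ℝ}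
  {G : (Fin n → ℕ) → E n → ℝ}

/-- The exponents `2 * (ε - l + j)` may have either sign, hence the minimum over both endpoints. -/
theorem min_rpow_le {a b t : ℝ} (ha : 0 < a) (hat : a ≤ t) (htb : t ≤ b) (s : ℝ) :
    min (a ^ s) (b ^ s) ≤ t ^ s := by
  rcases le_total 0 s with hs | hs
  · exact (min_le_left _ _).trans (Real.rpow_le_rpow ha.le hat hs)
  · exact (min_le_right _ _).trans (Real.rpow_le_rpow_of_nonpos (ha.trans_le hat) htb hs)

theorem ofReal_min_rpow_le {a b : ℝ} (ha : 0 < a) {t : ℝ≥0∞} (hat : ENNReal.ofReal a ≤ t)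
    (htb : t ≤ ENNReal.ofReal b) (s : ℝ) : ENNReal.ofReal (min (a ^ s) (b ^ s)) ≤ t ^ s := by
  have ht : t ≠ ⊤ := (htb.trans_lt ENNReal.ofReal_lt_top).ne
  obtain ⟨t, rfl, ht0⟩ : ∃ t', t = ENNReal.ofReal t' ∧ 0 ≤ t' :=
    ⟨t.toReal, (ENNReal.ofReal_toReal ht).symm, ENNReal.toReal_nonneg⟩
  have h1 : a ≤ t := (ENNReal.ofReal_le_ofReal_iff ht0).1 hat
  have hb : 0 < b := by
    have := (ENNReal.ofReal_pos.2 ha).trans_le (hat.trans htb)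
    exact ENNReal.ofReal_pos.1 this
  have h2 : t ≤ b := (ENNReal.ofReal_le_ofReal_iff hb.le).1 htb
  rw [ENNReal.ofReal_rpow_of_pos (ha.trans_le h1)]
  exact ENNReal.ofReal_le_ofReal (min_rpow_le ha h1 h2 s)

theorem MemH.of_le {k l : ℕ} {U : Set (E n)} (hu : MemH k U u) (hl : l ≤ k) : MemH l U u := by
  refine lt_of_le_of_lt (ENNReal.rpow_le_rpow ?_ (by norm_num)) hu
  exact Finset.sum_le_sum_of_subset (Finset.range_mono (by omega))

/-- A bound for the mean square by a weighted norm, where the weight is comparable to `h`. -/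
theorem ms_le_of_wNormSq_le (hF : FatConvex D R κ) {V : Set (E n)} (hDV : D ⊆ V) {a b h : ℝ}
    (ha : 0 < a) (hh : 0 < h)
    (hd : ∀ x ∈ D, ENNReal.ofReal (a * h) ≤ Metric.infEDist x Γ ∧
      Metric.infEDist x Γ ≤ ENNReal.ofReal (b * h))
    {g : E n → ℝ} (hg : MemLp g 2 (volume.restrict D)) {β ν : ℝ}
    (hν : wNormSq Γ β V g ≤ ENNReal.ofReal (ν ^ 2)) :
    min (a ^ (2 * β)) (b ^ (2 * β)) * h ^ (2 * β) * (κ * R ^ n) * ms D g ≤ ν ^ 2 := by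
  have hm0 := ms_nonneg D g
  obtain ⟨x₀, hx₀⟩ := hF.nonempty
  have hb : 0 < b := by
    have h1 := (ENNReal.ofReal_pos.2 (mul_pos ha hh)).trans_le ((hd x₀ hx₀).1.trans (hd x₀ hx₀).2)
    exact pos_of_mul_pos_left (ENNReal.ofReal_pos.1 h1) hh.le
  have hχ : 0 < min (a ^ (2 * β)) (b ^ (2 * β)) :=
    lt_min (Real.rpow_pos_of_pos ha _) (Real.rpow_pos_of_pos hb _)
  set χ := min (a ^ (2 * β)) (b ^ (2 * β)) with hχd
  have hhp : 0 < h ^ (2 * β) := Real.rpow_pos_of_pos hh _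
  have hmin : min ((a * h) ^ (2 * β)) ((b * h) ^ (2 * β)) = χ * h ^ (2 * β) := by
    rw [Real.mul_rpow ha.le hh.le, Real.mul_rpow hb.le hh.le, hχd, min_mul_of_nonneg _ _ hhp.le]
  have h1 : ENNReal.ofReal (χ * h ^ (2 * β)) * ∫⁻ x in D, ‖g x‖ₑ ^ 2 ≤
      ENNReal.ofReal (ν ^ 2) := by
    rw [← lintegral_const_mul' _ _ ENNReal.ofReal_ne_top]
    refine le_trans ?_ hν
    refine le_trans ?_ (lintegral_mono_set hDV)
    refine setLIntegral_mono' hF.isOpen.measurableSet fun x hx => ?_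
    rw [mul_comm, ← hmin]
    exact mul_le_mul' le_rfl (ofReal_min_rpow_le (mul_pos ha hh) (hd x hx).1 (hd x hx).2 _)
  rw [lintegral_sq_eq_ms hF hg, ← ENNReal.ofReal_mul (by positivity),
    ENNReal.ofReal_le_ofReal_iff (sq_nonneg _)] at h1
  calc _ ≤ χ * h ^ (2 * β) * volume.real D * ms D g := by
        gcongr
        exact hF.le_vol
    _ = χ * h ^ (2 * β) * (volume.real D * ms D g) := by ring
    _ ≤ _ := h1

theorem isOpen_patch (M : Mesh Ω) (Γ : Set (E n)) (σ h : ℝ) (K : Fin M.N) :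
    IsOpen (M.patch Γ σ h K) :=
  isOpen_biUnion fun _ _ => isOpen_interior

theorem interior_subset_patch {K K' : Fin M.N} (hK' : ¬ M.IsIn Γ σ h K')
    (hKK : (M.cell K' ∩ M.cell K).Nonempty) : interior (M.cell K') ⊆ M.patch Γ σ h K :=
  subset_biUnion_of_mem (u := fun K' => interior (M.cell K')) (show _ ∧ _ from ⟨hK', hKK⟩)

theorem wNormSq_le_kondNorm_sq {V : Set (E n)} (hV : IsOpen V) {l : ℕ} (hG : SobFam l V u G)
    (ε : ℝ) {γ : Fin n → ℕ} {j : ℕ} (hγ : ∑ i, γ i = j) (hj : j ≤ l) :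
    wNormSq Γ (ε - l + j) V (G γ) ≤ kondNorm Γ l ε V u ^ 2 := by
  have hsq : ∀ x : ℝ≥0∞, (x ^ (1 / 2 : ℝ)) ^ 2 = x := by
    intro x
    rw [← ENNReal.rpow_natCast, ← ENNReal.rpow_mul]
    norm_num
  rw [kondNorm, hsq]
  refine le_trans ?_ (Finset.single_le_sum (f := fun j => semi Γ j (ε - l + j) V u ^ 2)
    (fun _ _ => zero_le) (Finset.mem_range.2 (Nat.lt_succ_of_le hj)))
  rw [semi_eq hV j _ fun δ hδ => (hG δ (hδ.trans_le hj)).1, hsq]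
  exact Finset.single_le_sum (f := fun γ => wNormSq Γ (ε - l + j) V (G γ)) (fun _ _ => zero_le)
    (Finset.mem_piAntidiag.2 ⟨hγ, fun i _ => Finset.mem_univ i⟩)

/-- The order `j` cancels against the weight exponent `ε - l + j`. So all orders contribute the same
power of `h` to a nodal value. -/
theorem rpow_scaling (hh : 0 < h) (j l n : ℕ) (ε : ℝ) :
    h ^ (2 * j) = h ^ (2 * (ε - l + j)) * h ^ n * (h ^ ((l : ℝ) - ε - n / 2)) ^ 2 := by
  rw [← Real.rpow_natCast h (2 * j), ← Real.rpow_natCast h n, ← Real.rpow_natCast _ 2,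
    ← Real.rpow_mul hh.le, ← Real.rpow_add hh, ← Real.rpow_add hh]
  congr 1
  push_cast
  ring

/-- Nodal values on a cell `K` near the interface. -/
theorem exists_abs_nodeVal_le (hn : n ≤ 3) (hΩo : IsOpen Ω) (hΩc : Convex ℝ Ω)
    (hΓ : IsClosed Γ) {l : ℕ} (hl : 2 ≤ l) (ε Cs : ℝ) (hc₁ : 0 < c₁) (hσ : c₂ < σ) :
    ∃ C : ℝ, 0 ≤ C ∧ ∀ (M : Mesh Ω) (h : ℝ), M.Regular h Cs c₁ c₂ →
      ∀ u : E n → ℝ, MemH l (Ω \ Γ) u → ∀ K, M.IsIn Γ σ h K →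
        ∀ ν : ℝ, 0 ≤ ν → kondNorm Γ l ε (M.patch Γ σ h K) u ≤ ENNReal.ofReal ν →
          ∀ x ∈ M.cell K, |nodeVal M Γ σ h u x| ≤ C * (h ^ ((l : ℝ) - ε - n / 2) * ν) := by
  set κ : ℝ := unitBallVol n / (2 * Cs * c₂) ^ n with hκ
  set χ : ℕ → ℝ := fun j =>
    min ((σ - c₂) ^ (2 * (ε - l + j))) ((σ + c₂) ^ (2 * (ε - l + j))) with hχ
  -- Only the orders `0`, `1`, `2` enter the embedding. Absolute values are taken because no cell,
  -- and so no sign of `c₂` or `Cs`, is available yet.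
  set Z : ℝ := ∑ j ∈ Finset.range 3, |c₂ ^ (2 * j) / (χ j * (κ * c₂ ^ n))| with hZ
  have hZ0 : 0 ≤ Z := Finset.sum_nonneg fun j _ => abs_nonneg _
  have hs := sobConst_nonneg n κ
  refine ⟨(1 + sobConst n κ * (2 * n)) * √Z, by positivity,
    fun M h hM u hu K hK ν hν0 hν x hx => ?_⟩
  have hh := hM.h_pos
  have hc₂ := hM.c₂_pos hc₁ K
  have hτ : 0 ≤ h ^ ((l : ℝ) - ε - n / 2) := Real.rpow_nonneg hh.le _
  unfold nodeVal
  split_ifs with hcase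
  swap
  · rw [abs_zero]
    positivity
  -- The node itself witnesses that the outer cell `K'` meets `K`, so `K'` belongs to the patch.
  obtain ⟨hxΩ, K', hK', hxK'⟩ := hcase
  have hKK : (M.cell K' ∩ M.cell K).Nonempty := ⟨x, hxK', hx⟩
  have hF := hM.fatConvex hc₁ K'
  rw [← hκ] at hF
  have hκ0 := hF.κ_pos
  set D := interior (M.cell K') with hD
  have hDV : D ⊆ M.patch Γ σ h K := interior_subset_patch hK' hKK
  have hVΓ : M.patch Γ σ h K ⊆ Ω \ Γ :=
    iUnion₂_subset fun i hi => hM.interior_subset_sdiff hΩo hΩc hc₁ hσ hi.1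
  obtain ⟨G, hG⟩ := hu.exists_weakDeriv
  have hGΩ : SobFam l (Ω \ Γ) u G := hG
  have hGV := hGΩ.mono hVΓ
  have hGD : SobFam l D u G := hGV.mono hDV
  obtain ⟨hwc, hwu⟩ := contRep_spec hn hΩo hΩc hΓ (hGΩ.of_le hl)
  have hcl : closure D = M.cell K' := hM.closure_interior K'
  have hd : ∀ y ∈ D, ENNReal.ofReal ((σ - c₂) * h) ≤ Metric.infEDist y Γ ∧
      Metric.infEDist y Γ ≤ ENNReal.ofReal ((σ + c₂) * h) := fun y hy =>
    ⟨hM.le_infEDist_of_not_isIn hc₁ hσ hK' (interior_subset hy),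
      hM.infEDist_le_of_inter hc₁ hσ hK hKK (interior_subset hy)⟩
  rw [mul_assoc]
  refine abs_le_of_ms_le hn hF (hGD.of_le hl) ?_ (ae_restrict_of_ae_restrict_of_subset
    (hM.interior_subset_sdiff hΩo hΩc hc₁ hσ hK') hwu) (by positivity) (fun γ hγ => ?_)
    (by rwa [hcl])
  · rw [hcl]
    exact hwc.mono (hM.cell_subset_sdiff hc₁ hσ hK')
  obtain ⟨j, hj⟩ : ∃ j, ∑ i, γ i = j := ⟨_, rfl⟩
  rw [hj] at hγ ⊢
  have hw : wNormSq Γ (ε - l + j) (M.patch Γ σ h K) (G γ) ≤ ENNReal.ofReal (ν ^ 2) := by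
    refine (wNormSq_le_kondNorm_sq (isOpen_patch M Γ σ h K) hGV ε hj (hγ.trans hl)).trans ?_
    rw [ENNReal.ofReal_pow hν0]
    gcongr
  have h1 := ms_le_of_wNormSq_le hF hDV (sub_pos.2 hσ) hh hd
    (hGD γ (hj.trans_le (hγ.trans hl))).2 hw
  have hχ0 : 0 < χ j := lt_min (Real.rpow_pos_of_pos (sub_pos.2 hσ) _)
    (Real.rpow_pos_of_pos (by linarith) _)
  change χ j * h ^ (2 * (ε - l + j)) * (κ * (c₂ * h) ^ n) * ms D (G γ) ≤ ν ^ 2 at h1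
  have hZj : c₂ ^ (2 * j) / (χ j * (κ * c₂ ^ n)) ≤ Z :=
    (le_abs_self _).trans (Finset.single_le_sum
      (f := fun j => |c₂ ^ (2 * j) / (χ j * (κ * c₂ ^ n))|) (fun j _ => abs_nonneg _)
      (Finset.mem_range.2 (Nat.lt_succ_of_le hγ)))
  calc (c₂ * h) ^ (2 * j) * ms D (G γ)
      = c₂ ^ (2 * j) / (χ j * (κ * c₂ ^ n)) * (h ^ ((l : ℝ) - ε - n / 2)) ^ 2 *
        (χ j * h ^ (2 * (ε - l + j)) * (κ * (c₂ * h) ^ n) * ms D (G γ)) := by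
        rw [mul_pow, mul_pow, rpow_scaling hh j l n ε]
        field_simp
    _ ≤ Z * (h ^ ((l : ℝ) - ε - n / 2)) ^ 2 * ν ^ 2 := by
        have hms := ms_nonneg D (G γ)
        gcongr
    _ = _ := by
        rw [mul_pow, mul_pow, Real.sq_sqrt hZ0]
        ring

theorem rpow_scaling' (hh : 0 < h) (l m n : ℕ) (α ε : ℝ) :
    (h ^ ((l : ℝ) - ε - n / 2) / h ^ m) ^ 2 * (h ^ (2 * α) * h ^ n) =
      (h ^ ((l : ℝ) - m + α - ε)) ^ 2 := by
  rw [← Real.rpow_natCast h m, ← Real.rpow_sub hh, ← Real.rpow_natCast h n,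
    ← Real.rpow_natCast _ 2, ← Real.rpow_mul hh.le, ← Real.rpow_add hh, ← Real.rpow_add hh,
    ← Real.rpow_natCast _ 2, ← Real.rpow_mul hh.le]
  congr 1
  push_cast
  ring

/-- The stability of the interpolation on a cell near the interface. -/
theorem exists_semi_interp_le (hn : n ≤ 3) (hΩo : IsOpen Ω) (hΩc : Convex ℝ Ω)
    (hΓ : IsClosedLipschitzSurface Γ) {l m : ℕ} (hl : 2 ≤ l) (hm : m ≤ l) (hr : 0 < r)
    {α ε : ℝ} (hα : -(1 / 2) < α) (hε : ε ≤ α) (Cs : ℝ) (hc₁ : 0 < c₁) (hσ : c₂ < σ) :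
    ∃ C : ℝ, 0 ≤ C ∧ ∀ (M : Mesh Ω) (h : ℝ), M.Regular h Cs c₁ c₂ →
      ∀ u : E n → ℝ, MemH l (Ω \ Γ) u → ∀ K, M.IsIn Γ σ h K →
        ∀ ν : ℝ, 0 ≤ ν → kondNorm Γ l ε (M.patch Γ σ h K) u ≤ ENNReal.ofReal ν →
          semi Γ m α (interior (M.cell K)) (M.interp Γ σ h r u) ≤
            ENNReal.ofReal (C * M.hK K ^ ((l : ℝ) - m + α - ε) * ν) := by
  obtain ⟨C₁, hC₁0, hC₁⟩ := exists_abs_nodeVal_le hn hΩo hΩc hΓ.1.isClosed hl ε Cs hc₁ hσ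
  obtain ⟨C₂, hC₂0, hC₂⟩ := exists_multiDeriv_cellShape_le n r m
  obtain ⟨C₃, hC₃0, hC₃⟩ := exists_lintegral_dist_rpow_le hΓ hα
  set L : ℝ := (r + 1) ^ n * (C₁ * (C₂ * (√n * (2 * Cs)) ^ m)) with hL
  set N : ℝ := ((Finset.piAntidiag (Finset.univ : Finset (Fin n)) m).card : ℝ) with hN
  -- Positivity of `σ` follows only from a cell of a regular mesh, hence `|σ|` in the constant.
  set A : ℝ := N * (L ^ 2 * (C₃ * (|σ| ^ (2 * α) * |σ| ^ n))) with hA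
  have hA0 : 0 ≤ A := by positivity
  -- The exponent must be nonnegative for `c₁ * h ≤ h_K` to bound `h^e` by `h_K^e`; this uses `m ≤
  -- l` and `ε ≤ α`.
  have he : 0 ≤ (l : ℝ) - m + α - ε := by
    have : (m : ℝ) ≤ l := by exact_mod_cast hm
    linarith
  set e : ℝ := (l : ℝ) - m + α - ε with hed
  refine ⟨√A / c₁ ^ e, by positivity, fun M h hM u hu K hK ν hν0 hν => ?_⟩
  have hh := hM.h_pos
  have hc₂ := hM.c₂_pos hc₁ K
  have hσ0 := hc₂.trans hσ
  have hCs := (hM.Cs_pos_and_exists_ball K).1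
  have hF := hM.fatConvex hc₁ K
  set D := interior (M.cell K) with hD
  obtain ⟨x₀, hx₀⟩ := hF.nonempty
  set τ : ℝ := h ^ ((l : ℝ) - ε - n / 2) with hτ
  have hτ0 : 0 < τ := Real.rpow_pos_of_pos hh _
  set β : ℝ := (r + 1) ^ n * (C₁ * (τ * ν) * (C₂ * (√n * (2 * Cs) / h) ^ m)) with hβ
  have hβL : β = L * (τ / h ^ m) * ν := by
    rw [hβ, hL, div_pow]
    ring
  have hint : ∫⁻ y in D, Metric.infEDist y Γ ^ (2 * α) ≤
      ENNReal.ofReal (C₃ * ((σ * h) ^ (2 * α) * (σ * h) ^ n)) := by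
    refine hC₃ D x₀ (σ * h) (by positivity) isOpen_interior.measurableSet (fun y hy => ?_)
      fun y hy => infEDist_le_of_isIn hK (interior_subset hy)
    rw [Metric.mem_closedBall]
    exact (hM.dist_le (interior_subset hy) (interior_subset hx₀)).trans (by gcongr)
  have hw : ∀ γ : Fin n → ℕ, ∑ i, γ i = m →
      wNormSq Γ α D (fun x => ∑ a, nodeVal M Γ σ h u (M.F K (gnode r a)) *
        multiDeriv γ (cellShape M K r a) x) ≤
      ENNReal.ofReal (β ^ 2 * (C₃ * ((σ * h) ^ (2 * α) * (σ * h) ^ n))) := by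
    intro γ hγ
    rw [ENNReal.ofReal_mul (by positivity)]
    refine le_trans ?_ (mul_le_mul' le_rfl hint)
    rw [← lintegral_const_mul' _ _ ENNReal.ofReal_ne_top]
    refine setLIntegral_mono' isOpen_interior.measurableSet fun x hx => ?_
    refine mul_le_mul' ?_ le_rfl
    rw [ofReal_sq_eq_enorm]
    refine ENNReal.ofReal_le_ofReal ?_
    have hb := abs_sum_mul_le
      (fun a => hC₁ M h hM u hu K hK ν hν0 hν _ (mem_image_of_mem _ (gnode_mem_refCube a)))
      (fun a => hC₂ hM K a γ hγ x (interior_subset hx))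
    exact sq_le_sq' (abs_le.1 hb).1 (abs_le.1 hb).2
  rw [semi_eq isOpen_interior m α fun γ _ => isWeakDeriv_interp hr hΩo hΩc M Γ σ h u K γ]
  have hhe : 0 ≤ h ^ e := Real.rpow_nonneg hh.le _
  have hKe : c₁ ^ e * h ^ e ≤ M.hK K ^ e := by
    rw [← Real.mul_rpow hc₁.le hh.le]
    exact Real.rpow_le_rpow (by positivity) (hM.quasiUniform K).1 he
  have hKe0 : 0 ≤ M.hK K ^ e := Real.rpow_nonneg (hM.hK_pos hc₁ K).le _
  have hsum : ∑ γ ∈ Finset.piAntidiag (Finset.univ : Finset (Fin n)) m,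
      wNormSq Γ α D (fun x => ∑ a, nodeVal M Γ σ h u (M.F K (gnode r a)) *
        multiDeriv γ (cellShape M K r a) x) ≤
      ENNReal.ofReal (√A / c₁ ^ e * M.hK K ^ e * ν) ^ 2 * 1 := by
    rw [mul_one, ← ENNReal.ofReal_pow (by positivity)]
    refine (Finset.sum_le_sum fun γ hγ => hw γ (Finset.mem_piAntidiag.1 hγ).1).trans ?_
    rw [Finset.sum_const, nsmul_eq_mul, ← ENNReal.ofReal_natCast,
      ← ENNReal.ofReal_mul (by positivity)]
    refine ENNReal.ofReal_le_ofReal ?_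
    calc N * (β ^ 2 * (C₃ * ((σ * h) ^ (2 * α) * (σ * h) ^ n)))
        = A * ((τ / h ^ m) ^ 2 * (h ^ (2 * α) * h ^ n)) * ν ^ 2 := by
          rw [hβL, hA, Real.mul_rpow hσ0.le hh.le, abs_of_pos hσ0]
          ring
      _ = A * (h ^ e) ^ 2 * ν ^ 2 := by rw [hτ, rpow_scaling' hh l m n α ε]
      _ ≤ (√A / c₁ ^ e * M.hK K ^ e) ^ 2 * ν ^ 2 := by
          gcongr
          exact mul_sq_le_sq_sqrt_div hA0 (Real.rpow_pos_of_pos hc₁ _) hhe hKe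
      _ = _ := by ring
  refine (rpow_half_le_mul hsum).trans ?_
  rw [ENNReal.one_rpow, mul_one]

end NearInterface

end ImmersedFEM

end

/-! ### The main theorem -/

open ImmersedFEM in
theorem mainTheorem2 {n : ℕ} (hn : n = 2 ∨ n = 3)
    (Ω : Set (E n)) (hΩo : IsOpen Ω) (hΩb : Bornology.IsBounded Ω) (hΩc : Convex ℝ Ω)
    (Γ : Set (E n)) (hΓ : IsClosedLipschitzSurface Γ) (hΓΩ : Γ ⊆ Ω)
    (k l m r : ℕ) (hl : l ≤ k + 1) (hemb : EmbedsInLinfty l Ω) (hm : m ≤ l) (hr : k ≤ r)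
    (α ε : ℝ) (hα : α ∈ Set.Ioo (-(1 / 2 : ℝ)) (1 / 2)) (hε : ε ≤ α)
    (Cs c₁ c₂ σ : ℝ) (hc₁ : 0 < c₁) (hσ : c₂ < σ) :
    ∃ C : ℝ, 0 < C ∧
      ∀ (M : Mesh Ω) (h : ℝ), M.Regular h Cs c₁ c₂ →
        ∀ u : E n → ℝ, MemH (k + 1) (Ω \ Γ) u → MemV Γ l ε (Ω \ Γ) u →
          (∀ K, ¬ M.IsIn Γ σ h K →
            (∀ x ∈ M.cell K ∩ frontier Ω, contRep Ω Γ u x = 0) →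
            semi0 m (interior (M.cell K)) (fun x => u x - M.interp Γ σ h r u x) ≤
              ENNReal.ofReal (C * M.hK K ^ ((k : ℝ) + 1 - m)) *
                semi0 (k + 1) (interior (M.cell K)) u) ∧
          (∀ K, M.IsIn Γ σ h K →
            semi Γ m α (interior (M.cell K)) (M.interp Γ σ h r u) ≤
              ENNReal.ofReal (C * M.hK K ^ ((l : ℝ) - m + α - ε)) *
                kondNorm Γ l ε (M.patch Γ σ h K) u) := by
  have hn3 : n ≤ 3 := by omega
  rcases Ω.eq_empty_or_nonempty with rfl | hΩ
  -- The failure of the `H¹` embedding needs a point of `Ω`. For empty `Ω` there are no cells at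
  -- all.
  · refine ⟨1, one_pos, fun M h hM u _ _ => ?_⟩
    have hempty : ∀ K : Fin M.N, False := fun K => by
      have h1 := cell_subset_closure M K (mem_image_of_mem (M.F K) (fun i => by simp : 0 ∈ refCube n))
      simp at h1
    exact ⟨fun K => (hempty K).elim, fun K => (hempty K).elim⟩
  have hl2 := two_le_of_embedsInLinfty (by omega) hΩo hΩ hemb
  obtain ⟨C₁, hC₁0, hC₁⟩ := exists_semi0_sub_interp_le hn3 hΩo hΩc hΓ.1.isClosed
    (by omega : 1 ≤ k) (hm.trans hl) hr Cs hc₁ hσ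
  obtain ⟨C₂, hC₂0, hC₂⟩ := exists_semi_interp_le hn3 hΩo hΩc hΓ hl2 hm (by omega : 0 < r) hα.1
    hε Cs hc₁ hσ
  -- The summand `1` makes the constant strictly positive. This also settles the case of an infinite
  -- norm on the patch, where the right-hand side is then `∞`.
  refine ⟨C₁ + C₂ + 1, by positivity, fun M h hM u hu _ => ⟨fun K hK hbd => ?_, fun K hK => ?_⟩⟩
  · refine (hC₁ M h hM u hu K hK hbd).trans (mul_le_mul' (ENNReal.ofReal_le_ofReal ?_) le_rfl)
    exact mul_le_mul_of_nonneg_right (by linarith) (Real.rpow_nonneg (hM.hK_pos hc₁ K).le _)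
  · have hKpos : 0 < M.hK K ^ ((l : ℝ) - m + α - ε) := Real.rpow_pos_of_pos (hM.hK_pos hc₁ K) _
    by_cases htop : kondNorm Γ l ε (M.patch Γ σ h K) u = ⊤
    · rw [htop, ENNReal.mul_top (ENNReal.ofReal_pos.2 (by positivity)).ne']
      exact le_top
    refine (hC₂ M h hM u (hu.of_le hl) K hK _ ENNReal.toReal_nonneg
      (ENNReal.ofReal_toReal htop).ge).trans ?_
    rw [ENNReal.ofReal_mul (by positivity), ENNReal.ofReal_toReal htop]
    refine mul_le_mul' (ENNReal.ofReal_le_ofReal ?_) le_rfl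
    exact mul_le_mul_of_nonneg_right (by linarith) hKpos.le
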